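/- **Setting.** Let $\mathbb{R}^4_1$ be $\mathbb{R}^4$ with the Lorentzian product $\langle v,w\rangle=-(v^1w^4+v^4w^1)+v^2w^2+v^3w^3$. Identify a contact element $(p,n)\in\mathbb{R}^3\times S^2$ with the null line $[x,v]=\{x+tv:t\in\mathbb R\}$ of $\mathbb{R}^4_1$ with $$x=\Big(\tfrac{p^1}{\sqrt2},p^2,p^3,-\tfrac{p^1}{\sqrt2}\Big),\qquad v=\Big(\tfrac{1+n^1}{2},\tfrac{n^2}{\sqrt2},\tfrac{n^3}{\sqrt2},\tfrac{1-n^1}{2}\Big).$$ Let $M$ be a connected smooth surface and $F=(f,n):M\to\mathbb{R}^3\times S^2$ a smooth nondegenerate Legendre immersion: $df\cdot n=0$, $dn\cdot dn>0$, and the quadratic forms $df\cdot dn$ and $dn\cdot dn$ are linearly independent at every point. *Middle frames.* A middle frame field on an open set $U\subset M$ is a smooth map $(a_0;a_1,\dots,a_4)$ on $U$ into the frames of $\mathbb{R}^4_1$ (a point and a positively oriented basis with $\langle a_1,a_4\rangle=-1$, $\langle a_2,a_2\rangle=\langle a_3,a_3\rangle=1$, all other products zero, and $a_1,a_4$ positive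 null vectors, i.e. with negative product with $(1,0,0,1)$) such that $F=[a_0,a_1]$ and, writing $da_j=\sum_i\alpha_j^i a_i$ for $0\le j\le 4$, there are smooth functions $p_1,p_2,p_3,q_1,q_2$ on $U$ with $\alpha_0^1=\alpha_0^4=0$ and $$(\alpha^i_j)_{1\le i,j\le4}=\begin{pmatrix}2q_2\alpha_0^2-2q_1\alpha_0^3& p_1\alpha_0^2+p_2\alpha_0^3& p_2\alpha_0^2+p_3\alpha_0^3&0\\ \alpha_0^2&0&-q_1\alpha_0^2-q_2\alpha_0^3&p_1\alpha_0^2+p_2\alpha_0^3\\ -\alpha_0^3&q_1\alpha_0^2+q_2\alpha_0^3&0&p_2\alpha_0^2+p_3\alpha_0^3\\ 0&\alpha_0^2&-\alpha_0^3&-2q_2\alpha_0^2+2q_1\alpha_0^3\end{pmatrix}.$$ Such frames exist around every point and are unique up to $(a_2,a_3)\mapsto(-a_2,-a_3)$ on connected sets. Put $\varphi=\alpha_0^2+i\alpha_0^3$ and give $M$ the complex structure for which $\varphi$ is of type $(1,0)$. The differentials $$\mathcal Q_F=\big(\tfrac12(p_1-p_3)-ip_2\big)\varphi^4,\qquad \mathcal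 P_F=(p_1+p_3)\varphi^2$$ are globally defined on $M$. *L-minimal.* $F$ is L-minimal if it is critical, for compactly supported variations (inside coordinate domains) through Legendre immersions with $dn\cdot dn>0$, for the Weingarten functional $\int(H^2/K-1)\,dA$. For general Legendre immersions this is read, up to sign, as $\int\big((\tfrac12\operatorname{tr}S)^2-\det S\big)\,dA_{III}$, where $III=dn\cdot dn$ and $S$ is the endomorphism that represents $df\cdot dn$ with respect to $III$. *L-isothermic, Blaschke potential.* $F$ is L-isothermic if around each point there are local coordinates that diagonalize both $\langle da_0,da_0\rangle$ and $\langle da_0,da_1\rangle$ and are isothermal for $\langle da_0,da_0\rangle$. For a smooth function $u$, a coordinate $z=x+iy$ is an isothermic coordinate with potential $e^u$ if $\alpha_0^2=e^u\,dx$, $\alpha_0^3=e^u\,dy$ for some middle frame on its domain. A smooth $u:M\to\mathbb R$ defines a Blaschke potential $\Phi=e^u$ of $F$ if there are isothermic coordinates with potential $e^u$ around each point. **Proposition 3.5.** The quartic differential $\mathcal{Q}_F$ is holomorphic if and only if * $F$ is L-minimal, in which case $\mathcal P_F$ vanishes on $M$; or * $F$ is L-isothermic and has a Blaschke potential $\Phi=e^u$,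 $u:M\to\mathbb R$ smooth, such that for some constant $c\in\mathbb R$ $$\Delta u=c\,e^{-2u},\qquad \Delta=\partial_x^2+\partial_y^2,$$ in all isothermic coordinates $z=x+iy$ with potential $e^u$. The equivalence also holds if in the second alternative $u$ and $c$ are only required locally: $F$ is L-isothermic and around each point there is an isothermic coordinate with some potential $e^u$ such that $\Delta u=c\,e^{-2u}$ on its domain for some $c\in\mathbb R$. -/

import Mathlib

open Set
open scoped Manifold ContDiff InnerProductSpace Laplacian

noncomputable section

namespace Laguerre

/-! ### Minkowski 4-space and Laguerre frames

The basis vectors with indices 1, 2, 3, 4 of the usual notation are indexed here by 0, 1, 2, 3. -/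

/-- Minkowski 4-space as a real vector space. -/
abbrev V4 : Type := Fin 4 → ℝ

/-- Euclidean 3-space. -/
abbrev E3 : Type := EuclideanSpace ℝ (Fin 3)

/-- The Euclidean plane, the model space of surfaces. -/
abbrev E2 : Type := EuclideanSpace ℝ (Fin 2)

/-- The Lorentzian scalar product in null coordinates. -/
def lorentz (v w : V4) : ℝ := -(v 0 * w 3 + v 3 * w 0) + v 1 * w 1 + v 2 * w 2

/-- The Gram matrix `g` of the standard basis for `lorentz`. -/
def gram : Matrix (Fin 4) (Fin 4) ℝ :=
  !![0, 0, 0, -1; 0, 1, 0, 0; 0, 0, 1, 0; -1, 0, 0, 0]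

/-- The positive light cone (null vectors that are positive for the time orientation). -/
def posLightcone : Set V4 := {v | lorentz v v = 0 ∧ lorentz v ![1, 0, 0, 1] < 0}

/-- The matrix with columns `a 0, …, a 3`. -/
def frameMatrix (a : Fin 4 → V4) : Matrix (Fin 4) (Fin 4) ℝ := Matrix.of fun i j => a j i

/-- The vector part of a Laguerre frame: a positively oriented basis with Gram matrix `g` whose
first and last vectors are positive null vectors. -/
def IsLaguerreBasis (a : Fin 4 → V4) : Prop :=
  (∀ i j, lorentz (a i) (a j) = gram i j) ∧ a 0 ∈ posLightcone ∧ a 3 ∈ posLightcone ∧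
    0 < (frameMatrix a).det

/-! ### The cyclographic model -/

/-- The point of Minkowski space which represents the oriented sphere with centre `c` and signed
radius `r`. -/
def spherePoint (c : E3) (r : ℝ) : V4 :=
  ![(r + c 0) / √2, c 1, c 2, (r - c 0) / √2]

/-- The positive null vector attached to an oriented plane with unit normal `n`. -/
def planeNormal (n : E3) : V4 :=
  ![(1 + n 0) / 2, n 1 / √2, n 2 / √2, (1 - n 0) / 2]

/-- The line through `x` with direction `v`. -/
def line (x v : V4) : Set V4 := range fun t : ℝ => x + t • v

/-! ### Legendre immersions -/

section Surface

variable {M : Type*} [TopologicalSpace M] [ChartedSpace E2 M]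

/-- The differential at `p` of a map from a surface to a normed space. -/
def dAt {E : Type*} [NormedAddCommGroup E] [NormedSpace ℝ E] (g : M → E) (p : M) :
    TangentSpace (𝓡 2) p →L[ℝ] E :=
  mfderiv (𝓡 2) 𝓘(ℝ, E) g p

variable (M) in
/-- A Legendre immersion `F = (f, n)` of the surface `M` into the space of contact elements
`ℝ³ × S²`, with `dn · dn > 0`. The latter makes `n`, and so `F`, an immersion. -/
structure LegendreImmersion where
  /-- the point component -/
  f : M → E3
  /-- the unit normal component -/
  n : M → E3
  smooth_f : ContMDiff (𝓡 2) 𝓘(ℝ, E3) ∞ f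
  smooth_n : ContMDiff (𝓡 2) 𝓘(ℝ, E3) ∞ n
  norm_n : ∀ p, ‖n p‖ = 1
  contact : ∀ p (v : TangentSpace (𝓡 2) p), ⟪dAt f p v, n p⟫_ℝ = 0
  pos_third : ∀ p (v : TangentSpace (𝓡 2) p), v ≠ 0 → 0 < ⟪dAt n p v, dAt n p v⟫_ℝ

/-- `F` is nondegenerate: the quadratic forms `df · dn` and `dn · dn` are linearly independent at
every point. -/
def LegendreImmersion.IsNondegenerate (F : LegendreImmersion M) : Prop :=
  ∀ p, LinearIndependent ℝ
    ![fun v : TangentSpace (𝓡 2) p => ⟪dAt F.f p v, dAt F.n p v⟫_ℝ,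
      fun v : TangentSpace (𝓡 2) p => ⟪dAt F.n p v, dAt F.n p v⟫_ℝ]

/-- The value of `F` at `p` as a null line: all oriented spheres in oriented contact at `f p` with
the plane through `f p` with normal `n p`. -/
def LegendreImmersion.nullLine (F : LegendreImmersion M) (p : M) : Set V4 :=
  line (spherePoint (F.f p) 0) (planeNormal (F.n p))

/-- A local Laguerre frame field `(a₀; a₁, …, a₄)` along `F` on the open set `dom`. The vector
`aᵢ` is `a (i - 1)`. -/
structure LaguerreFrameField (F : LegendreImmersion M) where
  /-- the domain -/
  dom : Set M
  isOpen_dom : IsOpen dom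
  /-- the position vector -/
  a₀ : M → V4
  /-- the basis vectors -/
  a : Fin 4 → M → V4
  smooth_a₀ : ContMDiffOn (𝓡 2) 𝓘(ℝ, V4) ∞ a₀ dom
  smooth_a : ∀ i, ContMDiffOn (𝓡 2) 𝓘(ℝ, V4) ∞ (a i) dom
  isLaguerreBasis : ∀ p ∈ dom, IsLaguerreBasis fun i => a i p
  line_eq : ∀ p ∈ dom, line (a₀ p) (a 0 p) = F.nullLine p

namespace LaguerreFrameField

variable {F : LegendreImmersion M} (A : LaguerreFrameField F)

/-- The translation part of `A⁻¹ dA`: the coordinates of `da₀` in the frame. -/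
def trans (p : M) (v : TangentSpace (𝓡 2) p) : V4 :=
  (frameMatrix fun i => A.a i p)⁻¹.mulVec (dAt A.a₀ p v)

/-- The linear part of `A⁻¹ dA`: column `j` holds the coordinates of `d(a j)` in the frame. -/
def rot (p : M) (v : TangentSpace (𝓡 2) p) : Matrix (Fin 4) (Fin 4) ℝ :=
  (frameMatrix fun i => A.a i p)⁻¹ * frameMatrix fun j => dAt (A.a j) p v

end LaguerreFrameField

/-- A middle frame field along `F`, with its invariant functions. In `normal_form`, `θ` and `η`
are the members of the middle coframe. -/
structure MiddleFrame (F : LegendreImmersion M) extends LaguerreFrameField F where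
  (p₁ p₂ p₃ q₁ q₂ : M → ℝ)
  smooth_p₁ : ContMDiffOn (𝓡 2) 𝓘(ℝ, ℝ) ∞ p₁ dom
  smooth_p₂ : ContMDiffOn (𝓡 2) 𝓘(ℝ, ℝ) ∞ p₂ dom
  smooth_p₃ : ContMDiffOn (𝓡 2) 𝓘(ℝ, ℝ) ∞ p₃ dom
  smooth_q₁ : ContMDiffOn (𝓡 2) 𝓘(ℝ, ℝ) ∞ q₁ dom
  smooth_q₂ : ContMDiffOn (𝓡 2) 𝓘(ℝ, ℝ) ∞ q₂ dom
  normal_form : ∀ p ∈ dom, ∀ v : TangentSpace (𝓡 2) p,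
    ∃ θ η : ℝ, toLaguerreFrameField.trans p v = ![0, θ, η, 0] ∧
      toLaguerreFrameField.rot p v =
        !![2 * q₂ p * θ - 2 * q₁ p * η, p₁ p * θ + p₂ p * η, p₂ p * θ + p₃ p * η, 0;
           θ, 0, -(q₁ p * θ) - q₂ p * η, p₁ p * θ + p₂ p * η;
           -η, q₁ p * θ + q₂ p * η, 0, p₂ p * θ + p₃ p * η;
           0, θ, -η, -(2 * q₂ p * θ) + 2 * q₁ p * η]

namespace MiddleFrame

variable {F : LegendreImmersion M} (A : MiddleFrame F)

/-- The complex form `φ = α₀² + i α₀³` built from the middle coframe. -/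
def φ (p : M) (v : TangentSpace (𝓡 2) p) : ℂ :=
  ⟨A.trans p v 1, A.trans p v 2⟩

/-- The coefficient `Q = (p₁ - p₃)/2 - i p₂`. -/
def Q (p : M) : ℂ := ⟨(A.p₁ p - A.p₃ p) / 2, -A.p₂ p⟩

/-- The coefficient `P = p₁ + p₃`. -/
def P (p : M) : ℂ := ((A.p₁ p + A.p₃ p : ℝ) : ℂ)

end MiddleFrame

/-! ### The quartic and the quadratic differential

A differential of degree `k` on the surface is a function `T p v`, homogeneous of degree `k` in
the tangent vector `v` at `p`. -/

open Classical in
/-- The quartic differential `Q φ⁴` of `F`, computed in any middle frame around the point. (The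
value is the same for all of them; if `F` is nondegenerate there is one around each point.) -/
def LegendreImmersion.quarticDifferential (F : LegendreImmersion M) (p : M)
    (v : TangentSpace (𝓡 2) p) : ℂ :=
  if h : ∃ A : MiddleFrame F, p ∈ A.dom then h.choose.Q p * h.choose.φ p v ^ 4 else 0

open Classical in
/-- The quadratic differential `P φ²` of `F`, computed in any middle frame around the point. -/
def LegendreImmersion.quadraticDifferential (F : LegendreImmersion M) (p : M)
    (v : TangentSpace (𝓡 2) p) : ℂ :=
  if h : ∃ A : MiddleFrame F, p ∈ A.dom then h.choose.P p * h.choose.φ p v ^ 2 else 0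

/-- A smooth local coordinate `z = x + i y` on the surface `M`. -/
def IsSmoothCoordinate (z : OpenPartialHomeomorph M ℂ) : Prop :=
  ContMDiffOn (𝓡 2) 𝓘(ℝ, ℂ) ∞ z z.source ∧ ContMDiffOn 𝓘(ℝ, ℂ) (𝓡 2) ∞ z.symm z.target

/-- `z` is a local complex coordinate of the Riemann surface `M` whose complex structure is the one
for which `φ` is of type `(1, 0)`. -/
def LegendreImmersion.IsHolomorphicCoordinate (F : LegendreImmersion M)
    (z : OpenPartialHomeomorph M ℂ) : Prop :=
  IsSmoothCoordinate z ∧ ∀ A : MiddleFrame F, ∀ p ∈ A.dom ∩ z.source,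
    ∃ μ : ℂ, μ ≠ 0 ∧ ∀ v : TangentSpace (𝓡 2) p, A.φ p v = μ * dAt z p v

/-- The differential `T` of degree `k` is holomorphic on the Riemann surface `M`: around each point
it is `h(z) (dz)^k` with `z` a local complex coordinate and `h` a holomorphic function. -/
def LegendreImmersion.IsHolomorphicDifferential (F : LegendreImmersion M) (k : ℕ)
    (T : ∀ p : M, TangentSpace (𝓡 2) p → ℂ) : Prop :=
  ∀ p : M, ∃ z : OpenPartialHomeomorph M ℂ, F.IsHolomorphicCoordinate z ∧ p ∈ z.source ∧
    ∃ h : ℂ → ℂ, DifferentiableOn ℂ h z.target ∧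
      ∀ q ∈ z.source, ∀ v : TangentSpace (𝓡 2) q, T q v = h (z q) * dAt z q v ^ k

/-! ### L-isothermic immersions and the Blaschke potential -/

/-- `F` is L-isothermic: around each point there are local coordinates `x, y` which diagonalize
both `⟨da₀, da₀⟩` and `⟨da₀, da₁⟩` and are isothermal for `⟨da₀, da₀⟩`. -/
def LegendreImmersion.IsLIsothermic (F : LegendreImmersion M) : Prop :=
  ∀ p : M, ∃ z : OpenPartialHomeomorph M ℂ, IsSmoothCoordinate z ∧ p ∈ z.source ∧
    ∀ A : MiddleFrame F, ∀ q ∈ A.dom ∩ z.source, ∃ r b c : ℝ,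
      ∀ v : TangentSpace (𝓡 2) q,
        lorentz (dAt A.a₀ q v) (dAt A.a₀ q v)
          = r * (dAt z q v).re ^ 2 + r * (dAt z q v).im ^ 2 ∧
        lorentz (dAt A.a₀ q v) (dAt (A.a 0) q v)
          = b * (dAt z q v).re ^ 2 + c * (dAt z q v).im ^ 2

/-- `z = x + i y` is an isothermic coordinate of `F` adapted to `Φ`: on its domain the middle
coframe of some middle frame is `(Φ dx, Φ dy)`. -/
def LegendreImmersion.IsIsothermicCoordinate (F : LegendreImmersion M)
    (z : OpenPartialHomeomorph M ℂ) (Φ : M → ℝ) : Prop :=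
  IsSmoothCoordinate z ∧ ∃ A : MiddleFrame F, z.source ⊆ A.dom ∧
    ∀ q ∈ z.source, ∀ v : TangentSpace (𝓡 2) q,
      A.trans q v 1 = Φ q * (dAt z q v).re ∧ A.trans q v 2 = Φ q * (dAt z q v).im

/-- `Φ = e^u` is a Blaschke potential of `F`: `u` is smooth on `M`, and around each point there are
isothermic coordinates in which the middle coframe is `(e^u dx, e^u dy)`. -/
def LegendreImmersion.IsBlaschkePotential (F : LegendreImmersion M) (u : M → ℝ) : Prop :=
  ContMDiff (𝓡 2) 𝓘(ℝ, ℝ) ∞ u ∧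
    ∀ p : M, ∃ z : OpenPartialHomeomorph M ℂ, p ∈ z.source ∧
      F.IsIsothermicCoordinate z fun q => Real.exp (u q)

/-- The equation `Δu = c e^{-2u}` on the domain of the coordinate `z = x + i y`, where
`Δ = ∂²/∂x² + ∂²/∂y²`. -/
def SatisfiesSpecialEquation (z : OpenPartialHomeomorph M ℂ) (u : M → ℝ) (c : ℝ) : Prop :=
  ∀ q ∈ z.source, (Δ (u ∘ z.symm)) (z q) = c * Real.exp (-2 * u q)

/-! ### L-minimal immersions

L-minimality is criticality for the Weingarten functional `∫ (H²/K - 1) dA`. If `III = dn · dn`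
and `II = df · dn`, the matrix `S = III⁻¹ II` has the principal radii of curvature as eigenvalues
up to a common sign, so `(H/K)² = (tr S / 2)²`, `1/K = det S`, and `dA_III = |K| dA`. Hence
`(H²/K - 1) dA = ± ((tr S / 2)² - det S) dA_III` with the sign of `K`, and the right side without
its sign makes sense for all Legendre immersions. -/

/-- The symmetric matrix of scalar products of partial derivatives of `g` and `h` at `x`. -/
def derivGram (g h : E2 → E3) (x : E2) : Matrix (Fin 2) (Fin 2) ℝ :=
  Matrix.of fun i j => ⟪fderiv ℝ g x (EuclideanSpace.single i 1),
    fderiv ℝ h x (EuclideanSpace.single j 1)⟫_ℝ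

/-- The Weingarten integrand of a Legendre immersion `(f, n)` of a plane domain. -/
def weingartenDensity (f n : E2 → E3) (x : E2) : ℝ :=
  (((derivGram n n x)⁻¹ * derivGram f n x).trace ^ 2 / 4
    - ((derivGram n n x)⁻¹ * derivGram f n x).det) * √(derivGram n n x).det

/-- `(ft t, nt t)`, `|t| < ε`, is a smooth variation of `(f, n)` on the open set `D` through
Legendre immersions with `dn · dn > 0`, supported in the compact set `K`. -/
structure IsLegendreVariation (D : Set E2) (f n : E2 → E3) (K : Set E2) (ε : ℝ)
    (ft nt : ℝ → E2 → E3) : Prop where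
  pos : 0 < ε
  compact : IsCompact K
  subset : K ⊆ D
  smooth_f : ContDiffOn ℝ ∞ (fun y : ℝ × E2 => ft y.1 y.2) (Ioo (-ε) ε ×ˢ D)
  smooth_n : ContDiffOn ℝ ∞ (fun y : ℝ × E2 => nt y.1 y.2) (Ioo (-ε) ε ×ˢ D)
  norm_n : ∀ t ∈ Ioo (-ε) ε, ∀ x ∈ D, ‖nt t x‖ = 1
  contact : ∀ t ∈ Ioo (-ε) ε, ∀ x ∈ D, ∀ v, ⟪fderiv ℝ (ft t) x v, nt t x⟫_ℝ = 0
  immersive : ∀ t ∈ Ioo (-ε) ε, ∀ x ∈ D, ∀ v, v ≠ 0 → fderiv ℝ (nt t) x v ≠ 0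
  start : ∀ x ∈ D, ft 0 x = f x ∧ nt 0 x = n x
  support : ∀ t ∈ Ioo (-ε) ε, ∀ x ∈ D \ K, ft t x = f x ∧ nt t x = n x

/-- `F` is L-minimal: it is critical for the Weingarten functional with respect to all variations
through Legendre immersions with compact support in a coordinate domain of `M`. -/
def LegendreImmersion.IsLMinimal (F : LegendreImmersion M) : Prop :=
  ∀ e ∈ IsManifold.maximalAtlas (𝓡 2) ∞ M, ∀ (K : Set E2) (ε : ℝ) (ft nt : ℝ → E2 → E3),
    IsLegendreVariation e.target (F.f ∘ e.symm) (F.n ∘ e.symm) K ε ft nt →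
      HasDerivAt (fun t => ∫ x in K, weingartenDensity (ft t) (nt t) x) 0 0

end Surface

end Laguerre

end

/-!
A middle frame turns the surface into a solution of the Maurer–Cartan equations for the functions
`p₁, p₂, p₃, q₁, q₂` and the coframe `θ = α₀²`, `η = α₀³`, where `φ = θ + iη`
(`CoordFrame.structure_equations`). Among them is a Codazzi equation: with `Q = (p₁ - p₃)/2 - i p₂`
and `P = p₁ + p₃`, the form `Q φ⁴` satisfies the Cauchy–Riemann equation exactly when
`dP = -2 P (q₂ θ - q₁ η)` (`CoordFrame.codazzi_iff`), which says that `P φ²` is holomorphic. The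
equation is linear in the real function `P`, so that on a connected surface `P` is identically zero
or has no zeros (`CoordFrame.eventually_P_eq_zero`, `mean_zero_or_ne_zero`). The two cases are the
two alternatives.

`P = 0` is L-minimality. The Weingarten integrand is, in every parametrization, the area density of
the middle sphere map, the surface of spheres `(f + r n, r)` in Lorentzian space whose radius is, up
to sign, the mean of the principal radii. Hence the first variation is minus the integral of the
product of the variation field with the Laplacian of this map (`hasDerivAt_area`,
`IsLegendreVariation.hasDerivAt_weingarten`), and this Laplacian is `P a₁`
(`CoordFrame.laplaceDensity_eq`). It vanishes with `P` (`isLMinimal_of_mean_zero`);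
conversely a bump variation where `P ≠ 0` is not critical
(`exists_noncritical_variation`, `mean_zero_of_isLMinimal`). When `P = 0` the equation for `P` holds
trivially; what remains for the holomorphy of `Q φ⁴` is a complex coordinate, which is found by
integrating a closed multiple of `φ` built from a harmonic component of `a₀`
(`holomorphic_of_mean_zero`). No general theorem on isothermal coordinates is needed.

If `P` has no zeros, put `u = -log |P| / 2`. The equation for `P` makes `e^{-u} φ` closed, so that
it is `dz` for a local coordinate (`exists_isothermicCoordinate`); it exhibits `q₂ θ - q₁ η` as
exact, which forces `p₂ = 0` (`CoordFrame.p₂_eq_zero`) and hence L-isothermicity, and the remaining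
structure equations say that `(p₁ - p₃) / P²` is constant (`CoordFrame.fderiv_quotient_eq_zero`). As
`p₁ - p₃ = -e^{-2u} Δu` in an isothermic coordinate (`CoordFrame.laplacian_isothermic`) and
`P² = e^{-4u}`, this is the equation `Δu = c e^{-2u}` with the same `c` on all of `M`
(`exists_blaschkePotential`). Conversely, in an isothermic coordinate `Q φ⁴` is
`-e^{2u} Δu / 2 · dz⁴`, which has constant coefficient if `Δu = c e^{-2u}`
(`holomorphic_of_special_equation`).

Middle frames exist around each point by nondegeneracy (`LegendreImmersion.exists_middleFrame`) and
are unique up to the sign of `(a₂, a₃)` (`MiddleFrame.unique`), so that `p₁`, `p₂`, `p₃` are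
functions on `M`.
-/

noncomputable section

namespace Laguerre

/-! ### Lorentzian linear algebra -/

lemma lorentz_comm (v w : V4) : lorentz v w = lorentz w v := by simp only [lorentz]; ring

lemma lorentz_add_left (v v' w : V4) : lorentz (v + v') w = lorentz v w + lorentz v' w := by
  simp only [lorentz, Pi.add_apply]; ring

lemma lorentz_sub_left (v v' w : V4) : lorentz (v - v') w = lorentz v w - lorentz v' w := by
  simp only [lorentz, Pi.sub_apply]; ring

lemma lorentz_smul_left (c : ℝ) (v w : V4) : lorentz (c • v) w = c * lorentz v w := by
  simp only [lorentz, Pi.smul_apply, smul_eq_mul]; ring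

lemma lorentz_add_right (v w w' : V4) : lorentz v (w + w') = lorentz v w + lorentz v w' := by
  simp only [lorentz, Pi.add_apply]; ring

lemma lorentz_smul_right (c : ℝ) (v w : V4) : lorentz v (c • w) = c * lorentz v w := by
  simp only [lorentz, Pi.smul_apply, smul_eq_mul]; ring

lemma lorentz_zero_left (w : V4) : lorentz 0 w = 0 := by simp [lorentz]

lemma lorentz_zero_right (w : V4) : lorentz w 0 = 0 := by simp [lorentz]

lemma frameMatrix_mulVec (a : Fin 4 → V4) (c : Fin 4 → ℝ) :
    (frameMatrix a).mulVec c = ∑ k, c k • a k := by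
  ext i
  simp [Matrix.mulVec, dotProduct, frameMatrix, mul_comm]

namespace IsLaguerreBasis

variable {a : Fin 4 → V4} (ha : IsLaguerreBasis a)
include ha

lemma isUnit_det : IsUnit (frameMatrix a).det := isUnit_iff_ne_zero.2 ha.2.2.2.ne'

lemma inv_mulVec_eq_iff (w c : V4) :
    (frameMatrix a)⁻¹.mulVec w = c ↔ w = ∑ k, c k • a k := by
  rw [← frameMatrix_mulVec]
  constructor
  · rintro rfl
    rw [Matrix.mulVec_mulVec, Matrix.mul_nonsing_inv _ ha.isUnit_det, Matrix.one_mulVec]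
  · rintro rfl
    rw [Matrix.mulVec_mulVec, Matrix.nonsing_inv_mul _ ha.isUnit_det, Matrix.one_mulVec]

lemma inv_mul_eq_iff (d : Fin 4 → V4) (B : Matrix (Fin 4) (Fin 4) ℝ) :
    (frameMatrix a)⁻¹ * frameMatrix d = B ↔ ∀ j, d j = ∑ k, B k j • a k := by
  have h : (frameMatrix a)⁻¹ * frameMatrix d = B ↔ frameMatrix d = frameMatrix a * B := by
    constructor
    · rintro rfl
      rw [Matrix.mul_nonsing_inv_cancel_left _ _ ha.isUnit_det]
    · intro h
      rw [h, Matrix.nonsing_inv_mul_cancel_left _ _ ha.isUnit_det]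
  rw [h]
  constructor
  · intro h j
    ext i
    have := congrFun (congrFun h i) j
    simpa [frameMatrix, Matrix.mul_apply, mul_comm] using this
  · intro h
    ext i j
    have := congrFun (h j) i
    simpa [frameMatrix, Matrix.mul_apply, mul_comm] using this

lemma eq_zero_of_sum {c : Fin 4 → ℝ} (h : ∑ k, c k • a k = 0) : c = 0 := by
  have := (ha.inv_mulVec_eq_iff 0 c).2 h.symm
  rw [Matrix.mulVec_zero] at this
  exact this.symm

/-- The ten scalar products of the members of a Laguerre basis. -/
lemma products :
    lorentz (a 0) (a 0) = 0 ∧ lorentz (a 0) (a 1) = 0 ∧ lorentz (a 0) (a 2) = 0 ∧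
    lorentz (a 0) (a 3) = -1 ∧ lorentz (a 1) (a 1) = 1 ∧ lorentz (a 1) (a 2) = 0 ∧
    lorentz (a 1) (a 3) = 0 ∧ lorentz (a 2) (a 2) = 1 ∧ lorentz (a 2) (a 3) = 0 ∧
    lorentz (a 3) (a 3) = 0 := by
  refine ⟨?_, ?_, ?_, ?_, ?_, ?_, ?_, ?_, ?_, ?_⟩ <;> rw [ha.1] <;> simp [gram]

lemma products' :
    lorentz (a 1) (a 0) = 0 ∧ lorentz (a 2) (a 0) = 0 ∧
    lorentz (a 3) (a 0) = -1 ∧ lorentz (a 2) (a 1) = 0 ∧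
    lorentz (a 3) (a 1) = 0 ∧ lorentz (a 3) (a 2) = 0 := by
  refine ⟨?_, ?_, ?_, ?_, ?_, ?_⟩ <;> rw [ha.1] <;> simp [gram]

/-- Scalar product of two vectors in terms of their coordinates in a Laguerre basis. -/
lemma lorentz_sum (c d : Fin 4 → ℝ) :
    lorentz (∑ k, c k • a k) (∑ k, d k • a k)
      = -(c 0 * d 3 + c 3 * d 0) + c 1 * d 1 + c 2 * d 2 := by
  obtain ⟨h00, h01, h02, h03, h11, h12, h13, h22, h23, h33⟩ := ha.products
  obtain ⟨h10, h20, h30, h21, h31, h32⟩ := ha.products'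
  simp only [Fin.sum_univ_four, lorentz_add_left, lorentz_add_right, lorentz_smul_left,
    lorentz_smul_right, h00, h01, h02, h03, h11, h12, h13, h22, h23, h33, h10, h20, h30, h21,
    h31, h32]
  ring

lemma expansion (w : V4) :
    w = (-lorentz w (a 3)) • a 0 + lorentz w (a 1) • a 1 + lorentz w (a 2) • a 2
      + (-lorentz w (a 0)) • a 3 := by
  set c := (frameMatrix a)⁻¹.mulVec w with hc
  have hw := (ha.inv_mulVec_eq_iff w c).1 rfl
  obtain ⟨h00, h01, h02, h03, h11, h12, h13, h22, h23, h33⟩ := ha.products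
  obtain ⟨h10, h20, h30, h21, h31, h32⟩ := ha.products'
  have e0 : lorentz w (a 0) = -c 3 := by
    rw [hw]
    simp [Fin.sum_univ_four, lorentz_add_left, lorentz_smul_left, h00, h10, h20, h30]
  have e1 : lorentz w (a 1) = c 1 := by
    rw [hw]
    simp [Fin.sum_univ_four, lorentz_add_left, lorentz_smul_left, h01, h11, h21, h31]
  have e2 : lorentz w (a 2) = c 2 := by
    rw [hw]
    simp [Fin.sum_univ_four, lorentz_add_left, lorentz_smul_left, h02, h12, h22, h32]
  have e3 : lorentz w (a 3) = -c 0 := by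
    rw [hw]
    simp [Fin.sum_univ_four, lorentz_add_left, lorentz_smul_left, h03, h13, h23, h33]
  rw [e0, e1, e2, e3, neg_neg, neg_neg]
  conv_lhs => rw [hw, Fin.sum_univ_four]

end IsLaguerreBasis

/-! ### Second derivatives along a moving frame -/

section Structure

variable {E : Type*} [NormedAddCommGroup E] [NormedSpace ℝ E]

lemma fderiv_fderiv_comm {G : Type*} [NormedAddCommGroup G] [NormedSpace ℝ G] {g : E → G} {x : E}
    (hg : ContDiffAt ℝ ∞ g x) (u v : E) :
    fderiv ℝ (fun y => fderiv ℝ g y u) x v = fderiv ℝ (fun y => fderiv ℝ g y v) x u := by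
  have hs : IsSymmSndFDerivAt ℝ g x := hg.isSymmSndFDerivAt (by simp; norm_cast)
  have hd : DifferentiableAt ℝ (fderiv ℝ g) x :=
    (hg.fderiv_right (m := 1) (by norm_cast)).differentiableAt (by simp)
  have h1 : ∀ w, fderiv ℝ (fun y => fderiv ℝ g y w) x = (fderiv ℝ (fderiv ℝ g) x).flip w := by
    intro w
    rw [fderiv_clm_apply hd (differentiableAt_const w)]
    simp
  rw [h1, h1]
  exact hs.eq v u

/-- The Maurer–Cartan equation for the coordinates of the differential of `b` in a moving frame
`a`, evaluated on two constant vector fields `u` and `v`. -/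
lemma maurer_cartan {a : Fin 4 → E → V4} {b : E → V4} {x : E} (u v : E)
    (hx : IsLaguerreBasis fun i => a i x)
    (hb : ContDiffAt ℝ ∞ b x) (ha : ∀ i, DifferentiableAt ℝ (a i) x)
    {Cu Cv : Fin 4 → E → ℝ} {Au Av : Fin 4 → Fin 4 → ℝ}
    (hCu : ∀ k, DifferentiableAt ℝ (Cu k) x) (hCv : ∀ k, DifferentiableAt ℝ (Cv k) x)
    (hbu : ∀ᶠ y in nhds x, fderiv ℝ b y u = ∑ k, Cu k y • a k y)
    (hbv : ∀ᶠ y in nhds x, fderiv ℝ b y v = ∑ k, Cv k y • a k y)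
    (hau : ∀ j, fderiv ℝ (a j) x u = ∑ k, Au k j • a k x)
    (hav : ∀ j, fderiv ℝ (a j) x v = ∑ k, Av k j • a k x) (k : Fin 4) :
    fderiv ℝ (Cv k) x u - fderiv ℝ (Cu k) x v
      + ∑ l, (Au k l * Cv l x - Av k l * Cu l x) = 0 := by
  have hai : ∀ i j, DifferentiableAt ℝ (fun y => a i y j) x := fun i j =>
    differentiableAt_pi.1 (ha i) j
  have fa : ∀ i j w, fderiv ℝ (fun y => a i y j) x w = fderiv ℝ (a i) x w j := by
    intro i j w
    rw [fderiv_apply (ha i) j]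
    rfl
  have key : ∀ i, fderiv ℝ (fun y => ∑ k, Cv k y * a k y i) x u
      = fderiv ℝ (fun y => ∑ k, Cu k y * a k y i) x v := by
    intro i
    have hbi : ContDiffAt ℝ ∞ (fun y => b y i) x := contDiffAt_pi.1 hb i
    have h := fderiv_fderiv_comm hbi u v
    have hdiff : ∀ᶠ y in nhds x, DifferentiableAt ℝ b y :=
      ((hb.of_le (m := 1) (by norm_cast)).eventually (by simp)).mono
        fun y hy => hy.differentiableAt (by simp)
    have e1 : (fun y => fderiv ℝ (fun y => b y i) y u) =ᶠ[nhds x]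
        fun y => ∑ k, Cu k y * a k y i := by
      filter_upwards [hbu, hdiff] with y hy hd
      rw [fderiv_apply hd i]
      have := congrFun hy i
      simpa using this
    have e2 : (fun y => fderiv ℝ (fun y => b y i) y v) =ᶠ[nhds x]
        fun y => ∑ k, Cv k y * a k y i := by
      filter_upwards [hbv, hdiff] with y hy hd
      rw [fderiv_apply hd i]
      have := congrFun hy i
      simpa using this
    rw [e1.fderiv_eq, e2.fderiv_eq] at h
    exact h.symm
  have expand : ∀ (C : Fin 4 → E → ℝ) (_ : ∀ k, DifferentiableAt ℝ (C k) x) (w : E) (i : Fin 4),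
      fderiv ℝ (fun y => ∑ k, C k y * a k y i) x w
        = ∑ k, (C k x * fderiv ℝ (a k) x w i + a k x i * fderiv ℝ (C k) x w) := by
    intro C hC w i
    rw [fderiv_fun_sum fun k _ => (hC k).fun_mul (hai k i)]
    simp only [sum_apply]
    refine Finset.sum_congr rfl fun k _ => ?_
    rw [fderiv_fun_mul (hC k) (hai k i)]
    simp [fa]
  have hz : ∑ k, (fderiv ℝ (Cv k) x u - fderiv ℝ (Cu k) x v
      + ∑ l, (Au k l * Cv l x - Av k l * Cu l x)) • a k x = 0 := by
    ext i
    have h := key i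
    rw [expand Cv hCv, expand Cu hCu] at h
    simp only [hau, hav, Fin.sum_univ_four, Pi.add_apply, Pi.smul_apply, smul_eq_mul,
      Pi.zero_apply] at h ⊢
    linear_combination h
  exact congrFun (hx.eq_zero_of_sum hz) k

end Structure

/-! ### Middle frames in coordinates and their structure equations -/

/-- The linear part of the Maurer–Cartan form of a middle frame, as a function of the invariants
and of the values `θ`, `η` of the middle coframe. -/
def connMatrix (p₁ p₂ p₃ q₁ q₂ θ η : ℝ) : Matrix (Fin 4) (Fin 4) ℝ :=
  !![2 * q₂ * θ - 2 * q₁ * η, p₁ * θ + p₂ * η, p₂ * θ + p₃ * η, 0;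
     θ, 0, -(q₁ * θ) - q₂ * η, p₁ * θ + p₂ * η;
     -η, q₁ * θ + q₂ * η, 0, p₂ * θ + p₃ * η;
     0, θ, -η, -(2 * q₂ * θ) + 2 * q₁ * η]

/-- A middle frame field on an open set `D` of a normed plane `E`, together with its coframe: the
expression of a `MiddleFrame` in a local coordinate. -/
structure CoordFrame {E : Type*} [NormedAddCommGroup E] [NormedSpace ℝ E] (D : Set E) where
  /-- the position vector -/
  a₀ : E → V4
  /-- the basis vectors -/
  a : Fin 4 → E → V4
  /-- the first member of the coframe -/
  θ : E → E → ℝ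
  /-- the second member of the coframe -/
  η : E → E → ℝ
  (p₁ p₂ p₃ q₁ q₂ : E → ℝ)
  isOpen : IsOpen D
  smooth_a₀ : ContDiffOn ℝ ∞ a₀ D
  smooth_a : ∀ i, ContDiffOn ℝ ∞ (a i) D
  smooth_p₁ : ContDiffOn ℝ ∞ p₁ D
  smooth_p₂ : ContDiffOn ℝ ∞ p₂ D
  smooth_p₃ : ContDiffOn ℝ ∞ p₃ D
  smooth_q₁ : ContDiffOn ℝ ∞ q₁ D
  smooth_q₂ : ContDiffOn ℝ ∞ q₂ D
  basis : ∀ x ∈ D, IsLaguerreBasis fun i => a i x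
  d_a₀ : ∀ x ∈ D, ∀ w, fderiv ℝ a₀ x w = θ x w • a 1 x + η x w • a 2 x
  d_a : ∀ x ∈ D, ∀ w j, fderiv ℝ (a j) x w
    = ∑ k, connMatrix (p₁ x) (p₂ x) (p₃ x) (q₁ x) (q₂ x) (θ x w) (η x w) k j • a k x
  injective : ∀ x ∈ D, ∀ w, θ x w = 0 → η x w = 0 → w = 0

section Expand

variable {E : Type*} [NormedAddCommGroup E] [NormedSpace ℝ E]

lemma fderiv_combination {f g h k : E → ℝ} {x : E} (c d : ℝ) (hf : DifferentiableAt ℝ f x)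
    (hg : DifferentiableAt ℝ g x) (hh : DifferentiableAt ℝ h x) (hk : DifferentiableAt ℝ k x)
    (w : E) :
    fderiv ℝ (fun y => c * (f y * g y) + d * (h y * k y)) x w
      = c * (f x * fderiv ℝ g x w + g x * fderiv ℝ f x w)
        + d * (h x * fderiv ℝ k x w + k x * fderiv ℝ h x w) := by
  have := (((hf.hasFDerivAt.mul hg.hasFDerivAt).const_mul c).add
    ((hh.hasFDerivAt.mul hk.hasFDerivAt).const_mul d)).fderiv
  have e : (fun y => c * (f y * g y) + d * (h y * k y))
    = ((fun y => c * (f * g) y) + fun y => d * (h * k) y) := rfl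
  rw [e, this]
  simp only [add_apply, smul_apply, smul_eq_mul]

end Expand

namespace CoordFrame

variable {E : Type*} [NormedAddCommGroup E] [NormedSpace ℝ E] {D : Set E} (A : CoordFrame D)

/-- The value of `θ ∧ η` on a pair of vectors. -/
def area (x u v : E) : ℝ := A.θ x u * A.η x v - A.θ x v * A.η x u

lemma contDiffAt_a₀ {x : E} (hx : x ∈ D) : ContDiffAt ℝ ∞ A.a₀ x :=
  A.smooth_a₀.contDiffAt (A.isOpen.mem_nhds hx)

lemma contDiffAt_a {x : E} (hx : x ∈ D) (i : Fin 4) : ContDiffAt ℝ ∞ (A.a i) x :=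
  (A.smooth_a i).contDiffAt (A.isOpen.mem_nhds hx)

lemma θ_eq {x : E} (hx : x ∈ D) (w : E) : A.θ x w = lorentz (fderiv ℝ A.a₀ x w) (A.a 1 x) := by
  obtain ⟨-, -, -, -, h11, -, -, -, -, -⟩ := (A.basis x hx).products
  obtain ⟨-, -, -, h21, -, -⟩ := (A.basis x hx).products'
  rw [A.d_a₀ x hx, lorentz_add_left, lorentz_smul_left, lorentz_smul_left, h11, h21]
  ring

lemma η_eq {x : E} (hx : x ∈ D) (w : E) : A.η x w = lorentz (fderiv ℝ A.a₀ x w) (A.a 2 x) := by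
  obtain ⟨-, -, -, -, -, h12, -, h22, -, -⟩ := (A.basis x hx).products
  rw [A.d_a₀ x hx, lorentz_add_left, lorentz_smul_left, lorentz_smul_left, h12, h22]
  ring

lemma θ_linear {x : E} (hx : x ∈ D) (c d : ℝ) (v w : E) :
    A.θ x (c • v + d • w) = c * A.θ x v + d * A.θ x w := by
  simp only [A.θ_eq hx, map_add, map_smul, lorentz_add_left, lorentz_smul_left]

lemma η_linear {x : E} (hx : x ∈ D) (c d : ℝ) (v w : E) :
    A.η x (c • v + d • w) = c * A.η x v + d * A.η x w := by
  simp only [A.η_eq hx, map_add, map_smul, lorentz_add_left, lorentz_smul_left]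

end CoordFrame

lemma contDiffOn_lorentz {E : Type*} [NormedAddCommGroup E] [NormedSpace ℝ E] {D : Set E}
    {g h : E → V4} (hg : ContDiffOn ℝ ∞ g D) (hh : ContDiffOn ℝ ∞ h D) :
    ContDiffOn ℝ ∞ (fun x => lorentz (g x) (h x)) D := by
  have hg' := fun i => contDiffOn_pi.1 hg i
  have hh' := fun i => contDiffOn_pi.1 hh i
  unfold lorentz
  exact ((((hg' 0).mul (hh' 3)).add ((hg' 3).mul (hh' 0))).neg.add ((hg' 1).mul (hh' 1))).add
    ((hg' 2).mul (hh' 2))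

lemma contDiffOn_fderiv_apply {E F : Type*} [NormedAddCommGroup E] [NormedSpace ℝ E]
    [NormedAddCommGroup F] [NormedSpace ℝ F] {D : Set E} (hD : IsOpen D)
    {g : E → F} (hg : ContDiffOn ℝ ∞ g D) (w : E) :
    ContDiffOn ℝ ∞ (fun x => fderiv ℝ g x w) D :=
  (hg.fderiv_of_isOpen hD (by simp)).clm_apply contDiffOn_const

namespace CoordFrame

variable {E : Type*} [NormedAddCommGroup E] [NormedSpace ℝ E] {D : Set E} (A : CoordFrame D)

lemma smooth_θ (w : E) : ContDiffOn ℝ ∞ (fun x => A.θ x w) D :=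
  (contDiffOn_lorentz (contDiffOn_fderiv_apply A.isOpen A.smooth_a₀ w) (A.smooth_a 1)).congr
    fun _ hx => A.θ_eq hx w

lemma smooth_η (w : E) : ContDiffOn ℝ ∞ (fun x => A.η x w) D :=
  (contDiffOn_lorentz (contDiffOn_fderiv_apply A.isOpen A.smooth_a₀ w) (A.smooth_a 2)).congr
    fun _ hx => A.η_eq hx w

/-- The first derivatives of the coframe and of the invariants of a middle frame satisfy the
structure equations. They are evaluated here on the constant vector fields `u` and `v`. -/
theorem structure_equations {x : E} (hx : x ∈ D) (u v : E) :
    (fderiv ℝ (fun y => A.θ y v) x u - fderiv ℝ (fun y => A.θ y u) x v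
      = A.q₁ x * A.area x u v) ∧
    (fderiv ℝ (fun y => A.η y v) x u - fderiv ℝ (fun y => A.η y u) x v
      = A.q₂ x * A.area x u v) ∧
    (fderiv ℝ A.q₂ x u * A.θ x v - fderiv ℝ A.q₂ x v * A.θ x u
      - fderiv ℝ A.q₁ x u * A.η x v + fderiv ℝ A.q₁ x v * A.η x u = A.p₂ x * A.area x u v) ∧
    (fderiv ℝ A.q₁ x u * A.θ x v - fderiv ℝ A.q₁ x v * A.θ x u
      + fderiv ℝ A.q₂ x u * A.η x v - fderiv ℝ A.q₂ x v * A.η x u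
      = (A.p₃ x - A.p₁ x - A.q₁ x ^ 2 - A.q₂ x ^ 2) * A.area x u v) ∧
    (fderiv ℝ A.p₁ x u * A.θ x v - fderiv ℝ A.p₁ x v * A.θ x u
      + fderiv ℝ A.p₂ x u * A.η x v - fderiv ℝ A.p₂ x v * A.η x u
      = (-3 * A.q₁ x * A.p₁ x - 4 * A.q₂ x * A.p₂ x + A.q₁ x * A.p₃ x) * A.area x u v) ∧
    (fderiv ℝ A.p₂ x u * A.θ x v - fderiv ℝ A.p₂ x v * A.θ x u
      + fderiv ℝ A.p₃ x u * A.η x v - fderiv ℝ A.p₃ x v * A.η x u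
      = (-4 * A.q₁ x * A.p₂ x - 3 * A.q₂ x * A.p₃ x + A.q₂ x * A.p₁ x) * A.area x u v) := by
  have hn := A.isOpen.mem_nhds hx
  have dθ : ∀ w, DifferentiableAt ℝ (fun y => A.θ y w) x := fun w =>
    ((A.smooth_θ w).contDiffAt hn).differentiableAt (by simp)
  have dη : ∀ w, DifferentiableAt ℝ (fun y => A.η y w) x := fun w =>
    ((A.smooth_η w).contDiffAt hn).differentiableAt (by simp)
  have dp₁ := (A.smooth_p₁.contDiffAt hn).differentiableAt (by simp)
  have dp₂ := (A.smooth_p₂.contDiffAt hn).differentiableAt (by simp)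
  have dp₃ := (A.smooth_p₃.contDiffAt hn).differentiableAt (by simp)
  have dq₁ := (A.smooth_q₁.contDiffAt hn).differentiableAt (by simp)
  have dq₂ := (A.smooth_q₂.contDiffAt hn).differentiableAt (by simp)
  have da : ∀ i, DifferentiableAt ℝ (A.a i) x := fun i =>
    (A.contDiffAt_a hx i).differentiableAt (by simp)
  have hau := A.d_a x hx u
  have hav := A.d_a x hx v
  have ev : ∀ᶠ y in nhds x, y ∈ D := hn
  have m0 := fun k => maurer_cartan u v (A.basis x hx) (A.contDiffAt_a₀ hx) da
    (Cu := fun k y => ![0, A.θ y u, A.η y u, 0] k) (Cv := fun k y => ![0, A.θ y v, A.η y v, 0] k)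
    (by intro k; fin_cases k <;> simp [dθ, dη]) (by intro k; fin_cases k <;> simp [dθ, dη])
    (ev.mono fun y hy => by rw [A.d_a₀ y hy]; simp [Fin.sum_univ_four])
    (ev.mono fun y hy => by rw [A.d_a₀ y hy]; simp [Fin.sum_univ_four]) hau hav k
  have dC : ∀ w k j, DifferentiableAt ℝ (fun y => connMatrix (A.p₁ y) (A.p₂ y) (A.p₃ y) (A.q₁ y)
      (A.q₂ y) (A.θ y w) (A.η y w) k j) x := by
    intro w k j
    have hθ := dθ w
    have hη := dη w
    fin_cases k <;> fin_cases j <;> simp [connMatrix] <;> fun_prop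
  have m := fun j k => maurer_cartan u v (A.basis x hx) (A.contDiffAt_a hx j) da
    (Cu := fun k y => connMatrix (A.p₁ y) (A.p₂ y) (A.p₃ y) (A.q₁ y)
      (A.q₂ y) (A.θ y u) (A.η y u) k j)
    (Cv := fun k y => connMatrix (A.p₁ y) (A.p₂ y) (A.p₃ y) (A.q₁ y)
      (A.q₂ y) (A.θ y v) (A.η y v) k j)
    (fun k => dC u k j) (fun k => dC v k j)
    (ev.mono fun y hy => A.d_a y hy u j)
    (ev.mono fun y hy => A.d_a y hy v j) hau hav k
  have s1 := m0 1
  have s2 := m0 2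
  have s3 := m 0 0
  have s4 := m 1 2
  have s5 := m 1 0
  have s6 := m 2 0
  simp only [connMatrix, Fin.sum_univ_four, Matrix.of_apply, Matrix.cons_val] at s1 s2 s3 s4 s5 s6
  have e3 : ∀ w w', fderiv ℝ (fun y => 2 * A.q₂ y * A.θ y w - 2 * A.q₁ y * A.η y w) x w'
      = 2 * (A.q₂ x * fderiv ℝ (fun y => A.θ y w) x w' + A.θ x w * fderiv ℝ A.q₂ x w')
        + -2 * (A.q₁ x * fderiv ℝ (fun y => A.η y w) x w' + A.η x w * fderiv ℝ A.q₁ x w') := by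
    intro w w'
    rw [← fderiv_combination 2 (-2) dq₂ (dθ w) dq₁ (dη w)]
    congr 2
    ext y
    ring
  have e1 : ∀ (f g : E → ℝ) (_ : DifferentiableAt ℝ f x) (_ : DifferentiableAt ℝ g x) (w w' : E),
      fderiv ℝ (fun y => f y * A.θ y w + g y * A.η y w) x w'
      = (f x * fderiv ℝ (fun y => A.θ y w) x w' + A.θ x w * fderiv ℝ f x w')
        + (g x * fderiv ℝ (fun y => A.η y w) x w' + A.η x w * fderiv ℝ g x w') := by
    intro f g hf hg w w'
    have := fderiv_combination 1 1 hf (dθ w) hg (dη w) w'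
    simpa only [one_mul] using this
  rw [e3, e3] at s3
  rw [e1 _ _ dq₁ dq₂, e1 _ _ dq₁ dq₂] at s4
  rw [e1 _ _ dp₁ dp₂, e1 _ _ dp₁ dp₂] at s5
  rw [e1 _ _ dp₂ dp₃, e1 _ _ dp₂ dp₃] at s6
  simp only [area]
  have S1 : fderiv ℝ (fun y => A.θ y v) x u = fderiv ℝ (fun y => A.θ y u) x v
      + A.q₁ x * (A.θ x u * A.η x v - A.θ x v * A.η x u) := by linear_combination s1
  have S2 : fderiv ℝ (fun y => A.η y v) x u = fderiv ℝ (fun y => A.η y u) x v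
      + A.q₂ x * (A.θ x u * A.η x v - A.θ x v * A.η x u) := by linear_combination s2
  rw [S1, S2] at s3 s4 s5 s6
  refine ⟨by rw [S1]; ring, by rw [S2]; ring, ?_, ?_, ?_, ?_⟩
  · linear_combination s3 / 2
  · linear_combination s4
  · linear_combination s5
  · linear_combination s6

end CoordFrame

/-! ### The generalized Codazzi equation -/

namespace CoordFrame

variable {E : Type*} [NormedAddCommGroup E] [NormedSpace ℝ E] {D : Set E} (A : CoordFrame D)

/-- The complex form `φ = θ + i η`. -/
def φ (x w : E) : ℂ := ⟨A.θ x w, A.η x w⟩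

/-- The coefficient `Q = (p₁ - p₃)/2 - i p₂`. -/
def Q (x : E) : ℂ := ⟨(A.p₁ x - A.p₃ x) / 2, -A.p₂ x⟩

/-- The coefficient `P = p₁ + p₃`, as a real function. -/
def P (x : E) : ℝ := A.p₁ x + A.p₃ x

lemma exists_dual (hE : Module.finrank ℝ E = 2) {x : E} (hx : x ∈ D) :
    ∃ e f : E, A.θ x e = 1 ∧ A.η x e = 0 ∧ A.θ x f = 0 ∧ A.η x f = 1 ∧
      ∀ w, w = A.θ x w • e + A.η x w • f := by
  let L : E →ₗ[ℝ] ℝ × ℝ :=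
    { toFun := fun w => (A.θ x w, A.η x w)
      map_add' := fun v w => by
        have h1 := A.θ_linear hx 1 1 v w
        have h2 := A.η_linear hx 1 1 v w
        simp only [one_smul, one_mul] at h1 h2
        simp [h1, h2]
      map_smul' := fun c w => by
        have h1 := A.θ_linear hx c 0 w 0
        have h2 := A.η_linear hx c 0 w 0
        simp only [zero_smul, zero_mul, add_zero] at h1 h2
        simp [h1, h2] }
  have hinj : Function.Injective L := by
    rw [← LinearMap.ker_eq_bot, LinearMap.ker_eq_bot']
    intro w hw
    have h := Prod.ext_iff.1 hw
    exact A.injective x hx w h.1 h.2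
  have : FiniteDimensional ℝ E := Module.finite_of_finrank_eq_succ hE
  have hsurj : Function.Surjective L :=
    (LinearMap.injective_iff_surjective_of_finrank_eq_finrank (by simp [hE])).1 hinj
  obtain ⟨e, he⟩ := hsurj (1, 0)
  obtain ⟨f, hf⟩ := hsurj (0, 1)
  have he' := Prod.ext_iff.1 he
  have hf' := Prod.ext_iff.1 hf
  simp only [L, LinearMap.coe_mk, AddHom.coe_mk] at he' hf'
  refine ⟨e, f, he'.1, he'.2, hf'.1, hf'.2, fun w => hinj ?_⟩
  simp only [L, LinearMap.coe_mk, AddHom.coe_mk, A.θ_linear hx, A.η_linear hx, he', hf']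
  simp

lemma area_ne_zero (hE : Module.finrank ℝ E = 2) {x : E} (hx : x ∈ D) {u v : E}
    (h : LinearIndependent ℝ ![u, v]) : A.area x u v ≠ 0 := by
  intro h0
  obtain ⟨e, f, -, -, -, -, hw⟩ := A.exists_dual hE hx
  rw [LinearIndependent.pair_iff] at h
  have h1 := h (A.θ x v) (-A.θ x u) (by
    apply A.injective x hx <;> simp only [A.θ_linear hx, A.η_linear hx]
    · ring
    · simp only [area] at h0; linear_combination -h0)
  have h2 := h (A.η x v) (-A.η x u) (by
    apply A.injective x hx <;> simp only [A.θ_linear hx, A.η_linear hx]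
    · simp only [area] at h0; linear_combination h0
    · ring)
  have hu := hw u
  rw [neg_eq_zero.1 h1.2, neg_eq_zero.1 h2.2] at hu
  have := h 1 0 (by rw [hu]; simp)
  exact one_ne_zero this.1

lemma differentiableAt_of_contDiffOn {F : Type*} [NormedAddCommGroup F] [NormedSpace ℝ F]
    {g : E → F} (hg : ContDiffOn ℝ ∞ g D) {x : E} (hx : x ∈ D) (hD : IsOpen D) :
    DifferentiableAt ℝ g x :=
  (hg.contDiffAt (hD.mem_nhds hx)).differentiableAt (by simp)

lemma fderiv_P {x : E} (hx : x ∈ D) (w : E) :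
    fderiv ℝ A.P x w = fderiv ℝ A.p₁ x w + fderiv ℝ A.p₃ x w := by
  have h1 := differentiableAt_of_contDiffOn A.smooth_p₁ hx A.isOpen
  have h3 := differentiableAt_of_contDiffOn A.smooth_p₃ hx A.isOpen
  have := (h1.hasFDerivAt.add h3.hasFDerivAt).fderiv
  change fderiv ℝ A.P x = _ at this
  rw [this]
  simp

lemma smooth_P : ContDiffOn ℝ ∞ A.P D := A.smooth_p₁.add A.smooth_p₃

/-- The equation `dP = -2 P (q₂ θ - q₁ η)`, which expresses that `P φ²` is holomorphic. -/
def POdeAt (x : E) : Prop :=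
  ∀ w, fderiv ℝ A.P x w = -2 * A.P x * (A.q₂ x * A.θ x w - A.q₁ x * A.η x w)

lemma hasFDerivAt_Q {x : E} (hx : x ∈ D) :
    ∃ Q' : E →L[ℝ] ℂ, HasFDerivAt A.Q Q' x ∧ ∀ w, Q' w =
      ((((fderiv ℝ A.p₁ x w - fderiv ℝ A.p₃ x w) / 2 : ℝ) : ℂ)
        - (fderiv ℝ A.p₂ x w : ℝ) * Complex.I) := by
  have h1 := (differentiableAt_of_contDiffOn A.smooth_p₁ hx A.isOpen).hasFDerivAt
  have h2 := (differentiableAt_of_contDiffOn A.smooth_p₂ hx A.isOpen).hasFDerivAt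
  have h3 := (differentiableAt_of_contDiffOn A.smooth_p₃ hx A.isOpen).hasFDerivAt
  have h := (Complex.ofRealCLM.hasFDerivAt.comp x ((h1.sub h3).const_mul (2⁻¹ : ℝ))).sub
    ((Complex.ofRealCLM.hasFDerivAt.comp x h2).mul_const Complex.I)
  refine ⟨_, h.congr_of_eventuallyEq (Filter.Eventually.of_forall fun y => ?_), fun w => ?_⟩
  · apply Complex.ext
    · simp [Q]; ring
    · simp [Q]
  · apply Complex.ext <;> simp
    ring

/-- The generalized Codazzi equation: `Q φ⁴` satisfies the Cauchy–Riemann equation at a point if and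
only if `P φ²` does. The vectors `e`, `f` are dual to the middle coframe. -/
lemma codazzi_iff {x : E} (hx : x ∈ D) {e f : E} (h1 : A.θ x e = 1) (h2 : A.η x e = 0)
    (h3 : A.θ x f = 0) (h4 : A.η x f = 1) (h5 : ∀ w, w = A.θ x w • e + A.η x w • f)
    {Q' : E →L[ℝ] ℂ} (hQ : HasFDerivAt A.Q Q' x) :
    Complex.I * Q' e - Q' f + 4 * A.Q x * ⟨A.q₁ x, A.q₂ x⟩ = 0 ↔ A.POdeAt x := by
  obtain ⟨Q'', hQ'', hval⟩ := A.hasFDerivAt_Q hx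
  obtain rfl := hQ.unique hQ''
  obtain ⟨-, -, -, -, s5, s6⟩ := A.structure_equations hx e f
  simp only [area, h1, h2, h3, h4] at s5 s6
  have hode : A.POdeAt x ↔ (fderiv ℝ A.P x e = -2 * A.P x * A.q₂ x ∧
      fderiv ℝ A.P x f = 2 * A.P x * A.q₁ x) := by
    constructor
    · intro h
      refine ⟨?_, ?_⟩
      · rw [h e, h1, h2]; ring
      · rw [h f, h3, h4]; ring
    · rintro ⟨ha, hb⟩ w
      conv_lhs => rw [h5 w]
      rw [map_add, map_smul, map_smul, ha, hb, smul_eq_mul, smul_eq_mul]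
      ring
  rw [hode, hval, hval, Complex.ext_iff, A.fderiv_P hx, A.fderiv_P hx]
  simp only [Q, P, Complex.add_re, Complex.sub_re, Complex.mul_re, Complex.I_re, Complex.I_im,
    Complex.ofReal_re, Complex.ofReal_im, Complex.add_im, Complex.sub_im, Complex.mul_im,
    Complex.zero_re, Complex.zero_im, Complex.re_ofNat, Complex.im_ofNat]
  constructor
  · rintro ⟨ha, hb⟩
    constructor
    · linear_combination 2 * hb + 2 * s6
    · linear_combination 2 * ha - 2 * s5
  · rintro ⟨ha, hb⟩
    constructor
    · linear_combination s5 + hb / 2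
    · linear_combination ha / 2 - s6

lemma pOdeAt_of_eventually_zero {x : E} (h : ∀ᶠ y in nhds x, A.P y = 0) : A.POdeAt x := by
  intro w
  have h0 : A.P =ᶠ[nhds x] fun _ => (0 : ℝ) := h
  rw [h0.fderiv_eq, h.self_of_nhds]
  simp

/-- Where `P` has no zeros, the equation `dP = -2 P (q₂ θ - q₁ η)` exhibits `q₂ θ - q₁ η` as an
exact form, and so `p₂ = 0`. -/
lemma p₂_eq_zero (hE : Module.finrank ℝ E = 2) (hode : ∀ y ∈ D, A.POdeAt y) {x : E} (hx : x ∈ D)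
    (hP : A.P x ≠ 0) : A.p₂ x = 0 := by
  obtain ⟨e, f, h1, h2, h3, h4, -⟩ := A.exists_dual hE hx
  have hn := A.isOpen.mem_nhds hx
  obtain ⟨s1, s2, s3, -, -, -⟩ := A.structure_equations hx e f
  have hsym := fderiv_fderiv_comm (A.smooth_P.contDiffAt hn) e f
  have dθ : ∀ w, DifferentiableAt ℝ (fun y => A.θ y w) x := fun w =>
    differentiableAt_of_contDiffOn (A.smooth_θ w) hx A.isOpen
  have dη : ∀ w, DifferentiableAt ℝ (fun y => A.η y w) x := fun w =>
    differentiableAt_of_contDiffOn (A.smooth_η w) hx A.isOpen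
  have dP := differentiableAt_of_contDiffOn A.smooth_P hx A.isOpen
  have dq₁ := differentiableAt_of_contDiffOn A.smooth_q₁ hx A.isOpen
  have dq₂ := differentiableAt_of_contDiffOn A.smooth_q₂ hx A.isOpen
  have ex : ∀ w w', fderiv ℝ (fun y => fderiv ℝ A.P y w) x w' =
      -2 * (A.P x * ((A.q₂ x * fderiv ℝ (fun y => A.θ y w) x w'
        + A.θ x w * fderiv ℝ A.q₂ x w') - (A.q₁ x * fderiv ℝ (fun y => A.η y w) x w'
        + A.η x w * fderiv ℝ A.q₁ x w'))
        + (A.q₂ x * A.θ x w - A.q₁ x * A.η x w) * fderiv ℝ A.P x w') := by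
    intro w w'
    have hev : (fun y => fderiv ℝ A.P y w) =ᶠ[nhds x]
        fun y => -2 * (A.P y * (A.q₂ y * A.θ y w - A.q₁ y * A.η y w)) := by
      filter_upwards [hn] with y hy
      rw [hode y hy w]; ring
    rw [hev.fderiv_eq]
    have := ((dP.hasFDerivAt.mul ((dq₂.hasFDerivAt.mul (dθ w).hasFDerivAt).sub
      (dq₁.hasFDerivAt.mul (dη w).hasFDerivAt))).const_mul (-2)).fderiv
    simp only [Pi.mul_apply, Pi.sub_apply] at this
    rw [this]
    simp
    ring
  rw [ex, ex, hode x hx, hode x hx] at hsym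
  simp only [area, h1, h2, h3, h4] at s1 s2 s3 hsym
  have : A.P x * A.p₂ x = 0 := by
    have e1 : fderiv ℝ (fun y => A.θ y f) x e = fderiv ℝ (fun y => A.θ y e) x f + A.q₁ x := by
      linear_combination s1
    have e2 : fderiv ℝ (fun y => A.η y f) x e = fderiv ℝ (fun y => A.η y e) x f + A.q₂ x := by
      linear_combination s2
    rw [e1, e2] at hsym
    linear_combination hsym / 2 - A.P x * s3
  exact (mul_eq_zero.1 this).resolve_left hP

/-- If `P` has no zeros and `dP = -2 P (q₂ θ - q₁ η)`, then `p₂ = 0`, so that `(p₁ - p₃) / P²` is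
`2 Q / P²`; its differential vanishes. -/
lemma fderiv_quotient_eq_zero (hE : Module.finrank ℝ E = 2) (hode : ∀ y ∈ D, A.POdeAt y)
    (hP : ∀ y ∈ D, A.P y ≠ 0) {x : E} (hx : x ∈ D) :
    HasFDerivAt (fun y => (A.p₁ y - A.p₃ y) / A.P y ^ 2) (0 : E →L[ℝ] ℝ) x := by
  obtain ⟨e, f, h1, h2, h3, h4, h5⟩ := A.exists_dual hE hx
  have hn := A.isOpen.mem_nhds hx
  obtain ⟨Q', hQ, hval⟩ := A.hasFDerivAt_Q hx
  have hc := (A.codazzi_iff hx h1 h2 h3 h4 h5 hQ).2 (hode x hx)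
  have hp₂ : A.p₂ =ᶠ[nhds x] fun _ => 0 := by
    filter_upwards [hn] with y hy using A.p₂_eq_zero hE hode hy (hP y hy)
  have dP := differentiableAt_of_contDiffOn A.smooth_P hx A.isOpen
  have dp₁ := differentiableAt_of_contDiffOn A.smooth_p₁ hx A.isOpen
  have dp₃ := differentiableAt_of_contDiffOn A.smooth_p₃ hx A.isOpen
  have hp0 : A.p₂ x = 0 := hp₂.self_of_nhds
  simp only [hval, hp₂.fderiv_eq, Complex.ext_iff, Q, hp0, Complex.add_re, Complex.sub_re,
    Complex.mul_re, Complex.I_re, Complex.I_im,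
    Complex.ofReal_re, Complex.ofReal_im, Complex.add_im, Complex.sub_im, Complex.mul_im,
    Complex.zero_re, Complex.zero_im, Complex.re_ofNat, Complex.im_ofNat] at hc
  simp at hc
  have hR : ∀ w, fderiv ℝ A.p₁ x w - fderiv ℝ A.p₃ x w
      = -4 * (A.p₁ x - A.p₃ x) * (A.q₂ x * A.θ x w - A.q₁ x * A.η x w) := by
    intro w
    conv_lhs => rw [h5 w]
    simp only [map_add, map_smul, smul_eq_mul]
    linear_combination 2 * A.θ x w * hc.2 - 2 * A.η x w * hc.1
  have hd := (dp₁.hasFDerivAt.sub dp₃.hasFDerivAt).mul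
    ((hasDerivAt_inv (pow_ne_zero 2 (hP x hx))).comp_hasFDerivAt x (dP.hasFDerivAt.pow 2))
  refine (hd.congr_of_eventuallyEq (Filter.Eventually.of_forall fun y => ?_)).congr_fderiv ?_
  · simp [div_eq_mul_inv]
  · ext w
    have hPx := hP x hx
    have hw := hode x hx w
    have hRw := hR w
    simp only [Function.comp, add_apply, smul_apply, sub_apply, smul_eq_mul, zero_apply,
      Pi.sub_apply, nsmul_eq_mul]
    rw [hw, hRw]
    field_simp
    ring

end CoordFrame

/-! ### Complex coordinates -/

namespace CoordFrame

/-- In a coordinate for which `φ` is of type `(1, 0)`, the coefficient of `Q φ⁴` is holomorphic at a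
point if and only if `dP = -2 P (q₂ θ - q₁ η)` there. -/
theorem differentiableAt_coefficient_iff {D : Set ℂ} (A : CoordFrame D)
    (hφ : ∀ x ∈ D, ∀ w, A.φ x w = A.φ x 1 * w) {x : ℂ} (hx : x ∈ D) :
    DifferentiableAt ℂ (fun y => A.Q y * A.φ y 1 ^ 4) x ↔ A.POdeAt x := by
  have hn := A.isOpen.mem_nhds hx
  obtain ⟨e, f, h1, h2, h3, h4, h5⟩ := A.exists_dual Complex.finrank_real_complex hx
  obtain ⟨Q', hQ, -⟩ := A.hasFDerivAt_Q hx
  have dθ : ∀ w, DifferentiableAt ℝ (fun y => A.θ y w) x := fun w =>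
    differentiableAt_of_contDiffOn (A.smooth_θ w) hx A.isOpen
  have dη : ∀ w, DifferentiableAt ℝ (fun y => A.η y w) x := fun w =>
    differentiableAt_of_contDiffOn (A.smooth_η w) hx A.isOpen
  have hθη : ∀ y ∈ D, A.θ y Complex.I = -A.η y 1 ∧ A.η y Complex.I = A.θ y 1 := by
    intro y hy
    have := Complex.ext_iff.1 (hφ y hy Complex.I)
    simpa [φ] using this
  set m := A.θ x 1 with hm
  set n := A.η x 1 with hnn
  have hμ : HasFDerivAt (fun y => A.φ y 1) (Complex.ofRealCLM.comp
      (fderiv ℝ (fun y => A.θ y 1) x) + Complex.I •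
      Complex.ofRealCLM.comp (fderiv ℝ (fun y => A.η y 1) x)) x := by
    have h := (Complex.ofRealCLM.hasFDerivAt.comp x (dθ 1).hasFDerivAt).add
      ((Complex.ofRealCLM.hasFDerivAt.comp x (dη 1).hasFDerivAt).const_smul Complex.I)
    refine h.congr_of_eventuallyEq (Filter.Eventually.of_forall fun y => ?_)
    apply Complex.ext <;> simp [φ]
  have hg := hQ.mul (hμ.pow 4)
  obtain ⟨s1, s2, -⟩ := A.structure_equations hx 1 Complex.I
  have e1 : fderiv ℝ (fun y => A.θ y Complex.I) x 1 = -fderiv ℝ (fun y => A.η y 1) x 1 := by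
    have : (fun y => A.θ y Complex.I) =ᶠ[nhds x] -fun y => A.η y 1 := by
      filter_upwards [hn] with y hy using (hθη y hy).1
    rw [this.fderiv_eq, fderiv_neg]
    rfl
  have e2 : fderiv ℝ (fun y => A.η y Complex.I) x 1 = fderiv ℝ (fun y => A.θ y 1) x 1 := by
    have : (fun y => A.η y Complex.I) =ᶠ[nhds x] fun y => A.θ y 1 := by
      filter_upwards [hn] with y hy using (hθη y hy).2
    rw [this.fderiv_eq]
  rw [e1, area, (hθη x hx).1, (hθη x hx).2] at s1
  rw [e2, area, (hθη x hx).1, (hθη x hx).2] at s2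
  have hφx : A.φ x 1 = m + n * Complex.I := by apply Complex.ext <;> simp [φ, hm, hnn]
  have hφ0 : A.φ x 1 ≠ 0 := by
    intro h0
    have := Complex.ext_iff.1 h0
    exact one_ne_zero (A.injective x hx 1 this.1 this.2)
  have hQ1 : Q' 1 = m * Q' e + n * Q' f := by
    conv_lhs => rw [h5 1, map_add, map_smul, map_smul, Complex.real_smul, Complex.real_smul]
  have hQI : Q' Complex.I = -n * Q' e + m * Q' f := by
    conv_lhs => rw [h5 Complex.I, (hθη x hx).1, (hθη x hx).2, map_add, map_smul, map_smul,
      Complex.real_smul, Complex.real_smul, Complex.ofReal_neg]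
  have hconj : (m - n * Complex.I : ℂ) ≠ 0 := by
    intro h0
    apply hφ0
    rw [hφx]
    have := Complex.ext_iff.1 h0
    simp at this
    simp [this.1, this.2]
  rw [differentiableAt_complex_iff_differentiableAt_real,
    ← A.codazzi_iff hx h1 h2 h3 h4 h5 hQ]
  have hgd : DifferentiableAt ℝ (fun y => A.Q y * A.φ y 1 ^ 4) x := hg.differentiableAt
  have hgf : fderiv ℝ (fun y => A.Q y * A.φ y 1 ^ 4) x = _ := hg.fderiv
  rw [hgf]
  have hs : Complex.I * ((fderiv ℝ (fun y => A.θ y 1) x 1 : ℂ)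
      + Complex.I * (fderiv ℝ (fun y => A.η y 1) x 1 : ℂ))
      - ((fderiv ℝ (fun y => A.θ y 1) x Complex.I : ℂ)
      + Complex.I * (fderiv ℝ (fun y => A.η y 1) x Complex.I : ℂ))
      = ⟨A.q₁ x, A.q₂ x⟩ * (m ^ 2 + n ^ 2) := by
    obtain ⟨r, hr⟩ : ∃ r : ℝ, r = m ^ 2 + n ^ 2 := ⟨_, rfl⟩
    have hr' : ((m : ℂ) ^ 2 + (n : ℂ) ^ 2) = (r : ℂ) := by rw [hr]; push_cast; rfl
    rw [hr']
    apply Complex.ext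
    · simp
      rw [hr]
      linear_combination s1
    · simp
      rw [hr]
      linear_combination s2
  simp only [hgd, true_and, add_apply, smul_apply, smul_eq_mul, nsmul_eq_mul,
    ContinuousLinearMap.comp_apply, Complex.ofRealCLM_apply]
  rw [hQ1, hQI, hφx]
  have key : Complex.I * (A.Q x * (4 * (m + n * Complex.I) ^ 3
      * ((fderiv ℝ (fun y => A.θ y 1) x 1 : ℂ)
      + Complex.I * (fderiv ℝ (fun y => A.η y 1) x 1 : ℂ)))
      + (m + n * Complex.I) ^ 4 * (m * Q' e + n * Q' f))
      - (A.Q x * (4 * (m + n * Complex.I) ^ 3 * ((fderiv ℝ (fun y => A.θ y 1) x Complex.I : ℂ)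
      + Complex.I * (fderiv ℝ (fun y => A.η y 1) x Complex.I : ℂ)))
      + (m + n * Complex.I) ^ 4 * (-n * Q' e + m * Q' f))
      = (m + n * Complex.I) ^ 4 * (m - n * Complex.I) *
        (Complex.I * Q' e - Q' f + 4 * A.Q x * ⟨A.q₁ x, A.q₂ x⟩) := by
    have hI := Complex.I_sq
    have hmn : (m : ℂ) ^ 2 + (n : ℂ) ^ 2 = (m + n * Complex.I) * (m - n * Complex.I) := by
      linear_combination (n : ℂ) ^ 2 * hI
    rw [hmn] at hs
    linear_combination 4 * A.Q x * (m + n * Complex.I) ^ 3 * hs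
      + (m + n * Complex.I) ^ 4 * n * Q' e * hI
  rw [← hφx] at key ⊢
  constructor
  · intro h
    have h0 := mul_ne_zero (pow_ne_zero 4 hφ0) hconj
    refine (mul_eq_zero.1 (key.symm.trans ?_)).resolve_left h0
    push_cast at h ⊢
    linear_combination -h
  · intro h
    rw [h, mul_zero] at key
    push_cast at key ⊢
    linear_combination -key

/-- The Laplacian of the logarithm `u` of the conformal factor of an isothermic coordinate, and the
vanishing of `p₂` in such coordinates. -/
theorem laplacian_isothermic {D : Set ℂ} (A : CoordFrame D) {u : ℂ → ℝ} (hu : ContDiffOn ℝ ∞ u D)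
    (hθ : ∀ x ∈ D, ∀ w : ℂ, A.θ x w = Real.exp (u x) * w.re)
    (hη : ∀ x ∈ D, ∀ w : ℂ, A.η x w = Real.exp (u x) * w.im) {x : ℂ} (hx : x ∈ D) :
    A.p₂ x = 0 ∧ (Δ u) x = (A.p₃ x - A.p₁ x) * Real.exp (u x) ^ 2 := by
  have hn := A.isOpen.mem_nhds hx
  have du : ∀ y ∈ D, DifferentiableAt ℝ u y := fun y hy =>
    differentiableAt_of_contDiffOn hu hy A.isOpen
  have dq₁ := differentiableAt_of_contDiffOn A.smooth_q₁ hx A.isOpen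
  have dq₂ := differentiableAt_of_contDiffOn A.smooth_q₂ hx A.isOpen
  have hθ1 : ∀ y ∈ D, A.θ y 1 = Real.exp (u y) := fun y hy => by simp [hθ y hy]
  have hη1 : ∀ y ∈ D, A.η y 1 = 0 := fun y hy => by simp [hη y hy]
  have hθI : ∀ y ∈ D, A.θ y Complex.I = 0 := fun y hy => by simp [hθ y hy]
  have hηI : ∀ y ∈ D, A.η y Complex.I = Real.exp (u y) := fun y hy => by simp [hη y hy]
  have hux : ∀ y ∈ D, fderiv ℝ u y 1 = Real.exp (u y) * A.q₂ y ∧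
      fderiv ℝ u y Complex.I = -(Real.exp (u y) * A.q₁ y) := by
    intro y hy
    have hny := A.isOpen.mem_nhds hy
    obtain ⟨s1, s2, -⟩ := A.structure_equations hy 1 Complex.I
    have ex : fderiv ℝ (fun y => Real.exp (u y)) y = Real.exp (u y) • fderiv ℝ u y :=
      (du y hy).hasFDerivAt.exp.fderiv
    have f1 : (fun y => A.θ y 1) =ᶠ[nhds y] fun y => Real.exp (u y) := by
      filter_upwards [hny] with t ht using hθ1 t ht
    have f2 : (fun y => A.η y 1) =ᶠ[nhds y] fun _ => 0 := by
      filter_upwards [hny] with t ht using hη1 t ht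
    have f3 : (fun y => A.θ y Complex.I) =ᶠ[nhds y] fun _ => 0 := by
      filter_upwards [hny] with t ht using hθI t ht
    have f4 : (fun y => A.η y Complex.I) =ᶠ[nhds y] fun y => Real.exp (u y) := by
      filter_upwards [hny] with t ht using hηI t ht
    rw [f3.fderiv_eq, f1.fderiv_eq, ex, area, hθ1 y hy, hη1 y hy, hθI y hy, hηI y hy] at s1
    rw [f2.fderiv_eq, f4.fderiv_eq, ex, area, hθ1 y hy, hη1 y hy, hθI y hy, hηI y hy] at s2
    simp at s1 s2
    have hpos := (Real.exp_pos (u y)).ne'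
    constructor
    · apply mul_left_cancel₀ hpos
      linear_combination s2
    · apply mul_left_cancel₀ hpos
      linear_combination -s1
  obtain ⟨-, -, s3, s4, -, -⟩ := A.structure_equations hx 1 Complex.I
  rw [area, hθ1 x hx, hη1 x hx, hθI x hx, hηI x hx] at s3 s4
  have hpos := (Real.exp_pos (u x)).ne'
  have second : ∀ (q : ℂ → ℝ) (_ : DifferentiableAt ℝ q x) (w : ℂ),
      fderiv ℝ (fun y => Real.exp (u y) * q y) x w
        = Real.exp (u x) * fderiv ℝ q x w + q x * (Real.exp (u x) * fderiv ℝ u x w) := by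
    intro q hq w
    have := ((du x hx).hasFDerivAt.exp.mul hq.hasFDerivAt).fderiv
    change fderiv ℝ (fun y => Real.exp (u y) * q y) x = _ at this
    rw [this]
    simp
  have g1 : (fun y => fderiv ℝ u y 1) =ᶠ[nhds x] fun y => Real.exp (u y) * A.q₂ y := by
    filter_upwards [hn] with y hy using (hux y hy).1
  have g2 : (fun y => fderiv ℝ u y Complex.I) =ᶠ[nhds x]
      -fun y => Real.exp (u y) * A.q₁ y := by
    filter_upwards [hn] with y hy using (hux y hy).2
  have k1 : ∀ w, fderiv ℝ (fun y => fderiv ℝ u y 1) x w = _ := fun w => by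
    rw [g1.fderiv_eq, second _ dq₂]
  have k2 : ∀ w, fderiv ℝ (fun y => fderiv ℝ u y Complex.I) x w = _ := fun w => by
    rw [g2.fderiv_eq, fderiv_neg, neg_apply, second _ dq₁]
  constructor
  · have hsym := fderiv_fderiv_comm (hu.contDiffAt hn) 1 Complex.I
    rw [k1, k2, (hux x hx).1, (hux x hx).2] at hsym
    apply mul_left_cancel₀ (pow_ne_zero 2 hpos)
    linear_combination -s3 - hsym
  · have hdd : DifferentiableAt ℝ (fderiv ℝ u) x :=
      (((hu.contDiffAt hn).fderiv_right (m := 1) (by norm_cast)).differentiableAt (by simp))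
    have hit : ∀ w, iteratedFDeriv ℝ 2 u x ![w, w] = fderiv ℝ (fun y => fderiv ℝ u y w) x w := by
      intro w
      rw [iteratedFDeriv_two_apply, fderiv_clm_apply hdd (differentiableAt_const w)]
      simp
    rw [InnerProductSpace.laplacian_eq_iteratedFDeriv_complexPlane]
    simp only [hit, k1, k2, (hux x hx).1, (hux x hx).2]
    linear_combination s4

end CoordFrame

/-! ### Propagation of zeros and integration of closed forms -/

namespace CoordFrame

variable {E : Type*} [NormedAddCommGroup E] [NormedSpace ℝ E] {D : Set E} (A : CoordFrame D)

/-- A solution `P` of the linear equation `dP = -2 P (q₂ θ - q₁ η)` that vanishes at a point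
vanishes near it. -/
theorem eventually_P_eq_zero (hode : ∀ y ∈ D, A.POdeAt y) {x : E} (hx : x ∈ D) (h0 : A.P x = 0) :
    ∀ᶠ y in nhds x, A.P y = 0 := by
  obtain ⟨r, hr, hball⟩ := Metric.isOpen_iff.1 A.isOpen x hx
  filter_upwards [Metric.ball_mem_nhds x hr] with y hy
  set w := y - x with hw
  set γ : ℝ → E := fun t => x + t • w with hγ
  have hγD : ∀ t ∈ Icc (0 : ℝ) 1, γ t ∈ D := by
    intro t ht
    apply hball
    have := (convex_ball x r).add_smul_sub_mem (Metric.mem_ball_self hr) hy ht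
    exact this
  have hγc : Continuous γ := by fun_prop
  have hγd : ∀ t, HasDerivAt γ w t := fun t => by
    have := ((hasDerivAt_id t).smul_const w).const_add x
    rw [hγ]
    simpa using this
  have hmaps : MapsTo γ (Icc 0 1) D := hγD
  have hcont : ∀ g : E → ℝ, ContDiffOn ℝ ∞ g D → ContinuousOn (fun t => g (γ t)) (Icc 0 1) :=
    fun g hg => hg.continuousOn.comp hγc.continuousOn hmaps
  set τ : ℝ → ℝ := fun t => A.q₂ (γ t) * A.θ (γ t) w - A.q₁ (γ t) * A.η (γ t) w with hτ
  have hτc : ContinuousOn τ (Icc 0 1) :=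
    ((hcont _ A.smooth_q₂).mul (hcont _ (A.smooth_θ w))).sub
      ((hcont _ A.smooth_q₁).mul (hcont _ (A.smooth_η w)))
  obtain ⟨K, hK⟩ := isCompact_Icc.exists_bound_of_continuousOn hτc
  have := eq_zero_of_abs_deriv_le_mul_abs_self_of_eq_zero_right
    (f := fun t => A.P (γ t)) (f' := fun t => -2 * A.P (γ t) * τ t) (K := 2 * K) (a := 0) (b := 1)
    (hcont _ A.smooth_P)
    (fun t ht => by
      have hD := hγD t (Ico_subset_Icc_self ht)
      have hd := (differentiableAt_of_contDiffOn A.smooth_P hD A.isOpen).hasFDerivAt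
      have := hd.comp_hasDerivAt t (hγd t)
      have e : fderiv ℝ A.P (γ t) w = -2 * A.P (γ t) * τ t := hode _ hD w
      rw [e] at this
      exact this.hasDerivWithinAt)
    (by simpa [hγ] using h0)
    (fun t ht => by
      have h := hK t (Ico_subset_Icc_self ht)
      rw [norm_mul, norm_mul]
      have h2 : ‖(-2 : ℝ)‖ = 2 := by norm_num
      rw [h2]
      nlinarith [norm_nonneg (A.P (γ t)), mul_le_mul_of_nonneg_left h (norm_nonneg (A.P (γ t)))])
    1 (by simp)
  simpa [hγ, hw] using this

/-- A complex multiple `c φ` of `φ` that is closed is the differential of a complex coordinate near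
each point at which `c` does not vanish. -/
theorem exists_coordinate_of_closed (hE : Module.finrank ℝ E = 2) {c : E → ℂ}
    (hc : ContDiffOn ℝ ∞ c D)
    (hclosed : ∀ x ∈ D, ∀ u v, fderiv ℝ c x u * A.φ x v - fderiv ℝ c x v * A.φ x u
      + c x * ⟨A.q₁ x, A.q₂ x⟩ * A.area x u v = 0) {x₀ : E} (hx₀ : x₀ ∈ D) (hc₀ : c x₀ ≠ 0) :
    ∃ Ψ : OpenPartialHomeomorph E ℂ, x₀ ∈ Ψ.source ∧ Ψ.source ⊆ D ∧
      ContDiffOn ℝ ∞ Ψ Ψ.source ∧ ContDiffOn ℝ ∞ Ψ.symm Ψ.target ∧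
      ∀ x ∈ Ψ.source, c x ≠ 0 ∧ ∀ w, fderiv ℝ Ψ x w = c x * A.φ x w := by
  have hfin : FiniteDimensional ℝ E := Module.finite_of_finrank_eq_succ hE
  have : CompleteSpace E := FiniteDimensional.complete ℝ E
  -- `ω = c φ` as a form with values in the continuous linear maps
  let L : E → E →L[ℝ] ℂ := fun x => LinearMap.toContinuousLinearMap
    { toFun := fun w => c x * ((lorentz (fderiv ℝ A.a₀ x w) (A.a 1 x) : ℝ)
        + (lorentz (fderiv ℝ A.a₀ x w) (A.a 2 x) : ℝ) * Complex.I)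
      map_add' := fun v w => by
        simp only [map_add, lorentz_add_left, Complex.ofReal_add]; ring
      map_smul' := fun r w => by
        simp only [map_smul, lorentz_smul_left, Complex.ofReal_mul, Complex.real_smul,
          RingHom.id_apply]
        ring }
  have hL : ∀ x ∈ D, ∀ w, L x w = c x * A.φ x w := by
    intro x hx w
    have : A.φ x w = (A.θ x w : ℂ) + (A.η x w : ℂ) * Complex.I := by
      apply Complex.ext <;> simp [φ]
    rw [this, A.θ_eq hx, A.η_eq hx]
    rfl
  have hφs : ∀ w, ContDiffOn ℝ ∞ (fun x => A.φ x w) D := by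
    intro w
    have h1 := Complex.ofRealCLM.contDiff.comp_contDiffOn (A.smooth_θ w)
    have h2 := (Complex.ofRealCLM.contDiff.comp_contDiffOn (A.smooth_η w)).mul
      (contDiffOn_const (c := Complex.I))
    refine (h1.add h2).congr fun x _ => ?_
    apply Complex.ext <;> simp [φ]
  have hLs : ContDiffOn ℝ ∞ L D :=
    contDiffOn_clm_apply.2 fun w => (hc.mul (hφs w)).congr fun x hx => hL x hx w
  have hLd : ∀ x ∈ D, DifferentiableAt ℝ L x := fun x hx =>
    differentiableAt_of_contDiffOn hLs hx A.isOpen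
  -- a ball around `x₀` on which `c` does not vanish
  have hne : ∀ᶠ x in nhds x₀, x ∈ D ∧ c x ≠ 0 :=
    (A.isOpen.eventually_mem hx₀).and
      ((hc.continuousOn.continuousAt (A.isOpen.mem_nhds hx₀)).eventually_ne hc₀)
  obtain ⟨r, hr, hball⟩ := Metric.eventually_nhds_iff_ball.1 hne
  have hsymm : ∀ x ∈ Metric.ball x₀ r, ∀ u v, fderiv ℝ L x u v = fderiv ℝ L x v u := by
    intro x hx u v
    have hxD := (hball x hx).1
    have hn := A.isOpen.mem_nhds hxD
    have dθ : ∀ w, DifferentiableAt ℝ (fun y => A.θ y w) x := fun w =>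
      differentiableAt_of_contDiffOn (A.smooth_θ w) hxD A.isOpen
    have dη : ∀ w, DifferentiableAt ℝ (fun y => A.η y w) x := fun w =>
      differentiableAt_of_contDiffOn (A.smooth_η w) hxD A.isOpen
    have dc := differentiableAt_of_contDiffOn hc hxD A.isOpen
    have e : ∀ w w', fderiv ℝ L x w w' = fderiv ℝ c x w * A.φ x w'
        + c x * ((fderiv ℝ (fun y => A.θ y w') x w : ℝ)
          + (fderiv ℝ (fun y => A.η y w') x w : ℝ) * Complex.I) := by
      intro w w'
      have h1 : fderiv ℝ (fun y => L y w') x w = fderiv ℝ L x w w' := by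
        rw [fderiv_clm_apply (hLd x hxD) (differentiableAt_const w')]
        simp
      have h2 : (fun y => L y w') =ᶠ[nhds x] fun y => c y * A.φ y w' := by
        filter_upwards [hn] with y hy using hL y hy w'
      have h3 : HasFDerivAt (fun y => A.φ y w') _ x :=
        ((Complex.ofRealCLM.hasFDerivAt.comp x (dθ w').hasFDerivAt).add
        ((Complex.ofRealCLM.hasFDerivAt.comp x (dη w').hasFDerivAt).mul_const
          Complex.I)).congr_of_eventuallyEq (Filter.Eventually.of_forall fun y => by
            apply Complex.ext <;> simp [φ])
      have h4 := (dc.hasFDerivAt.mul h3).fderiv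
      change fderiv ℝ (fun y => c y * A.φ y w') x = _ at h4
      rw [← h1, h2.fderiv_eq, h4]
      simp
      ring
    obtain ⟨s1, s2, -⟩ := A.structure_equations hxD u v
    have hq := hclosed x hxD u v
    have hq' : (⟨A.q₁ x, A.q₂ x⟩ : ℂ) = A.q₁ x + A.q₂ x * Complex.I := by
      apply Complex.ext <;> simp
    rw [e, e]
    rw [hq'] at hq
    have s1' := congrArg (fun t : ℝ => (t : ℂ)) s1
    have s2' := congrArg (fun t : ℝ => (t : ℂ)) s2
    push_cast at s1' s2'
    linear_combination hq + c x * s1' + c x * Complex.I * s2'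
  obtain ⟨Z, hZ⟩ := (convex_ball x₀ r).exists_forall_hasFDerivAt_of_fderiv_symmetric
    Metric.isOpen_ball (fun x hx => (hLd x (hball x hx).1).differentiableWithinAt) hsymm
  have hZs : ContDiffOn ℝ ∞ Z (Metric.ball x₀ r) := by
    rw [contDiffOn_infty_iff_fderiv_of_isOpen Metric.isOpen_ball]
    refine ⟨fun x hx => (hZ x hx).differentiableAt.differentiableWithinAt, ?_⟩
    exact (hLs.mono fun x hx => (hball x hx).1).congr fun x hx => (hZ x hx).fderiv
  have hequiv : ∀ x ∈ Metric.ball x₀ r, ∃ L' : E ≃L[ℝ] ℂ, (L' : E →L[ℝ] ℂ) = L x := by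
    intro x hx
    have hinj : Function.Injective (L x : E →ₗ[ℝ] ℂ) := by
      rw [← LinearMap.ker_eq_bot, LinearMap.ker_eq_bot']
      intro w hw
      have hw' : L x w = 0 := hw
      rw [hL x (hball x hx).1] at hw'
      have := (mul_eq_zero.1 hw').resolve_left (hball x hx).2
      have := Complex.ext_iff.1 this
      exact A.injective x (hball x hx).1 w this.1 this.2
    refine ⟨(LinearEquiv.ofInjectiveOfFinrankEq _ hinj
      (by rw [hE, Complex.finrank_real_complex])).toContinuousLinearEquiv, ?_⟩
    ext w
    rfl
  have hmem := Metric.mem_ball_self (x := x₀) hr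
  obtain ⟨L₀, hL₀⟩ := hequiv x₀ hmem
  have hstrict : HasStrictFDerivAt Z (L₀ : E →L[ℝ] ℂ) x₀ := by
    rw [hL₀, ← (hZ x₀ hmem).fderiv]
    exact (hZs.contDiffAt (Metric.isOpen_ball.mem_nhds hmem)).hasStrictFDerivAt (by simp)
  set Ψ := (hstrict.toOpenPartialHomeomorph Z).restrOpen _ (Metric.isOpen_ball (x := x₀) (ε := r))
    with hΨ
  have hsrc : Ψ.source ⊆ Metric.ball x₀ r := fun x hx => hx.2
  have hcoe : ∀ x, Ψ x = Z x := fun _ => rfl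
  have hcoe' : (Ψ : E → ℂ) = Z := rfl
  refine ⟨Ψ, ⟨hstrict.mem_toOpenPartialHomeomorph_source, hmem⟩,
    fun x hx => (hball x (hsrc hx)).1, ?_, ?_, ?_⟩
  · rw [hcoe']
    exact hZs.mono hsrc
  · intro y hy
    have hys := Ψ.map_target hy
    obtain ⟨L', hL'⟩ := hequiv _ (hsrc hys)
    refine (Ψ.contDiffAt_symm hy (f₀' := L') ?_ ?_).contDiffWithinAt
    · rw [hL', hcoe']
      exact hZ _ (hsrc hys)
    · rw [hcoe']
      exact hZs.contDiffAt (Metric.isOpen_ball.mem_nhds (hsrc hys))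
  · intro x hx
    have h := hball x (hsrc hx)
    refine ⟨h.2, fun w => ?_⟩
    rw [hcoe', (hZ x (hsrc hx)).fderiv, hL x h.1]

end CoordFrame

/-! ### Passage to local coordinates -/

section Charts

variable {M : Type*} [TopologicalSpace M] [ChartedSpace E2 M]
variable {E : Type*} [NormedAddCommGroup E] [NormedSpace ℝ E]

/-- A smooth local coordinate on the surface `M` with values in a normed space; for `E = ℂ` this is
`IsSmoothCoordinate`. -/
def IsSmoothChart (z : OpenPartialHomeomorph M E) : Prop :=
  ContMDiffOn (𝓡 2) 𝓘(ℝ, E) ∞ z z.source ∧ ContMDiffOn 𝓘(ℝ, E) (𝓡 2) ∞ z.symm z.target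

namespace IsSmoothChart

variable {z : OpenPartialHomeomorph M E} (hz : IsSmoothChart z)
include hz

lemma mdifferentiableAt {q : M} (hq : q ∈ z.source) :
    MDifferentiableAt (𝓡 2) 𝓘(ℝ, E) z q :=
  (hz.1.contMDiffAt (z.open_source.mem_nhds hq)).mdifferentiableAt (by simp)

lemma mdifferentiableAt_symm {x : E} (hx : x ∈ z.target) :
    MDifferentiableAt 𝓘(ℝ, E) (𝓡 2) z.symm x :=
  (hz.2.contMDiffAt (z.open_target.mem_nhds hx)).mdifferentiableAt (by simp)

lemma dAt_comp {F : Type*} [NormedAddCommGroup F] [NormedSpace ℝ F] {g : E → F} {q : M}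
    (hq : q ∈ z.source) (hg : DifferentiableAt ℝ g (z q)) (v : TangentSpace (𝓡 2) q) :
    dAt (g ∘ z) q v = fderiv ℝ g (z q) (dAt z q v) := by
  have h := mfderiv_comp (I := 𝓡 2) (I' := 𝓘(ℝ, E)) (I'' := 𝓘(ℝ, F)) q
    hg.mdifferentiableAt (hz.mdifferentiableAt hq)
  unfold dAt
  rw [h, mfderiv_eq_fderiv]
  rfl

lemma dAt_eq {F : Type*} [NormedAddCommGroup F] [NormedSpace ℝ F] {g : M → F} {q : M}
    (hq : q ∈ z.source) (hg : DifferentiableAt ℝ (g ∘ z.symm) (z q)) (v : TangentSpace (𝓡 2) q) :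
    dAt g q v = fderiv ℝ (g ∘ z.symm) (z q) (dAt z q v) := by
  rw [← hz.dAt_comp hq hg]
  have : g =ᶠ[nhds q] (g ∘ z.symm) ∘ z := by
    filter_upwards [z.open_source.mem_nhds hq] with y hy
    simp [z.left_inv hy]
  unfold dAt
  rw [this.mfderiv_eq]

/-- The differential of a smooth coordinate is bijective. -/
lemma exists_inverse {q : M} (hq : q ∈ z.source) :
    ∃ S : E →L[ℝ] TangentSpace (𝓡 2) q, (∀ v, S (dAt z q v) = v) ∧ ∀ w, dAt z q (S w) = w := by
  have hx : z q ∈ z.target := z.map_source hq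
  have h1 := hz.mdifferentiableAt hq
  have h2 := hz.mdifferentiableAt_symm hx
  have h2' : MDifferentiableAt (𝓡 2) 𝓘(ℝ, E) z (z.symm (z q)) := by rwa [z.left_inv hq]
  have c1 := mfderiv_comp (I := 𝓡 2) (I' := 𝓘(ℝ, E)) (I'' := 𝓡 2) q h2 h1
  have c2 := mfderiv_comp (I := 𝓘(ℝ, E)) (I' := 𝓡 2) (I'' := 𝓘(ℝ, E)) (z q) h2' h2
  have e1 : z.symm ∘ z =ᶠ[nhds q] id := by
    filter_upwards [z.open_source.mem_nhds hq] with y hy using z.left_inv hy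
  have e2 : z ∘ z.symm =ᶠ[nhds (z q)] id := by
    filter_upwards [z.open_target.mem_nhds hx] with y hy using z.right_inv hy
  rw [e1.mfderiv_eq] at c1
  rw [e2.mfderiv_eq] at c2
  rw [mfderiv_id] at c1 c2
  have hE : ∀ w : E, w = mfderiv (𝓡 2) 𝓘(ℝ, E) z (z.symm (z q))
      (mfderiv 𝓘(ℝ, E) (𝓡 2) z.symm (z q) w) := fun w => congrArg (fun T => T w) c2
  have hT : ∀ v : TangentSpace (𝓡 2) q, v = mfderiv 𝓘(ℝ, E) (𝓡 2) z.symm (z q)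
      (mfderiv (𝓡 2) 𝓘(ℝ, E) z q v) := fun v => congrArg (fun T => T v) c1
  refine ⟨mfderiv 𝓘(ℝ, E) (𝓡 2) z.symm (z q), fun v => (hT v).symm, fun w => ?_⟩
  have := (hE w).symm
  rw [z.left_inv hq] at this
  exact this

lemma surjective_dAt {q : M} (hq : q ∈ z.source) (w : E) :
    ∃ v : TangentSpace (𝓡 2) q, dAt z q v = w := by
  obtain ⟨S, -, h2⟩ := hz.exists_inverse hq
  exact ⟨S w, h2 w⟩

lemma contDiffOn_comp_symm {F : Type*} [NormedAddCommGroup F] [NormedSpace ℝ F] {g : M → F}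
    {s : Set M} (hg : ContMDiffOn (𝓡 2) 𝓘(ℝ, F) ∞ g s) :
    ContDiffOn ℝ ∞ (g ∘ z.symm) (z.target ∩ z.symm ⁻¹' s) :=
  contMDiffOn_iff_contDiffOn.1 (hg.comp (hz.2.mono inter_subset_left) fun _ hx => hx.2)

lemma contMDiffOn_comp {F : Type*} [NormedAddCommGroup F] [NormedSpace ℝ F] {g : E → F}
    {D : Set E} (hg : ContDiffOn ℝ ∞ g D) :
    ContMDiffOn (𝓡 2) 𝓘(ℝ, F) ∞ (g ∘ z) (z.source ∩ z ⁻¹' D) :=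
  (contMDiffOn_iff_contDiffOn.2 hg).comp (hz.1.mono inter_subset_left) fun _ hx => hx.2

lemma trans {E' : Type*} [NormedAddCommGroup E'] [NormedSpace ℝ E']
    {Ψ : OpenPartialHomeomorph E E'} (h1 : ContDiffOn ℝ ∞ Ψ Ψ.source)
    (h2 : ContDiffOn ℝ ∞ Ψ.symm Ψ.target) : IsSmoothChart (z.trans Ψ) := by
  constructor
  · have := hz.contMDiffOn_comp h1
    simpa [OpenPartialHomeomorph.trans_source] using this
  · have h2' := contMDiffOn_iff_contDiffOn.2 h2
    rw [OpenPartialHomeomorph.trans_target, OpenPartialHomeomorph.coe_trans_symm]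
    exact hz.2.comp (h2'.mono inter_subset_left) fun _ hx => hx.2

lemma restr {s : Set M} (hs : IsOpen s) : IsSmoothChart (z.restrOpen s hs) := by
  constructor
  · exact hz.1.mono fun x hx => hx.1
  · refine hz.2.mono fun x hx => ?_
    have := (z.restrOpen s hs).map_target hx
    have h2 : x ∈ (z.restrOpen s hs).symm.source := hx
    simp only [OpenPartialHomeomorph.restrOpen, OpenPartialHomeomorph.symm_source] at h2
    exact h2.1

end IsSmoothChart

lemma isSmoothChart_chartAt [IsManifold (𝓡 2) ∞ M] (p : M) :
    IsSmoothChart (chartAt E2 p) :=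
  ⟨contMDiffOn_chart, contMDiffOn_chart_symm⟩

end Charts

/-! ### The null lines of a frame field -/

lemma planeNormal_sum (n : E3) : planeNormal n 0 + planeNormal n 3 = 1 := by
  simp [planeNormal]; ring

lemma spherePoint_sum (c : E3) : spherePoint c 0 0 + spherePoint c 0 3 = 0 := by
  simp [spherePoint]; ring

/-- A parametrization of the null line of a contact element is determined by the sums of the first
and the last coordinate. -/
lemma eq_of_line_eq {x v : V4} {c n : E3}
    (h : line x v = line (spherePoint c 0) (planeNormal n)) :
    x = spherePoint c 0 + (x 0 + x 3) • planeNormal n ∧ v = (v 0 + v 3) • planeNormal n := by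
  have h1 : x ∈ line (spherePoint c 0) (planeNormal n) := h ▸ ⟨0, by simp⟩
  have h2 : x + v ∈ line (spherePoint c 0) (planeNormal n) := h ▸ ⟨1, by simp⟩
  obtain ⟨t, ht⟩ := h1
  obtain ⟨t', ht'⟩ := h2
  have hs := planeNormal_sum n
  have hc := spherePoint_sum c
  have hx : x 0 + x 3 = t := by
    rw [← ht]
    simp only [Pi.add_apply, Pi.smul_apply, smul_eq_mul]
    linear_combination hc + t * hs
  have hv : v = (t' - t) • planeNormal n := by
    have : v = (spherePoint c 0 + t' • planeNormal n) - (spherePoint c 0 + t • planeNormal n) := by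
      simp only at ht ht'
      rw [ht, ht']
      simp
    rw [this, sub_smul]
    abel
  have hv' : v 0 + v 3 = t' - t := by
    rw [hv]
    simp only [Pi.smul_apply, smul_eq_mul]
    linear_combination (t' - t) * hs
  exact ⟨by rw [hx]; exact ht.symm, by rw [hv']; exact hv⟩

lemma line_eq_of_eq {x v : V4} {c n : E3} {s l : ℝ} (hl : l ≠ 0)
    (hx : x = spherePoint c 0 + s • planeNormal n) (hv : v = l • planeNormal n) :
    line x v = line (spherePoint c 0) (planeNormal n) := by
  ext y
  constructor
  · rintro ⟨t, rfl⟩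
    exact ⟨s + t * l, by simp only [hx, hv]; module⟩
  · rintro ⟨t, rfl⟩
    refine ⟨(t - s) / l, ?_⟩
    simp only [hx, hv, smul_smul, div_mul_cancel₀ _ hl]
    module

lemma IsLaguerreBasis.sum_pos {a : Fin 4 → V4} (ha : IsLaguerreBasis a) :
    0 < a 0 0 + a 0 3 := by
  have := ha.2.1.2
  simp [lorentz] at this
  linarith

/-- The oriented spheres as a linear function of the centre and the radius. -/
def spherePointLin : E3 × ℝ →L[ℝ] V4 :=
  LinearMap.toContinuousLinearMap
    { toFun := fun y => spherePoint y.1 y.2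
      map_add' := fun v w => by
        ext i; fin_cases i <;> simp [spherePoint] <;> ring
      map_smul' := fun r w => by
        ext i; fin_cases i <;> simp [spherePoint] <;> ring }

lemma spherePointLin_apply (c : E3) (r : ℝ) : spherePointLin (c, r) = spherePoint c r := rfl

lemma planeNormal_eq_spherePoint (n : E3) : planeNormal n = (1 / √2) • spherePoint n 1 := by
  have h : √2 * √2 = 2 := Real.mul_self_sqrt (by norm_num)
  have h0 : √2 ≠ 0 := by positivity
  ext i
  fin_cases i <;> simp [spherePoint, planeNormal] <;> field_simp <;> rw [Real.sq_sqrt (by norm_num)]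

lemma lorentz_spherePoint (c d : E3) (r s : ℝ) :
    lorentz (spherePoint c r) (spherePoint d s) = ⟪c, d⟫_ℝ - r * s := by
  have h : √2 * √2 = 2 := Real.mul_self_sqrt (by norm_num)
  have h0 : √2 ≠ 0 := by positivity
  simp only [lorentz, spherePoint, PiLp.inner_apply, Fin.sum_univ_three]
  simp
  field_simp
  rw [Real.sq_sqrt (by norm_num)]
  ring

/-! ### Frames along a Legendre immersion of a plane domain -/

section Plane

variable {E : Type*} [NormedAddCommGroup E] [NormedSpace ℝ E]

/-- `(f, n)` is a Legendre immersion of the open set `D` with `dn · dn > 0`. -/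
structure IsLegendreOn (D : Set E) (f n : E → E3) : Prop where
  isOpen : IsOpen D
  smooth_f : ContDiffOn ℝ ∞ f D
  smooth_n : ContDiffOn ℝ ∞ n D
  norm_n : ∀ x ∈ D, ‖n x‖ = 1
  contact : ∀ x ∈ D, ∀ w, ⟪fderiv ℝ f x w, n x⟫_ℝ = 0
  immersive : ∀ x ∈ D, ∀ w, fderiv ℝ n x w = 0 → w = 0

namespace IsLegendreOn

variable {D : Set E} {f n : E → E3} (h : IsLegendreOn D f n)
include h

lemma differentiableAt_f {x : E} (hx : x ∈ D) : DifferentiableAt ℝ f x :=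
  (h.smooth_f.contDiffAt (h.isOpen.mem_nhds hx)).differentiableAt (by simp)

lemma differentiableAt_n {x : E} (hx : x ∈ D) : DifferentiableAt ℝ n x :=
  (h.smooth_n.contDiffAt (h.isOpen.mem_nhds hx)).differentiableAt (by simp)

lemma inner_fderiv_n {x : E} (hx : x ∈ D) (w : E) : ⟪fderiv ℝ n x w, n x⟫_ℝ = 0 := by
  have hd := h.differentiableAt_n hx
  have h1 := fderiv_inner_apply ℝ hd hd w
  have h2 : (fun y => ⟪n y, n y⟫_ℝ) =ᶠ[nhds x] fun _ => (1 : ℝ) := by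
    filter_upwards [h.isOpen.mem_nhds hx] with y hy
    rw [real_inner_self_eq_norm_sq, h.norm_n y hy, one_pow]
  rw [h2.fderiv_eq] at h1
  simp only [fderiv_fun_const, Pi.zero_apply, zero_apply] at h1
  rw [real_inner_comm (fderiv ℝ n x w) (n x)] at h1
  linarith

lemma mono {D' : Set E} (hD' : IsOpen D') (hs : D' ⊆ D) : IsLegendreOn D' f n :=
  ⟨hD', h.smooth_f.mono hs, h.smooth_n.mono hs, fun x hx => h.norm_n x (hs hx),
    fun x hx => h.contact x (hs hx), fun x hx => h.immersive x (hs hx)⟩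

end IsLegendreOn

/-- Derivative of a family of oriented spheres `spherePoint (c x) (r x)`. -/
lemma hasFDerivAt_spherePoint {c : E → E3} {r : E → ℝ} {x : E} (hc : DifferentiableAt ℝ c x)
    (hr : DifferentiableAt ℝ r x) (w : E) :
    DifferentiableAt ℝ (fun y => spherePoint (c y) (r y)) x ∧
    fderiv ℝ (fun y => spherePoint (c y) (r y)) x w
      = spherePoint (fderiv ℝ c x w) (fderiv ℝ r x w) := by
  have := spherePointLin.hasFDerivAt.comp x (hc.hasFDerivAt.prodMk hr.hasFDerivAt)
  have h2 : HasFDerivAt (fun y => spherePoint (c y) (r y)) _ x := this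
  refine ⟨h2.differentiableAt, ?_⟩
  rw [h2.fderiv]
  rfl

/-- Derivative of a multiple `l • spherePoint n 1` of the null direction of a plane. -/
lemma hasFDerivAt_smul_spherePoint {b : E → V4} {n : E → E3} {l : E → ℝ} {x : E}
    (hb : ∀ᶠ y in nhds x, b y = l y • spherePoint (n y) 1) (hn : DifferentiableAt ℝ n x)
    (hl : DifferentiableAt ℝ l x) (w : E) :
    fderiv ℝ b x w = l x • spherePoint (fderiv ℝ n x w) 0
      + fderiv ℝ l x w • spherePoint (n x) 1 := by
  have hs := hasFDerivAt_spherePoint hn (differentiableAt_const (1 : ℝ)) w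
  have hb' : b =ᶠ[nhds x] fun y => l y • spherePoint (n y) 1 := hb
  rw [hb'.fderiv_eq, fderiv_fun_smul hl hs.1]
  simp only [add_apply, smul_apply, ContinuousLinearMap.smulRight_apply, hs.2]
  simp

namespace CoordFrame

variable {D : Set E} (A : CoordFrame D)

/-- The frame field `A` belongs to the Legendre immersion `(f, n)`. -/
def Along (f n : E → E3) : Prop :=
  ∀ x ∈ D, line (A.a₀ x) (A.a 0 x) = line (spherePoint (f x) 0) (planeNormal (n x))

/-- The signed radius of the oriented sphere `a₀`. -/
def radius (x : E) : ℝ := (A.a₀ x 0 + A.a₀ x 3) / √2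

/-- The positive factor `l` with `a₁ = l • spherePoint n 1`. -/
def scale (x : E) : ℝ := (A.a 0 x 0 + A.a 0 x 3) / √2

lemma scale_pos {x : E} (hx : x ∈ D) : 0 < A.scale x :=
  div_pos (A.basis x hx).sum_pos (by positivity)

lemma smooth_radius : ContDiffOn ℝ ∞ A.radius D :=
  ((contDiffOn_pi.1 A.smooth_a₀ 0).add (contDiffOn_pi.1 A.smooth_a₀ 3)).div_const _

lemma smooth_scale : ContDiffOn ℝ ∞ A.scale D :=
  ((contDiffOn_pi.1 (A.smooth_a 0) 0).add (contDiffOn_pi.1 (A.smooth_a 0) 3)).div_const _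

end CoordFrame

lemma spherePoint_add_smul (c n : E3) (r s : ℝ) :
    spherePoint c r + s • spherePoint n 1 = spherePoint (c + s • n) (r + s) := by
  rw [← spherePointLin_apply, ← spherePointLin_apply, ← spherePointLin_apply, ← map_smul, ← map_add]
  simp

namespace CoordFrame

variable {D : Set E} {A : CoordFrame D} {f n : E → E3}

lemma Along.a₀_eq (hA : A.Along f n) {x : E} (hx : x ∈ D) :
    A.a₀ x = spherePoint (f x + A.radius x • n x) (A.radius x) := by
  have h := (eq_of_line_eq (hA x hx)).1
  rw [planeNormal_eq_spherePoint, smul_smul, spherePoint_add_smul] at h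
  rw [h, radius, mul_one_div, zero_add]

lemma Along.a_zero_eq (hA : A.Along f n) {x : E} (hx : x ∈ D) :
    A.a 0 x = A.scale x • spherePoint (n x) 1 := by
  have h := (eq_of_line_eq (hA x hx)).2
  rw [planeNormal_eq_spherePoint, smul_smul, mul_one_div] at h
  exact h

/-- The relations between the middle coframe and the fundamental forms of `(f, n)`. -/
lemma Along.forms (hA : A.Along f n) (hL : IsLegendreOn D f n) {x : E} (hx : x ∈ D) (v w : E) :
    (A.θ x v * A.θ x w + A.η x v * A.η x w
      = ⟪fderiv ℝ f x v + A.radius x • fderiv ℝ n x v,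
          fderiv ℝ f x w + A.radius x • fderiv ℝ n x w⟫_ℝ) ∧
    (A.θ x v * A.θ x w + A.η x v * A.η x w
      = A.scale x ^ 2 * ⟪fderiv ℝ n x v, fderiv ℝ n x w⟫_ℝ) ∧
    (A.θ x v * A.θ x w - A.η x v * A.η x w
      = A.scale x * ⟪fderiv ℝ f x v + A.radius x • fderiv ℝ n x v, fderiv ℝ n x w⟫_ℝ) := by
  have hn := hL.isOpen.mem_nhds hx
  have df := hL.differentiableAt_f hx
  have dn := hL.differentiableAt_n hx
  have ds := differentiableAt_of_contDiffOn A.smooth_radius hx A.isOpen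
  have dl := differentiableAt_of_contDiffOn A.smooth_scale hx A.isOpen
  have e₀ : A.a₀ =ᶠ[nhds x] fun y => spherePoint (f y + A.radius y • n y) (A.radius y) := by
    filter_upwards [hn] with y hy using hA.a₀_eq hy
  have e₁ : A.a 0 =ᶠ[nhds x] fun y => A.scale y • spherePoint (n y) 1 := by
    filter_upwards [hn] with y hy using hA.a_zero_eq hy
  have d₀ : ∀ u, fderiv ℝ A.a₀ x u = spherePoint (fderiv ℝ f x u + A.radius x • fderiv ℝ n x u)
      0 + fderiv ℝ A.radius x u • spherePoint (n x) 1 := by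
    intro u
    rw [e₀.fderiv_eq, (hasFDerivAt_spherePoint (df.fun_add (ds.fun_smul dn)) ds u).2,
      spherePoint_add_smul]
    congr 1
    · rw [(df.hasFDerivAt.fun_add (ds.hasFDerivAt.fun_smul dn.hasFDerivAt)).fderiv]
      simp
      abel
    · simp
  have d₁ : ∀ u, fderiv ℝ (A.a 0) x u = A.scale x • spherePoint (fderiv ℝ n x u) 0
      + fderiv ℝ A.scale x u • spherePoint (n x) 1 :=
    fun u => hasFDerivAt_smul_spherePoint e₁ dn dl u
  have nn : ⟪n x, n x⟫_ℝ = 1 := by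
    rw [real_inner_self_eq_norm_sq, hL.norm_n x hx, one_pow]
  have n1 := hL.contact x hx
  have n2 := fun u => hL.inner_fderiv_n hx u
  have n1' : ∀ u, ⟪n x, fderiv ℝ f x u⟫_ℝ = 0 := fun u => by rw [real_inner_comm, n1]
  have n2' : ∀ u, ⟪n x, fderiv ℝ n x u⟫_ℝ = 0 := fun u => by rw [real_inner_comm, n2]
  have hb := A.basis x hx
  have f₀ : ∀ u, fderiv ℝ A.a₀ x u = ∑ k, ![0, A.θ x u, A.η x u, 0] k • A.a k x := by
    intro u
    rw [A.d_a₀ x hx]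
    simp [Fin.sum_univ_four]
  have g0 := hb.lorentz_sum ![0, A.θ x v, A.η x v, 0] ![0, A.θ x w, A.η x w, 0]
  have g1 := hb.lorentz_sum
    (fun k => connMatrix (A.p₁ x) (A.p₂ x) (A.p₃ x) (A.q₁ x) (A.q₂ x) (A.θ x v) (A.η x v) k 0)
    (fun k => connMatrix (A.p₁ x) (A.p₂ x) (A.p₃ x) (A.q₁ x) (A.q₂ x) (A.θ x w) (A.η x w) k 0)
  have g2 := hb.lorentz_sum ![0, A.θ x v, A.η x v, 0]
    (fun k => connMatrix (A.p₁ x) (A.p₂ x) (A.p₃ x) (A.q₁ x) (A.q₂ x) (A.θ x w) (A.η x w) k 0)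
  rw [← f₀, ← f₀, d₀, d₀] at g0
  rw [← A.d_a x hx v 0, ← A.d_a x hx w 0, d₁, d₁] at g1
  rw [← f₀, ← A.d_a x hx w 0, d₀, d₁] at g2
  simp only [lorentz_add_left, lorentz_add_right, lorentz_smul_left, lorentz_smul_right,
    lorentz_spherePoint, inner_add_left, inner_add_right, inner_smul_left, inner_smul_right, n1,
    n2, n1', n2', nn, connMatrix, Matrix.of_apply, Matrix.cons_val, RCLike.conj_to_real]
    at g0 g1 g2 ⊢
  refine ⟨?_, ?_, ?_⟩
  · linear_combination -g0
  · linear_combination -g1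
  · linear_combination -g2

/-- Two orthogonal rows of equal length in the plane have columns of equal length. -/
lemma sq_columns {a b c d : ℝ} (h1 : a ^ 2 + b ^ 2 = c ^ 2 + d ^ 2) (h2 : a * c + b * d = 0) :
    a ^ 2 + c ^ 2 = b ^ 2 + d ^ 2 := by
  have h3 : (a ^ 2 + b ^ 2) * (c ^ 2 - b ^ 2) = 0 := by
    have : a ^ 2 * c ^ 2 = b ^ 2 * d ^ 2 := by
      linear_combination (a * c - b * d) * h2
    linear_combination this + b ^ 2 * (-h1)
  rcases mul_eq_zero.1 h3 with h | h
  · have ha : a = 0 := by nlinarith [sq_nonneg a, sq_nonneg b]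
    have hb : b = 0 := by nlinarith [sq_nonneg a, sq_nonneg b]
    have hc : c = 0 := by nlinarith [sq_nonneg c, sq_nonneg d]
    have hd : d = 0 := by nlinarith [sq_nonneg c, sq_nonneg d]
    simp [ha, hb, hc, hd]
  · linarith

/-- The radius `r` of `a₀` and the factor `l` of `a₁` are determined by `f` and `n`: the form
`df · dn + r dn · dn` has trace zero with respect to `dn · dn`, and
`l² dn · dn = (df + r dn) · (df + r dn)`. -/
lemma radius_scale_unique (hE : Module.finrank ℝ E = 2) {B : CoordFrame D} (hA : A.Along f n)
    (hB : B.Along f n) (hL : IsLegendreOn D f n) {x : E} (hx : x ∈ D) :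
    A.radius x = B.radius x ∧ A.scale x = B.scale x := by
  obtain ⟨e, e', h1, h2, h3, h4, -⟩ := A.exists_dual hE hx
  have lA := A.scale_pos hx
  have lB := B.scale_pos hx
  have FA := fun v w => hA.forms hL hx v w
  have FB := fun v w => hB.forms hL hx v w
  have A1 := (FA e e).2.1
  have A2 := (FA e' e').2.1
  have A3 := (FA e e').2.1
  have A4 := (FA e e).2.2
  have A5 := (FA e' e').2.2
  have B1 := (FB e e).2.1
  have B2 := (FB e' e').2.1
  have B3 := (FB e e').2.1
  have B4 := (FB e e).2.2
  have B5 := (FB e' e').2.2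
  simp only [h1, h2, h3, h4] at A1 A2 A3 A4 A5
  simp only [inner_add_left, inner_smul_left, RCLike.conj_to_real] at A4 A5 B4 B5
  have hc0 : ⟪fderiv ℝ n x e, fderiv ℝ n x e'⟫_ℝ = 0 := by
    have : A.scale x ^ 2 * ⟪fderiv ℝ n x e, fderiv ℝ n x e'⟫_ℝ = 0 := by linarith
    exact (mul_eq_zero.1 this).resolve_left (by positivity)
  have hcc : ⟪fderiv ℝ n x e, fderiv ℝ n x e⟫_ℝ = ⟪fderiv ℝ n x e', fderiv ℝ n x e'⟫_ℝ :=
    mul_left_cancel₀ (pow_ne_zero 2 lA.ne') (by linarith)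
  have hcol := sq_columns (a := B.θ x e) (b := B.η x e) (c := B.θ x e') (d := B.η x e')
    (by rw [hcc] at B1; linarith) (by rw [hc0] at B3; linarith)
  set c := ⟪fderiv ℝ n x e, fderiv ℝ n x e⟫_ℝ
  have hcpos : c ≠ 0 := by
    intro h0
    rw [h0] at A1
    simp at A1
  have tA : ⟪fderiv ℝ f x e, fderiv ℝ n x e⟫_ℝ + ⟪fderiv ℝ f x e', fderiv ℝ n x e'⟫_ℝ
      + 2 * A.radius x * c = 0 := by
    apply mul_left_cancel₀ lA.ne'
    rw [← hcc] at A5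
    linear_combination -A4 - A5
  have tB : ⟪fderiv ℝ f x e, fderiv ℝ n x e⟫_ℝ + ⟪fderiv ℝ f x e', fderiv ℝ n x e'⟫_ℝ
      + 2 * B.radius x * c = 0 := by
    apply mul_left_cancel₀ lB.ne'
    rw [← hcc] at B5
    linear_combination -B4 - B5 + hcol
  have hr : A.radius x = B.radius x := by
    apply mul_right_cancel₀ hcpos
    linarith
  refine ⟨hr, ?_⟩
  have hsq : A.scale x ^ 2 = B.scale x ^ 2 := by
    apply mul_right_cancel₀ hcpos
    have a1 := (FA e e).1
    have b1 := (FB e e).1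
    have a2 := (FA e e).2.1
    rw [hr] at a1
    linarith
  nlinarith

/-- Two middle frame fields along the same Legendre immersion agree up to a common sign of `a₂`
and `a₃`. -/
theorem unique (hE : Module.finrank ℝ E = 2) {B : CoordFrame D} (hA : A.Along f n)
    (hB : B.Along f n) (hL : IsLegendreOn D f n) {x : E} (hx : x ∈ D) :
    ∃ ε : ℝ, ε ^ 2 = 1 ∧ (∀ w, B.θ x w = ε * A.θ x w ∧ B.η x w = ε * A.η x w) ∧
      B.p₁ x = A.p₁ x ∧ B.p₂ x = A.p₂ x ∧ B.p₃ x = A.p₃ x := by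
  have ha₀ : ∀ y ∈ D, A.a₀ y = B.a₀ y := fun y hy => by
    rw [hA.a₀_eq hy, hB.a₀_eq hy, (radius_scale_unique hE hA hB hL hy).1]
  have ha₁ : ∀ y ∈ D, A.a 0 y = B.a 0 y := fun y hy => by
    rw [hA.a_zero_eq hy, hB.a_zero_eq hy, (radius_scale_unique hE hA hB hL hy).2]
  have pointwise : ∀ y ∈ D, ∃ ε : ℝ, ε ^ 2 = 1 ∧
      (∀ w, B.θ y w = ε * A.θ y w ∧ B.η y w = ε * A.η y w) ∧
      B.a 1 y = ε • A.a 1 y ∧ B.a 2 y = ε • A.a 2 y ∧ B.a 3 y = A.a 3 y := by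
    intro y hy
    obtain ⟨hr, hs⟩ := radius_scale_unique hE hA hB hL hy
    obtain ⟨e, e', h1, h2, h3, h4, h5⟩ := A.exists_dual hE hy
    have hθ : ∀ v w, A.θ y v * A.θ y w = B.θ y v * B.θ y w := by
      intro v w
      have a1 := (hA.forms hL hy v w).1
      have a2 := (hA.forms hL hy v w).2.2
      have b1 := (hB.forms hL hy v w).1
      have b2 := (hB.forms hL hy v w).2.2
      rw [hr] at a1
      rw [hr, hs] at a2
      linarith
    have hη : ∀ v w, A.η y v * A.η y w = B.η y v * B.η y w := by
      intro v w
      have a1 := (hA.forms hL hy v w).1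
      have b1 := (hB.forms hL hy v w).1
      rw [hr] at a1
      linarith [hθ v w]
    have k1 : B.θ y e ^ 2 = 1 := by have := hθ e e; rw [h1] at this; linarith
    have k2 : B.η y e' ^ 2 = 1 := by have := hη e' e'; rw [h4] at this; linarith
    have k3 : B.η y e = 0 := by
      have := hη e e; rw [h2] at this
      exact mul_self_eq_zero.1 (by linarith)
    have k4 : B.θ y e' = 0 := by
      have := hθ e' e'; rw [h3] at this
      exact mul_self_eq_zero.1 (by linarith)
    have hd : ∀ w, fderiv ℝ A.a₀ y w = fderiv ℝ B.a₀ y w := by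
      intro w
      have : A.a₀ =ᶠ[nhds y] B.a₀ := by
        filter_upwards [A.isOpen.mem_nhds hy] with t ht using ha₀ t ht
      rw [this.fderiv_eq]
    have m1 := hd e
    have m2 := hd e'
    rw [A.d_a₀ y hy, B.d_a₀ y hy, h1, h2, k3] at m1
    rw [A.d_a₀ y hy, B.d_a₀ y hy, h3, h4, k4] at m2
    simp only [one_smul, zero_smul, add_zero, zero_add] at m1 m2
    have n1 : B.a 1 y = B.θ y e • A.a 1 y := by
      rw [m1, smul_smul, ← pow_two, k1, one_smul]
    have n2 : B.a 2 y = B.η y e' • A.a 2 y := by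
      rw [m2, smul_smul, ← pow_two, k2, one_smul]
    have bA := A.basis y hy
    have bB := B.basis y hy
    have n3 : B.a 3 y = A.a 3 y := by
      have hexp := bA.expansion (B.a 3 y)
      obtain ⟨-, -, -, -, -, -, -, -, -, c33⟩ := bB.products
      obtain ⟨-, -, c30, -, c31, c32⟩ := bB.products'
      have u0 : lorentz (B.a 3 y) (A.a 0 y) = -1 := by rw [ha₁ y hy]; exact c30
      have u1 : lorentz (B.a 3 y) (A.a 1 y) = 0 := by
        rw [m1, lorentz_smul_right]
        rw [c31, mul_zero]
      have u2 : lorentz (B.a 3 y) (A.a 2 y) = 0 := by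
        rw [m2, lorentz_smul_right]
        rw [c32, mul_zero]
      obtain ⟨-, -, -, -, -, -, -, -, -, a33⟩ := bA.products
      rw [u0, u1, u2] at hexp
      have hexp' : B.a 3 y = (-lorentz (B.a 3 y) (A.a 3 y)) • A.a 0 y + A.a 3 y := by
        conv_lhs => rw [hexp]
        simp
      have u3 : lorentz (B.a 3 y) (A.a 3 y) = 0 := by
        have h := c33
        nth_rewrite 2 [hexp'] at h
        rw [lorentz_add_right, lorentz_smul_right, u0] at h
        linarith
      rw [hexp', u3]
      simp
    have hdet : (frameMatrix fun i => B.a i y).det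
        = B.θ y e * B.η y e' * (frameMatrix fun i => A.a i y).det := by
      have hm : (frameMatrix fun i => B.a i y) = (frameMatrix fun i => A.a i y)
          * Matrix.diagonal ![1, B.θ y e, B.η y e', 1] := by
        ext i j
        rw [Matrix.mul_diagonal]
        fin_cases j
        · simp [frameMatrix, ha₁ y hy]
        · simp [frameMatrix, n1, mul_comm]
        · simp [frameMatrix, n2, mul_comm]
        · simp [frameMatrix, n3]
      rw [hm, Matrix.det_mul, Matrix.det_diagonal, Fin.prod_univ_four]
      simp
      ring
    have hpos : 0 < B.θ y e * B.η y e' := by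
      have p1 := bA.2.2.2
      have p2 := bB.2.2.2
      rw [hdet] at p2
      exact (pos_iff_pos_of_mul_pos p2).2 p1
    have heq : B.η y e' = B.θ y e := by
      have : (B.θ y e * B.η y e') ^ 2 = 1 := by rw [mul_pow, k1, k2, one_mul]
      have h1 : B.θ y e * B.η y e' = 1 := by nlinarith
      calc B.η y e' = B.θ y e ^ 2 * B.η y e' := by rw [k1, one_mul]
        _ = B.θ y e := by rw [pow_two, mul_assoc, h1, mul_one]
    refine ⟨B.θ y e, k1, fun w => ?_, n1, heq ▸ n2, n3⟩
    constructor
    · conv_lhs => rw [h5 w, B.θ_linear hy, k4]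
      ring
    · conv_lhs => rw [h5 w, B.η_linear hy, k3, heq]
      ring
  obtain ⟨ε, hε, hcof, e1, e2, e3⟩ := pointwise x hx
  refine ⟨ε, hε, hcof, ?_⟩
  obtain ⟨e, e', h1, h2, h3, h4, h5⟩ := A.exists_dual hE hx
  have hd : ∀ w, fderiv ℝ (B.a 3) x w = fderiv ℝ (A.a 3) x w := by
    intro w
    have : B.a 3 =ᶠ[nhds x] A.a 3 := by
      filter_upwards [A.isOpen.mem_nhds hx] with t ht
      obtain ⟨-, -, -, -, -, h⟩ := pointwise t ht
      exact h
    rw [this.fderiv_eq]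
  have key : ∀ w, B.p₁ x * A.θ x w + B.p₂ x * A.η x w = A.p₁ x * A.θ x w + A.p₂ x * A.η x w ∧
      B.p₂ x * A.θ x w + B.p₃ x * A.η x w = A.p₂ x * A.θ x w + A.p₃ x * A.η x w := by
    intro w
    have h := hd w
    rw [A.d_a x hx, B.d_a x hx] at h
    simp only [Fin.sum_univ_four, connMatrix, Matrix.of_apply, Matrix.cons_val, e1, e2, e3,
      (hcof w).1, (hcof w).2, ← ha₁ x hx] at h
    have hz : ∑ k, (fun k => connMatrix (B.p₁ x) (B.p₂ x) (B.p₃ x) (ε * B.q₁ x) (ε * B.q₂ x)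
        (A.θ x w) (A.η x w) k 3
        - connMatrix (A.p₁ x) (A.p₂ x) (A.p₃ x) (A.q₁ x) (A.q₂ x) (A.θ x w) (A.η x w) k 3) k
        • A.a k x = 0 := by
      simp only [Fin.sum_univ_four, connMatrix, Matrix.of_apply, Matrix.cons_val]
      rw [← sub_eq_zero] at h
      rw [← h]
      have hm : ∀ t : ℝ, ε * (ε * t) = t := fun t => by rw [← mul_assoc, ← pow_two, hε, one_mul]
      have r1 : B.p₁ x * A.θ x w + B.p₂ x * A.η x w
          = (B.p₁ x * (ε * A.θ x w) + B.p₂ x * (ε * A.η x w)) * ε := by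
        linear_combination (-(B.p₁ x * A.θ x w + B.p₂ x * A.η x w)) * hε
      have r2 : B.p₂ x * A.θ x w + B.p₃ x * A.η x w
          = (B.p₂ x * (ε * A.θ x w) + B.p₃ x * (ε * A.η x w)) * ε := by
        linear_combination (-(B.p₂ x * A.θ x w + B.p₃ x * A.η x w)) * hε
      rw [r1, r2]
      module
    have hz' := (A.basis x hx).eq_zero_of_sum hz
    have z1 := congrFun hz' 1
    have z2 := congrFun hz' 2
    simp only [connMatrix, Matrix.of_apply, Matrix.cons_val, Pi.zero_apply] at z1 z2
    constructor <;> linarith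
  have ke := key e
  have kf := key e'
  simp only [h1, h2, h3, h4] at ke kf
  refine ⟨?_, ?_, ?_⟩ <;> linarith [ke.1, ke.2, kf.1, kf.2]

end CoordFrame

end Plane

/-! ### Middle frames and their expressions in coordinates -/

section Transfer

variable {M : Type*} [TopologicalSpace M] [ChartedSpace E2 M]
variable {E : Type*} [NormedAddCommGroup E] [NormedSpace ℝ E]
variable {F : LegendreImmersion M} {z : OpenPartialHomeomorph M E}

lemma IsSmoothChart.differentiableAt_comp_symm (hz : IsSmoothChart z) {G : Type*}
    [NormedAddCommGroup G] [NormedSpace ℝ G] {g : M → G} {s : Set M} (hs : IsOpen s)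
    (hg : ContMDiffOn (𝓡 2) 𝓘(ℝ, G) ∞ g s) {q : M} (hq : q ∈ z.source) (hqs : q ∈ s) :
    DifferentiableAt ℝ (g ∘ z.symm) (z q) :=
  CoordFrame.differentiableAt_of_contDiffOn (hz.contDiffOn_comp_symm hg)
    (⟨z.map_source hq, by simpa [z.left_inv hq] using hqs⟩)
    (z.isOpen_inter_preimage_symm hs)

lemma LegendreImmersion.isLegendreOn (F : LegendreImmersion M) (hz : IsSmoothChart z) :
    IsLegendreOn z.target (F.f ∘ z.symm) (F.n ∘ z.symm) where
  isOpen := z.open_target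
  smooth_f := by simpa using hz.contDiffOn_comp_symm F.smooth_f.contMDiffOn (s := univ)
  smooth_n := by simpa using hz.contDiffOn_comp_symm F.smooth_n.contMDiffOn (s := univ)
  norm_n := fun x _ => F.norm_n _
  contact := fun x hx w => by
    have hq := z.map_target hx
    obtain ⟨v, rfl⟩ := hz.surjective_dAt hq w
    have hd := hz.differentiableAt_comp_symm isOpen_univ F.smooth_f.contMDiffOn hq (mem_univ _)
    have h := F.contact (z.symm x) v
    rw [hz.dAt_eq hq hd, z.right_inv hx] at h
    exact h
  immersive := fun x hx w hw => by
    have hq := z.map_target hx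
    obtain ⟨v, rfl⟩ := hz.surjective_dAt hq w
    have hd := hz.differentiableAt_comp_symm isOpen_univ F.smooth_n.contMDiffOn hq (mem_univ _)
    have h := F.pos_third (z.symm x) v
    rw [hz.dAt_eq hq hd, z.right_inv hx, hw, inner_zero_left] at h
    by_contra hne
    exact lt_irrefl _ (h fun h0 => hne (by rw [h0, map_zero]))

namespace MiddleFrame

/-- The expression of a middle frame field in a smooth coordinate. -/
def coord (A : MiddleFrame F) (hz : IsSmoothChart z) :
    CoordFrame (z.target ∩ z.symm ⁻¹' A.dom) :=
  have hder : ∀ x ∈ z.target ∩ z.symm ⁻¹' A.dom, ∀ w, ∃ v : TangentSpace (𝓡 2) (z.symm x),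
      dAt z (z.symm x) v = w ∧ dAt A.a₀ (z.symm x) v = fderiv ℝ (A.a₀ ∘ z.symm) x w ∧
      ∀ i, dAt (A.a i) (z.symm x) v = fderiv ℝ (A.a i ∘ z.symm) x w := by
    intro x hx w
    have hq := z.map_target hx.1
    obtain ⟨v, rfl⟩ := hz.surjective_dAt hq w
    refine ⟨v, rfl, ?_, fun i => ?_⟩
    · rw [hz.dAt_eq hq (hz.differentiableAt_comp_symm A.isOpen_dom A.smooth_a₀ hq hx.2),
        z.right_inv hx.1]
    · rw [hz.dAt_eq hq (hz.differentiableAt_comp_symm A.isOpen_dom (A.smooth_a i) hq hx.2),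
        z.right_inv hx.1]
  have hnf : ∀ x ∈ z.target ∩ z.symm ⁻¹' A.dom, ∀ w, ∃ θ η : ℝ,
      (frameMatrix fun i => A.a i (z.symm x))⁻¹.mulVec (fderiv ℝ (A.a₀ ∘ z.symm) x w)
        = ![0, θ, η, 0] ∧
      ∀ j, fderiv ℝ (A.a j ∘ z.symm) x w
        = ∑ k, connMatrix (A.p₁ (z.symm x)) (A.p₂ (z.symm x)) (A.p₃ (z.symm x)) (A.q₁ (z.symm x))
          (A.q₂ (z.symm x)) θ η k j • A.a k (z.symm x) := by
    intro x hx w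
    obtain ⟨v, -, h2, h3⟩ := hder x hx w
    obtain ⟨θ, η, h4, h5⟩ := A.normal_form (z.symm x) hx.2 v
    refine ⟨θ, η, by rw [← h4, ← h2]; rfl, fun j => ?_⟩
    rw [← h3]
    exact ((A.isLaguerreBasis _ hx.2).inv_mul_eq_iff _ _).1 h5 j
  { a₀ := A.a₀ ∘ z.symm
    a := fun i => A.a i ∘ z.symm
    θ := fun x w =>
      (frameMatrix fun i => A.a i (z.symm x))⁻¹.mulVec (fderiv ℝ (A.a₀ ∘ z.symm) x w) 1
    η := fun x w =>
      (frameMatrix fun i => A.a i (z.symm x))⁻¹.mulVec (fderiv ℝ (A.a₀ ∘ z.symm) x w) 2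
    p₁ := A.p₁ ∘ z.symm
    p₂ := A.p₂ ∘ z.symm
    p₃ := A.p₃ ∘ z.symm
    q₁ := A.q₁ ∘ z.symm
    q₂ := A.q₂ ∘ z.symm
    isOpen := z.isOpen_inter_preimage_symm A.isOpen_dom
    smooth_a₀ := hz.contDiffOn_comp_symm A.smooth_a₀
    smooth_a := fun i => hz.contDiffOn_comp_symm (A.smooth_a i)
    smooth_p₁ := hz.contDiffOn_comp_symm A.smooth_p₁
    smooth_p₂ := hz.contDiffOn_comp_symm A.smooth_p₂
    smooth_p₃ := hz.contDiffOn_comp_symm A.smooth_p₃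
    smooth_q₁ := hz.contDiffOn_comp_symm A.smooth_q₁
    smooth_q₂ := hz.contDiffOn_comp_symm A.smooth_q₂
    basis := fun x hx => A.isLaguerreBasis _ hx.2
    d_a₀ := fun x hx w => by
      obtain ⟨θ, η, h1, -⟩ := hnf x hx w
      simp only [h1]
      rw [((A.isLaguerreBasis _ hx.2).inv_mulVec_eq_iff _ _).1 h1]
      simp [Fin.sum_univ_four]
    d_a := fun x hx w j => by
      obtain ⟨θ, η, h1, h2⟩ := hnf x hx w
      simp only [h1]
      exact h2 j
    injective := fun x hx w hθ hη => by
      obtain ⟨θ, η, h1, h2⟩ := hnf x hx w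
      simp only [h1] at hθ hη
      simp at hθ hη
      have hL := F.isLegendreOn hz
      set l : E → ℝ := fun y => (A.a 0 (z.symm y) 0 + A.a 0 (z.symm y) 3) / √2
      have hopen := z.isOpen_inter_preimage_symm A.isOpen_dom
      have hl : DifferentiableAt ℝ l x := by
        have hs := hz.contDiffOn_comp_symm (A.smooth_a 0)
        exact CoordFrame.differentiableAt_of_contDiffOn
          (((contDiffOn_pi.1 hs 0).add (contDiffOn_pi.1 hs 3)).div_const _) hx hopen
      have hev : ∀ᶠ y in nhds x, (A.a 0 ∘ z.symm) y = l y • spherePoint ((F.n ∘ z.symm) y) 1 := by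
        filter_upwards [hopen.mem_nhds hx] with y hy
        have h := (eq_of_line_eq (A.line_eq _ hy.2)).2
        rw [planeNormal_eq_spherePoint, smul_smul, mul_one_div] at h
        exact h
      have hd := hasFDerivAt_smul_spherePoint hev (hL.differentiableAt_n hx.1) hl w
      have hlx : l x ≠ 0 := (div_pos (A.isLaguerreBasis _ hx.2).sum_pos (by positivity)).ne'
      have h20 := h2 0
      rw [hd, hθ, hη] at h20
      have hb := A.isLaguerreBasis _ hx.2
      have := congrArg (fun y => lorentz y y) h20
      rw [hb.lorentz_sum] at this
      simp only [lorentz_add_left, lorentz_add_right, lorentz_smul_left, lorentz_smul_right,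
        lorentz_spherePoint, connMatrix, Matrix.of_apply, Matrix.cons_val,
        hL.inner_fderiv_n hx.1, real_inner_comm (fderiv ℝ (F.n ∘ z.symm) x w)] at this
      have nn : ⟪(F.n ∘ z.symm) x, (F.n ∘ z.symm) x⟫_ℝ = 1 := by
        rw [real_inner_self_eq_norm_sq, hL.norm_n x hx.1, one_pow]
      rw [nn] at this
      have h3 : l x * l x * ⟪fderiv ℝ (F.n ∘ z.symm) x w, fderiv ℝ (F.n ∘ z.symm) x w⟫_ℝ = 0 := by
        linear_combination this
      have h4 := (mul_eq_zero.1 h3).resolve_left (mul_self_ne_zero.2 hlx)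
      exact hL.immersive x hx.1 w (inner_self_eq_zero.1 h4) }

variable (A : MiddleFrame F) (hz : IsSmoothChart z)

lemma coord_along : (A.coord hz).Along (F.f ∘ z.symm) (F.n ∘ z.symm) :=
  fun _ hx => A.line_eq _ hx.2

lemma coord_trans {q : M} (hq : q ∈ z.source) (hqA : q ∈ A.dom) (v : TangentSpace (𝓡 2) q) :
    A.trans q v 1 = (A.coord hz).θ (z q) (dAt z q v) ∧
    A.trans q v 2 = (A.coord hz).η (z q) (dAt z q v) := by
  have h := hz.dAt_eq hq (hz.differentiableAt_comp_symm A.isOpen_dom A.smooth_a₀ hq hqA) v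
  have e : A.trans q v = (frameMatrix fun i => A.a i (z.symm (z q)))⁻¹.mulVec
      (fderiv ℝ (A.a₀ ∘ z.symm) (z q) (dAt z q v)) := by
    rw [← h, z.left_inv hq]
    rfl
  exact ⟨congrFun e 1, congrFun e 2⟩

lemma coord_φ {q : M} (hq : q ∈ z.source) (hqA : q ∈ A.dom) (v : TangentSpace (𝓡 2) q) :
    A.φ q v = (A.coord hz).φ (z q) (dAt z q v) := by
  obtain ⟨h1, h2⟩ := A.coord_trans hz hq hqA v
  rw [φ, CoordFrame.φ, h1, h2]

lemma coord_Q {q : M} (hq : q ∈ z.source) : (A.coord hz).Q (z q) = A.Q q := by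
  simp [coord, CoordFrame.Q, Q, z.left_inv hq]

lemma coord_P {q : M} (hq : q ∈ z.source) : (A.coord hz).P (z q) = A.p₁ q + A.p₃ q := by
  simp [coord, CoordFrame.P, z.left_inv hq]

end MiddleFrame

namespace CoordFrame

/-- Restriction of a frame field to a smaller open set. -/
def restrict {D D' : Set E} (A : CoordFrame D) (hD' : IsOpen D') (h : D' ⊆ D) : CoordFrame D' :=
  { A with
    isOpen := hD'
    smooth_a₀ := A.smooth_a₀.mono h
    smooth_a := fun i => (A.smooth_a i).mono h
    smooth_p₁ := A.smooth_p₁.mono h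
    smooth_p₂ := A.smooth_p₂.mono h
    smooth_p₃ := A.smooth_p₃.mono h
    smooth_q₁ := A.smooth_q₁.mono h
    smooth_q₂ := A.smooth_q₂.mono h
    basis := fun x hx => A.basis x (h hx)
    d_a₀ := fun x hx => A.d_a₀ x (h hx)
    d_a := fun x hx => A.d_a x (h hx)
    injective := fun x hx => A.injective x (h hx) }

lemma fderiv_a₀_comp (hz : IsSmoothChart z) {D : Set E} (B : CoordFrame D) {q : M}
    (hq : q ∈ z.source) (hqD : z q ∈ D) (v : TangentSpace (𝓡 2) q) :
    dAt (B.a₀ ∘ z) q v = ∑ k, ![0, B.θ (z q) (dAt z q v), B.η (z q) (dAt z q v), 0] k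
      • B.a k (z q) := by
  rw [hz.dAt_comp hq ((B.contDiffAt_a₀ hqD).differentiableAt (by simp)), B.d_a₀ _ hqD]
  simp [Fin.sum_univ_four]

/-- The middle frame field on the surface defined by a frame field in a smooth coordinate. -/
def toMiddleFrame (hz : IsSmoothChart z) {D : Set E} (B : CoordFrame D)
    (hB : B.Along (F.f ∘ z.symm) (F.n ∘ z.symm)) : MiddleFrame F where
  dom := z.source ∩ z ⁻¹' D
  isOpen_dom := z.isOpen_inter_preimage B.isOpen
  a₀ := B.a₀ ∘ z
  a := fun i => B.a i ∘ z
  smooth_a₀ := hz.contMDiffOn_comp B.smooth_a₀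
  smooth_a := fun i => hz.contMDiffOn_comp (B.smooth_a i)
  isLaguerreBasis := fun p hp => B.basis _ hp.2
  line_eq := fun p hp => by
    have := hB _ hp.2
    simp only [Function.comp, z.left_inv hp.1] at this
    exact this
  p₁ := B.p₁ ∘ z
  p₂ := B.p₂ ∘ z
  p₃ := B.p₃ ∘ z
  q₁ := B.q₁ ∘ z
  q₂ := B.q₂ ∘ z
  smooth_p₁ := hz.contMDiffOn_comp B.smooth_p₁
  smooth_p₂ := hz.contMDiffOn_comp B.smooth_p₂
  smooth_p₃ := hz.contMDiffOn_comp B.smooth_p₃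
  smooth_q₁ := hz.contMDiffOn_comp B.smooth_q₁
  smooth_q₂ := hz.contMDiffOn_comp B.smooth_q₂
  normal_form := fun p hp v => by
    refine ⟨B.θ (z p) (dAt z p v), B.η (z p) (dAt z p v), ?_, ?_⟩
    · exact ((B.basis _ hp.2).inv_mulVec_eq_iff _ _).2 (B.fderiv_a₀_comp hz hp.1 hp.2 v)
    · refine ((B.basis _ hp.2).inv_mul_eq_iff _ _).2 fun j => ?_
      change dAt (B.a j ∘ z) p v = _
      rw [hz.dAt_comp hp.1 ((B.contDiffAt_a hp.2 j).differentiableAt (by simp)), B.d_a _ hp.2]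
      rfl

end CoordFrame

lemma finrank_E2 : Module.finrank ℝ E2 = 2 := by simp

namespace MiddleFrame

variable [IsManifold (𝓡 2) ∞ M]

/-- Two middle frame fields along `F` agree up to a common sign of `a₂` and `a₃`. -/
theorem unique (A B : MiddleFrame F) {p : M} (hA : p ∈ A.dom) (hB : p ∈ B.dom) :
    ∃ ε : ℝ, ε ^ 2 = 1 ∧ (∀ v : TangentSpace (𝓡 2) p, B.trans p v 1 = ε * A.trans p v 1 ∧
      B.trans p v 2 = ε * A.trans p v 2) ∧
      B.p₁ p = A.p₁ p ∧ B.p₂ p = A.p₂ p ∧ B.p₃ p = A.p₃ p := by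
  have hz := isSmoothChart_chartAt p
  set z := chartAt E2 p
  have hp : p ∈ z.source := mem_chart_source E2 p
  set D := z.target ∩ z.symm ⁻¹' (A.dom ∩ B.dom) with hD
  have hDo : IsOpen D := z.isOpen_inter_preimage_symm (A.isOpen_dom.inter B.isOpen_dom)
  have hDA : D ⊆ z.target ∩ z.symm ⁻¹' A.dom := fun x hx => ⟨hx.1, hx.2.1⟩
  have hDB : D ⊆ z.target ∩ z.symm ⁻¹' B.dom := fun x hx => ⟨hx.1, hx.2.2⟩
  have hx : z p ∈ D := ⟨z.map_source hp, by simp [z.left_inv hp, hA, hB]⟩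
  obtain ⟨ε, h1, h2, h3, h4, h5⟩ := CoordFrame.unique finrank_E2
    (A := (A.coord hz).restrict hDo hDA) (B := (B.coord hz).restrict hDo hDB)
    (fun y hy => A.coord_along hz y (hDA hy)) (fun y hy => B.coord_along hz y (hDB hy))
    ((F.isLegendreOn hz).mono hDo inter_subset_left) hx
  refine ⟨ε, h1, fun v => ?_, ?_, ?_, ?_⟩
  · rw [(A.coord_trans hz hp hA v).1, (A.coord_trans hz hp hA v).2,
      (B.coord_trans hz hp hB v).1, (B.coord_trans hz hp hB v).2]
    exact h2 _
  · simpa [CoordFrame.restrict, coord, z.left_inv hp] using h3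
  · simpa [CoordFrame.restrict, coord, z.left_inv hp] using h4
  · simpa [CoordFrame.restrict, coord, z.left_inv hp] using h5

lemma unique_φ (A B : MiddleFrame F) {p : M} (hA : p ∈ A.dom) (hB : p ∈ B.dom) :
    ∃ ε : ℝ, ε ^ 2 = 1 ∧ (∀ v : TangentSpace (𝓡 2) p, B.φ p v = ε * A.φ p v) ∧
      B.Q p = A.Q p ∧ B.P p = A.P p := by
  obtain ⟨ε, h1, h2, h3, h4, h5⟩ := A.unique B hA hB
  refine ⟨ε, h1, fun v => ?_, ?_, ?_⟩
  · apply Complex.ext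
    · simpa [φ] using (h2 v).1
    · simpa [φ] using (h2 v).2
  · simp [Q, h3, h4, h5]
  · simp [P, h3, h5]

lemma quarticDifferential_eq (A : MiddleFrame F) {p : M} (hA : p ∈ A.dom)
    (v : TangentSpace (𝓡 2) p) : F.quarticDifferential p v = A.Q p * A.φ p v ^ 4 := by
  have h : ∃ A : MiddleFrame F, p ∈ A.dom := ⟨A, hA⟩
  rw [LegendreImmersion.quarticDifferential, dif_pos h]
  obtain ⟨ε, h1, h2, h3, -⟩ := A.unique_φ h.choose hA h.choose_spec
  have h4 : (ε : ℂ) ^ 4 = 1 := by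
    have : ε ^ 4 = 1 := by rw [show 4 = 2 * 2 by rfl, pow_mul, h1, one_pow]
    exact_mod_cast this
  rw [h2, h3, mul_pow, h4, one_mul]

lemma quadraticDifferential_eq (A : MiddleFrame F) {p : M} (hA : p ∈ A.dom)
    (v : TangentSpace (𝓡 2) p) : F.quadraticDifferential p v = A.P p * A.φ p v ^ 2 := by
  have h : ∃ A : MiddleFrame F, p ∈ A.dom := ⟨A, hA⟩
  rw [LegendreImmersion.quadraticDifferential, dif_pos h]
  obtain ⟨ε, h1, h2, -, h3⟩ := A.unique_φ h.choose hA h.choose_spec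
  have h4 : (ε : ℂ) ^ 2 = 1 := by exact_mod_cast h1
  rw [h2, h3, mul_pow, h4, one_mul]

end MiddleFrame

end Transfer

/-! ### Holomorphic quartic differentials -/

section Holomorphic

variable {M : Type*} [TopologicalSpace M] [ChartedSpace E2 M]
variable {F : LegendreImmersion M}

lemma MiddleFrame.dAt_a₀ (A : MiddleFrame F) {q : M} (hq : q ∈ A.dom) (v : TangentSpace (𝓡 2) q) :
    lorentz (dAt A.a₀ q v) (dAt A.a₀ q v) = A.trans q v 1 ^ 2 + A.trans q v 2 ^ 2 ∧
    lorentz (dAt A.a₀ q v) (dAt (A.a 0) q v) = A.trans q v 1 ^ 2 - A.trans q v 2 ^ 2 := by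
  obtain ⟨θ, η, h1, h2⟩ := A.normal_form q hq v
  have hb := A.isLaguerreBasis q hq
  have e1 := (hb.inv_mulVec_eq_iff _ _).1 h1
  have e2 := (hb.inv_mul_eq_iff _ _).1 h2 0
  rw [h1]
  simp only [Matrix.cons_val]
  constructor
  · rw [e1, hb.lorentz_sum]
    simp only [Matrix.cons_val]
    ring
  · rw [e1, e2, hb.lorentz_sum]
    simp only [Matrix.of_apply, Matrix.cons_val]
    ring

open Classical in
/-- The invariant `P = p₁ + p₃` as a function on the surface (zero at points without a middle frame
around them). -/
def LegendreImmersion.meanInvariant (F : LegendreImmersion M) (p : M) : ℝ :=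
  if h : ∃ A : MiddleFrame F, p ∈ A.dom then h.choose.p₁ p + h.choose.p₃ p else 0

open Classical in
/-- The invariant `p₁ - p₃` as a function on the surface (zero at points without a middle frame
around them). -/
def LegendreImmersion.differenceInvariant (F : LegendreImmersion M) (p : M) : ℝ :=
  if h : ∃ A : MiddleFrame F, p ∈ A.dom then h.choose.p₁ p - h.choose.p₃ p else 0

/-- `P φ²` is holomorphic: around each point there are a complex valued coordinate and a middle
frame in which `dP = -2 P (q₂ θ - q₁ η)`. -/
def LegendreImmersion.HasPOde (F : LegendreImmersion M) : Prop :=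
  ∀ p : M, ∃ (z : OpenPartialHomeomorph M ℂ) (hz : IsSmoothChart z) (A : MiddleFrame F),
    p ∈ z.source ∧ z.source ⊆ A.dom ∧
      ∀ x ∈ z.target ∩ z.symm ⁻¹' A.dom, (A.coord hz).POdeAt x

variable [IsManifold (𝓡 2) ∞ M]

namespace MiddleFrame

lemma meanInvariant_eq (A : MiddleFrame F) {p : M} (hA : p ∈ A.dom) :
    F.meanInvariant p = A.p₁ p + A.p₃ p := by
  have h : ∃ A : MiddleFrame F, p ∈ A.dom := ⟨A, hA⟩
  rw [LegendreImmersion.meanInvariant, dif_pos h]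
  obtain ⟨ε, -, -, h1, -, h3⟩ := A.unique h.choose hA h.choose_spec
  rw [h1, h3]

lemma differenceInvariant_eq (A : MiddleFrame F) {p : M} (hA : p ∈ A.dom) :
    F.differenceInvariant p = A.p₁ p - A.p₃ p := by
  have h : ∃ A : MiddleFrame F, p ∈ A.dom := ⟨A, hA⟩
  rw [LegendreImmersion.differenceInvariant, dif_pos h]
  obtain ⟨ε, -, -, h1, -, h3⟩ := A.unique h.choose hA h.choose_spec
  rw [h1, h3]

/-- It suffices to test a complex coordinate on one middle frame field. -/
lemma isHolomorphicCoordinate (A : MiddleFrame F) {z : OpenPartialHomeomorph M ℂ}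
    (hz : IsSmoothCoordinate z) (hA : z.source ⊆ A.dom)
    (h : ∀ q ∈ z.source, ∃ μ : ℂ, μ ≠ 0 ∧ ∀ v : TangentSpace (𝓡 2) q,
      A.φ q v = μ * dAt z q v) : F.IsHolomorphicCoordinate z := by
  refine ⟨hz, fun B q hq => ?_⟩
  obtain ⟨μ, hμ, h1⟩ := h q hq.2
  obtain ⟨ε, hε, h2, -, -⟩ := A.unique_φ B (hA hq.2) hq.1
  refine ⟨ε * μ, mul_ne_zero ?_ hμ, fun v => by rw [h2, h1, mul_assoc]⟩
  intro h0
  have : ε = 0 := by exact_mod_cast h0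
  rw [this] at hε
  norm_num at hε

omit [IsManifold (𝓡 2) ∞ M] in
/-- In a complex coordinate the form `φ` is a multiple of `dz`. -/
lemma coord_φ_eq (A : MiddleFrame F) {z : OpenPartialHomeomorph M ℂ} (hz : IsSmoothChart z)
    (h : ∀ q ∈ z.source ∩ A.dom, ∃ μ : ℂ, ∀ v : TangentSpace (𝓡 2) q, A.φ q v = μ * dAt z q v)
    {x : ℂ} (hx : x ∈ z.target ∩ z.symm ⁻¹' A.dom) (w : ℂ) :
    (A.coord hz).φ x w = (A.coord hz).φ x 1 * w := by
  have hq := z.map_target hx.1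
  obtain ⟨μ, hμ⟩ := h (z.symm x) ⟨hq, hx.2⟩
  have key : ∀ w, (A.coord hz).φ x w = μ * w := by
    intro w
    obtain ⟨v, rfl⟩ := hz.surjective_dAt hq w
    rw [← hμ v, A.coord_φ hz hq hx.2, z.right_inv hx.1]
  rw [key, key 1, mul_one]

end MiddleFrame

/-- If `Q φ⁴` is holomorphic, so is `P φ²`. -/
lemma hasPOde_of_holomorphic (hex : ∀ p : M, ∃ A : MiddleFrame F, p ∈ A.dom)
    (h : F.IsHolomorphicDifferential 4 F.quarticDifferential) : F.HasPOde := by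
  intro p
  obtain ⟨A, hA⟩ := hex p
  obtain ⟨z, hz, hp, g, hg, hT⟩ := h p
  have hzs : IsSmoothChart z := hz.1
  refine ⟨z.restrOpen A.dom A.isOpen_dom, hzs.restr A.isOpen_dom, A, ⟨hp, hA⟩, fun q hq => hq.2,
    fun x hx => ?_⟩
  set z' := z.restrOpen A.dom A.isOpen_dom with hz'
  have hsrc : ∀ q ∈ z'.source, q ∈ z.source := fun q hq => hq.1
  have hq := z'.map_target hx.1
  set C := A.coord (hzs.restr A.isOpen_dom) with hC
  have hφ := fun y hy => A.coord_φ_eq (hzs.restr A.isOpen_dom) (fun q hq => by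
    obtain ⟨μ, -, h2⟩ := hz.2 A q ⟨hq.2, hq.1.1⟩
    exact ⟨μ, h2⟩) (x := y) hy
  rw [← C.differentiableAt_coefficient_iff hφ hx]
  have hev : (fun y => C.Q y * C.φ y 1 ^ 4) =ᶠ[nhds x] g := by
    filter_upwards [C.isOpen.mem_nhds hx] with y hy
    have hqy := z'.map_target hy.1
    obtain ⟨v, hv⟩ := hzs.surjective_dAt (hsrc _ hqy) 1
    have h1 := hT _ (hsrc _ hqy) v
    rw [A.quarticDifferential_eq hy.2] at h1
    have h2 := A.coord_Q (hzs.restr A.isOpen_dom) hqy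
    have h3 := A.coord_φ (hzs.restr A.isOpen_dom) hqy hy.2 v
    have h4 : dAt z' (z'.symm y) v = 1 := hv
    have h5 : z (z'.symm y) = y := z'.right_inv hy.1
    rw [h4, z'.right_inv hy.1] at h3
    rw [z'.right_inv hy.1] at h2
    rw [hv, h5, one_pow, mul_one] at h1
    rw [← h1, hC, h2, h3]
  have hxz : x ∈ z.target := by
    have h5 : z (z'.symm x) = x := z'.right_inv hx.1
    rw [← h5]
    exact z.map_source (hsrc _ hq)
  exact (hg.differentiableAt (z.open_target.mem_nhds hxz)).congr_of_eventuallyEq hev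

/-- `Q φ⁴` is holomorphic if around each point there is a coordinate for which `φ` is of type
`(1, 0)` and the equation for `P` holds: its coefficient is then a holomorphic function. -/
lemma holomorphic_of_coordinate
    (h : ∀ p : M, ∃ (z : OpenPartialHomeomorph M ℂ) (hz : IsSmoothChart z) (A : MiddleFrame F),
      p ∈ z.source ∧ z.source ⊆ A.dom ∧
      (∀ q ∈ z.source, ∃ μ : ℂ, μ ≠ 0 ∧ ∀ v : TangentSpace (𝓡 2) q, A.φ q v = μ * dAt z q v) ∧
      ∀ x ∈ z.target ∩ z.symm ⁻¹' A.dom, (A.coord hz).POdeAt x) :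
    F.IsHolomorphicDifferential 4 F.quarticDifferential := by
  intro p
  obtain ⟨z, hz, A, hp, hA, hμ, hode⟩ := h p
  refine ⟨z, A.isHolomorphicCoordinate hz hA hμ, hp,
    fun y => (A.coord hz).Q y * (A.coord hz).φ y 1 ^ 4, fun x hx => ?_, fun q hq v => ?_⟩
  · have hxD : x ∈ z.target ∩ z.symm ⁻¹' A.dom := ⟨hx, hA (z.map_target hx)⟩
    refine DifferentiableAt.differentiableWithinAt ?_
    refine ((A.coord hz).differentiableAt_coefficient_iff (fun y hy => ?_) hxD).2 (hode x hxD)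
    exact A.coord_φ_eq hz (fun q hq => by
      obtain ⟨μ, -, h2⟩ := hμ q hq.1
      exact ⟨μ, h2⟩) hy
  · have hxD : z q ∈ z.target ∩ z.symm ⁻¹' A.dom :=
      ⟨z.map_source hq, by simpa [z.left_inv hq] using hA hq⟩
    have h1 := A.coord_φ_eq hz (fun q hq => by
      obtain ⟨μ, -, h2⟩ := hμ q hq.1
      exact ⟨μ, h2⟩) hxD (dAt z q v)
    rw [A.quarticDifferential_eq (hA hq), A.coord_φ hz hq (hA hq), h1]
    simp only [A.coord_Q hz hq]
    ring

/-- If `P` vanishes, the components of the middle sphere `a₀` are harmonic: with `X` one of them and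
`dX = X_θ θ + X_η η`, the form `(X_θ - i X_η) φ` is closed. Where it does not vanish it is the
differential of a complex coordinate, and in this coordinate `Q φ⁴` is holomorphic. -/
theorem holomorphic_of_mean_zero (hex : ∀ p : M, ∃ A : MiddleFrame F, p ∈ A.dom)
    (hP : ∀ p, F.meanInvariant p = 0) : F.IsHolomorphicDifferential 4 F.quarticDifferential := by
  refine holomorphic_of_coordinate fun p => ?_
  obtain ⟨A, hA⟩ := hex p
  have hz := isSmoothChart_chartAt p
  set z := chartAt E2 p
  have hp : p ∈ z.source := mem_chart_source E2 p
  set C := A.coord hz with hC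
  have hx : z p ∈ z.target ∩ z.symm ⁻¹' A.dom :=
    ⟨z.map_source hp, by simpa [z.left_inv hp] using hA⟩
  have hPC : ∀ y ∈ z.target ∩ z.symm ⁻¹' A.dom, C.P y = 0 := by
    intro y hy
    have := A.coord_P hz (z.map_target hy.1)
    rw [z.right_inv hy.1] at this
    rw [hC, this, ← A.meanInvariant_eq hy.2, hP]
  obtain ⟨k, hk⟩ : ∃ k, C.a 1 (z p) k ≠ 0 := by
    by_contra! h
    have h0 : C.a 1 (z p) = 0 := funext h
    obtain ⟨-, -, -, -, h11, -⟩ := (C.basis _ hx).products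
    rw [h0, lorentz_zero_left] at h11
    norm_num at h11
  have ha : ∀ i, ContDiffOn ℝ ∞ (fun y => C.a i y k) (z.target ∩ z.symm ⁻¹' A.dom) := fun i =>
    contDiffOn_pi.1 (C.smooth_a i) k
  have hcs : ContDiffOn ℝ ∞ (fun y => (C.a 1 y k : ℂ) - (C.a 2 y k : ℂ) * Complex.I)
      (z.target ∩ z.symm ⁻¹' A.dom) :=
    (Complex.ofRealCLM.contDiff.comp_contDiffOn (ha 1)).sub
      ((Complex.ofRealCLM.contDiff.comp_contDiffOn (ha 2)).mul contDiffOn_const)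
  obtain ⟨Ψ, hΨ1, hΨ2, hΨ3, hΨ4, hΨ5⟩ := C.exists_coordinate_of_closed finrank_E2 hcs
    (fun x hx u v => by
      have da : ∀ i, DifferentiableAt ℝ (C.a i) x := fun i =>
        (C.contDiffAt_a hx i).differentiableAt (by simp)
      have dak : ∀ i, DifferentiableAt ℝ (fun y => C.a i y k) x := fun i =>
        differentiableAt_pi.1 (da i) k
      have e : ∀ w, fderiv ℝ (fun y => (C.a 1 y k : ℂ) - (C.a 2 y k : ℂ) * Complex.I) x w
          = (fderiv ℝ (C.a 1) x w k : ℂ) - (fderiv ℝ (C.a 2) x w k : ℂ) * Complex.I := by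
        intro w
        have h1 : ∀ i, fderiv ℝ (fun y => C.a i y k) x w = fderiv ℝ (C.a i) x w k := by
          intro i
          rw [fderiv_apply (da i) k]
          rfl
        have := ((Complex.ofRealCLM.hasFDerivAt.comp x (dak 1).hasFDerivAt).sub
          ((Complex.ofRealCLM.hasFDerivAt.comp x (dak 2).hasFDerivAt).mul_const
            Complex.I)).fderiv
        change fderiv ℝ (fun y => (C.a 1 y k : ℂ) - (C.a 2 y k : ℂ) * Complex.I) x = _ at this
        rw [this, ← h1, ← h1]
        simp
        ring
      have hφ : ∀ w, C.φ x w = (C.θ x w : ℂ) + (C.η x w : ℂ) * Complex.I := by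
        intro w
        apply Complex.ext <;> simp [CoordFrame.φ]
      have hq : (⟨C.q₁ x, C.q₂ x⟩ : ℂ) = C.q₁ x + C.q₂ x * Complex.I := by
        apply Complex.ext <;> simp
      have hP0 : (C.p₁ x : ℂ) + C.p₃ x = 0 := by exact_mod_cast hPC x hx
      rw [e, e, C.d_a x hx, C.d_a x hx, C.d_a x hx, C.d_a x hx, hφ, hφ, hq, CoordFrame.area]
      simp only [Fin.sum_univ_four, connMatrix, Matrix.of_apply, Matrix.cons_val, Pi.add_apply,
        Pi.smul_apply, smul_eq_mul]
      push_cast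
      linear_combination (C.a 0 x k : ℂ) * Complex.I * (C.θ x u * C.η x v - C.θ x v * C.η x u) * hP0
        + ((C.q₁ x * C.a 1 x k - C.p₂ x * C.a 0 x k - C.q₂ x * C.a 2 x k) *
          (C.θ x u * C.η x v - C.θ x v * C.η x u) : ℂ) * Complex.I_sq) hx
    (fun h0 => hk (by simpa using congrArg Complex.re h0))
  have hsub : (z.trans Ψ).source ⊆ A.dom := by
    intro q hq
    rw [OpenPartialHomeomorph.trans_source] at hq
    have := (hΨ2 hq.2).2
    simpa [z.left_inv hq.1] using this
  refine ⟨z.trans Ψ, hz.trans hΨ3 hΨ4, A, ?_, hsub, fun q hq => ?_, fun x hx => ?_⟩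
  · rw [OpenPartialHomeomorph.trans_source]
    exact ⟨hp, hΨ1⟩
  · have hqA := hsub hq
    rw [OpenPartialHomeomorph.trans_source] at hq
    obtain ⟨h1, h2⟩ := hΨ5 _ hq.2
    refine ⟨_, inv_ne_zero h1, fun v => ?_⟩
    have hd : DifferentiableAt ℝ Ψ (z q) :=
      (hΨ3.contDiffAt (Ψ.open_source.mem_nhds hq.2)).differentiableAt (by simp)
    have h3 : dAt (z.trans Ψ) q v = fderiv ℝ Ψ (z q) (dAt z q v) := hz.dAt_comp hq.1 hd v
    rw [h3, h2, A.coord_φ hz hq.1 hqA, inv_mul_cancel_left₀ h1]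
  · refine CoordFrame.pOdeAt_of_eventually_zero _ ?_
    filter_upwards [((A.coord (hz.trans hΨ3 hΨ4)).isOpen.mem_nhds hx)] with y hy
    have := A.coord_P (hz.trans hΨ3 hΨ4) ((z.trans Ψ).map_target hy.1)
    rw [(z.trans Ψ).right_inv hy.1] at this
    rw [this, ← A.meanInvariant_eq hy.2, hP]

/-- In isothermic coordinates `Q φ⁴` is `-½ e^{2u} Δu dz⁴`, which is holomorphic if
`Δu = c e^{-2u}`. -/
theorem holomorphic_of_special_equation
    (h : ∀ p : M, ∃ z : OpenPartialHomeomorph M ℂ, p ∈ z.source ∧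
      ∃ u : M → ℝ, ContMDiffOn (𝓡 2) 𝓘(ℝ, ℝ) ∞ u z.source ∧
        F.IsIsothermicCoordinate z (fun q => Real.exp (u q)) ∧
          ∃ c : ℝ, SatisfiesSpecialEquation z u c) :
    F.IsHolomorphicDifferential 4 F.quarticDifferential := by
  intro p
  obtain ⟨z, hp, u, hu, ⟨hz, A, hA, hco⟩, c, hc⟩ := h p
  have hzs : IsSmoothChart z := hz
  have hφ : ∀ q ∈ z.source, ∀ v : TangentSpace (𝓡 2) q,
      A.φ q v = (Real.exp (u q) : ℂ) * dAt z q v := by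
    intro q hq v
    obtain ⟨h1, h2⟩ := hco q hq v
    apply Complex.ext
    · simpa [MiddleFrame.φ, Complex.mul_re, -Complex.ofReal_exp] using h1
    · simpa [MiddleFrame.φ, Complex.mul_im, -Complex.ofReal_exp] using h2
  refine ⟨z, A.isHolomorphicCoordinate hz hA fun q hq => ⟨_, ?_, hφ q hq⟩, hp,
    fun _ => ((-c / 2 : ℝ) : ℂ), differentiableOn_const _, fun q hq v => ?_⟩
  · exact_mod_cast (Real.exp_pos _).ne'
  rw [A.quarticDifferential_eq (hA hq), hφ q hq]
  have hsub : z.target ⊆ z.target ∩ z.symm ⁻¹' A.dom := fun x hx => ⟨hx, hA (z.map_target hx)⟩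
  set C := (A.coord hzs).restrict z.open_target hsub
  have hus : ContDiffOn ℝ ∞ (u ∘ z.symm) z.target :=
    (hzs.contDiffOn_comp_symm hu).mono fun x hx => ⟨hx, z.map_target hx⟩
  have hC : ∀ x ∈ z.target, ∀ w : ℂ, C.θ x w = Real.exp ((u ∘ z.symm) x) * w.re ∧
      C.η x w = Real.exp ((u ∘ z.symm) x) * w.im := by
    intro x hx w
    have hq := z.map_target hx
    obtain ⟨v, rfl⟩ := hzs.surjective_dAt hq w
    have h1 := A.coord_trans hzs hq (hA hq) v
    have h2 := hco _ hq v
    rw [z.right_inv hx] at h1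
    exact ⟨h1.1.symm.trans h2.1, h1.2.symm.trans h2.2⟩
  obtain ⟨l1, l2⟩ := C.laplacian_isothermic hus (fun x hx w => (hC x hx w).1)
    (fun x hx w => (hC x hx w).2) (z.map_source hq)
  have l3 := hc q hq
  have e2 : C.p₂ (z q) = A.p₂ q := congrArg A.p₂ (z.left_inv hq)
  have e1 : C.p₁ (z q) = A.p₁ q := congrArg A.p₁ (z.left_inv hq)
  have e3 : C.p₃ (z q) = A.p₃ q := congrArg A.p₃ (z.left_inv hq)
  rw [l3, e1, e3] at l2
  rw [e2] at l1
  have hu' : (u ∘ z.symm) (z q) = u q := congrArg u (z.left_inv hq)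
  rw [hu'] at l2
  have hexp : Real.exp (-2 * u q) * Real.exp (u q) ^ 2 = 1 := by
    rw [← Real.exp_nat_mul, ← Real.exp_add]
    norm_num
  have hQ : A.Q q * (Real.exp (u q) : ℂ) ^ 4 = ((-c / 2 : ℝ) : ℂ) := by
    have hQ' : A.Q q = (((A.p₁ q - A.p₃ q) / 2 : ℝ) : ℂ) := by
      apply Complex.ext <;> simp [MiddleFrame.Q, l1]
    rw [hQ', ← Complex.ofReal_pow, ← Complex.ofReal_mul]
    congr 1
    linear_combination (Real.exp (u q) ^ 2) / 2 * l2 - c / 2 * hexp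
  rw [mul_pow, ← mul_assoc, hQ]

/-- The function `P` vanishes identically or has no zeros. -/
theorem mean_zero_or_ne_zero [ConnectedSpace M] (h : F.HasPOde) :
    (∀ p, F.meanInvariant p = 0) ∨ ∀ p, F.meanInvariant p ≠ 0 := by
  have hcont : Continuous F.meanInvariant := by
    rw [continuous_iff_continuousAt]
    intro p
    obtain ⟨z, hz, A, hp, hA, -⟩ := h p
    have h1 : ContinuousAt (fun q => A.p₁ q + A.p₃ q) p :=
      (A.smooth_p₁.continuousOn.continuousAt (A.isOpen_dom.mem_nhds (hA hp))).add
        (A.smooth_p₃.continuousOn.continuousAt (A.isOpen_dom.mem_nhds (hA hp)))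
    refine h1.congr ?_
    filter_upwards [A.isOpen_dom.mem_nhds (hA hp)] with q hq using (A.meanInvariant_eq hq).symm
  have hclosed : IsClosed {p | F.meanInvariant p = 0} := isClosed_eq hcont continuous_const
  have hopen : IsOpen {p | F.meanInvariant p = 0} := by
    rw [isOpen_iff_mem_nhds]
    intro p hp0
    obtain ⟨z, hz, A, hp, hA, hode⟩ := h p
    have hx : z p ∈ z.target ∩ z.symm ⁻¹' A.dom :=
      ⟨z.map_source hp, by simpa [z.left_inv hp] using hA hp⟩
    have h0 : (A.coord hz).P (z p) = 0 := by
      rw [A.coord_P hz hp, ← A.meanInvariant_eq (hA hp)]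
      exact hp0
    have hev := (A.coord hz).eventually_P_eq_zero hode hx h0
    have hev' := (z.continuousAt hp).eventually hev
    filter_upwards [hev', z.open_source.mem_nhds hp] with q hq hqs
    rw [A.coord_P hz hqs, ← A.meanInvariant_eq (hA hqs)] at hq
    exact hq
  rcases isClopen_iff.1 ⟨hclosed, hopen⟩ with h0 | h0
  · right
    intro p hp
    have : p ∈ {p | F.meanInvariant p = 0} := hp
    rw [h0] at this
    exact this
  · left
    intro p
    have : p ∈ {p | F.meanInvariant p = 0} := by rw [h0]; trivial
    exact this

end Holomorphic

/-! ### The Blaschke potential -/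

section Blaschke

variable {M : Type*} [TopologicalSpace M] [ChartedSpace E2 M]
variable {F : LegendreImmersion M} [IsManifold (𝓡 2) ∞ M]

/-- The potential `u` with `e^{-2u} = |P|`. -/
def LegendreImmersion.potential (F : LegendreImmersion M) (p : M) : ℝ :=
  -(Real.log (F.meanInvariant p) / 2)

/-- If `P φ²` is holomorphic without zeros, then `|P|^{1/2} φ` is closed, and so it is the
differential of an isothermic coordinate. -/
theorem exists_isothermicCoordinate (h : F.HasPOde) (hP : ∀ p, F.meanInvariant p ≠ 0) (p : M) :
    ∃ z : OpenPartialHomeomorph M ℂ, p ∈ z.source ∧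
      F.IsIsothermicCoordinate z fun q => Real.exp (F.potential q) := by
  obtain ⟨z, hz, A, hp, hA, hode⟩ := h p
  set C := A.coord hz with hC
  have hx : z p ∈ z.target ∩ z.symm ⁻¹' A.dom :=
    ⟨z.map_source hp, by simpa [z.left_inv hp] using hA hp⟩
  have hPC : ∀ y ∈ z.target ∩ z.symm ⁻¹' A.dom, C.P y = F.meanInvariant (z.symm y) := by
    intro y hy
    have := A.coord_P hz (z.map_target hy.1)
    rw [z.right_inv hy.1] at this
    rw [hC, this, ← A.meanInvariant_eq hy.2]
  have hPne : ∀ y ∈ z.target ∩ z.symm ⁻¹' A.dom, C.P y ≠ 0 := fun y hy => by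
    rw [hPC y hy]; exact hP _
  have hgs : ContDiffOn ℝ ∞ (fun y => Real.exp (Real.log (C.P y) / 2))
      (z.target ∩ z.symm ⁻¹' A.dom) := ((C.smooth_P.log hPne).div_const 2).exp
  have hcs : ContDiffOn ℝ ∞ (fun y => ((Real.exp (Real.log (C.P y) / 2) : ℝ) : ℂ))
      (z.target ∩ z.symm ⁻¹' A.dom) := Complex.ofRealCLM.contDiff.comp_contDiffOn hgs
  have hne : ∀ y, ((Real.exp (Real.log (C.P y) / 2) : ℝ) : ℂ) ≠ 0 := fun y => by
    exact_mod_cast (Real.exp_pos _).ne'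
  obtain ⟨Ψ, hΨ1, hΨ2, hΨ3, hΨ4, hΨ5⟩ := C.exists_coordinate_of_closed
    Complex.finrank_real_complex hcs (fun x hx u v => by
      have dP := CoordFrame.differentiableAt_of_contDiffOn C.smooth_P hx C.isOpen
      have hd := ((dP.hasFDerivAt.log (hPne x hx)).mul_const (2⁻¹ : ℝ)).exp
      have e : ∀ w, fderiv ℝ (fun y => ((Real.exp (Real.log (C.P y) / 2) : ℝ) : ℂ)) x w
          = ((-Real.exp (Real.log (C.P x) / 2) *
              (C.q₂ x * C.θ x w - C.q₁ x * C.η x w) : ℝ) : ℂ) := by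
        intro w
        have h1 := (Complex.ofRealCLM.hasFDerivAt.comp x hd).fderiv
        have h2 : (fun y => ((Real.exp (Real.log (C.P y) / 2) : ℝ) : ℂ))
          = Complex.ofRealCLM ∘ fun y => Real.exp (Real.log (C.P y) * 2⁻¹) := by
          ext y
          simp [div_eq_mul_inv]
        rw [h2, h1]
        simp only [ContinuousLinearMap.comp_apply, smul_apply, smul_eq_mul, hode x hx w,
          Complex.ofRealCLM_apply]
        have := hPne x hx
        congr 1
        rw [← div_eq_mul_inv]
        field_simp
      have hφ : ∀ w, C.φ x w = (C.θ x w : ℂ) + (C.η x w : ℂ) * Complex.I := by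
        intro w
        apply Complex.ext <;> simp [CoordFrame.φ]
      have hq : (⟨C.q₁ x, C.q₂ x⟩ : ℂ) = C.q₁ x + C.q₂ x * Complex.I := by
        apply Complex.ext <;> simp
      rw [e, e, hφ, hφ, hq, CoordFrame.area]
      push_cast
      ring) hx (hne _)
  have hsub : (z.trans Ψ).source ⊆ A.dom := by
    intro q hq
    rw [OpenPartialHomeomorph.trans_source] at hq
    have := (hΨ2 hq.2).2
    simpa [z.left_inv hq.1] using this
  refine ⟨z.trans Ψ, ?_, hz.trans hΨ3 hΨ4, A, hsub, fun q hq v => ?_⟩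
  · rw [OpenPartialHomeomorph.trans_source]
    exact ⟨hp, hΨ1⟩
  · have hqA := hsub hq
    rw [OpenPartialHomeomorph.trans_source] at hq
    obtain ⟨h1, h2⟩ := hΨ5 _ hq.2
    have hd : DifferentiableAt ℝ Ψ (z q) :=
      (hΨ3.contDiffAt (Ψ.open_source.mem_nhds hq.2)).differentiableAt (by simp)
    have h3 : dAt (z.trans Ψ) q v = fderiv ℝ Ψ (z q) (dAt z q v) := hz.dAt_comp hq.1 hd v
    obtain ⟨t1, t2⟩ := A.coord_trans hz hq.1 hqA v
    have hPq : C.P (z q) = F.meanInvariant q := by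
      rw [hPC _ (hΨ2 hq.2), z.left_inv hq.1]
    have hexp : Real.exp (F.potential q) * Real.exp (Real.log (C.P (z q)) / 2) = 1 := by
      rw [← Real.exp_add, LegendreImmersion.potential, hPq]
      simp
    rw [h3, h2, t1, t2, Complex.re_ofReal_mul, Complex.im_ofReal_mul, ← mul_assoc, ← mul_assoc,
      hexp, one_mul, one_mul]
    exact ⟨rfl, rfl⟩

lemma smooth_potential (hex : ∀ p : M, ∃ A : MiddleFrame F, p ∈ A.dom)
    (hP : ∀ p, F.meanInvariant p ≠ 0) : ContMDiff (𝓡 2) 𝓘(ℝ, ℝ) ∞ F.potential := by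
  intro p
  obtain ⟨A, hA⟩ := hex p
  have hn := A.isOpen_dom.mem_nhds hA
  have h1 : ContMDiffAt (𝓡 2) 𝓘(ℝ, ℝ) ∞ (fun q => A.p₁ q + A.p₃ q) p :=
    (A.smooth_p₁.contMDiffAt hn).add (A.smooth_p₃.contMDiffAt hn)
  have h2 : ContDiffAt ℝ ∞ (fun t : ℝ => -(Real.log t / 2)) (A.p₁ p + A.p₃ p) := by
    have : A.p₁ p + A.p₃ p ≠ 0 := by rw [← A.meanInvariant_eq hA]; exact hP p
    exact ((contDiffAt_id.log this).div_const 2).neg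
  have h3 := h2.contMDiffAt.comp p h1
  refine h3.congr_of_eventuallyEq ?_
  filter_upwards [hn] with q hq
  simp [LegendreImmersion.potential, A.meanInvariant_eq hq]

/-- Isothermic coordinates diagonalize both fundamental forms. -/
lemma isLIsothermic_of_isothermicCoordinate {u : M → ℝ}
    (h : ∀ p : M, ∃ z : OpenPartialHomeomorph M ℂ, p ∈ z.source ∧
      F.IsIsothermicCoordinate z fun q => Real.exp (u q)) : F.IsLIsothermic := by
  intro p
  obtain ⟨z, hp, hz, A, hA, hco⟩ := h p
  refine ⟨z, hz, hp, fun B q hq => ⟨Real.exp (u q) ^ 2, Real.exp (u q) ^ 2,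
    -Real.exp (u q) ^ 2, fun v => ?_⟩⟩
  obtain ⟨ε, hε, h1, -⟩ := A.unique B (hA hq.2) hq.1
  obtain ⟨h2, h3⟩ := B.dAt_a₀ hq.1 v
  obtain ⟨c1, c2⟩ := hco q hq.2 v
  rw [h2, h3, (h1 v).1, (h1 v).2, c1, c2]
  constructor
  · linear_combination (Real.exp (u q) ^ 2 * ((dAt z q v).re ^ 2 + (dAt z q v).im ^ 2)) * hε
  · linear_combination (Real.exp (u q) ^ 2 * ((dAt z q v).re ^ 2 - (dAt z q v).im ^ 2)) * hε

/-- If `P φ²` is holomorphic without zeros, then `(p₁ - p₃) / P²` is constant. -/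
lemma exists_constant [ConnectedSpace M] (h : F.HasPOde) (hP : ∀ p, F.meanInvariant p ≠ 0) :
    ∃ c, ∀ p, F.differenceInvariant p = c * F.meanInvariant p ^ 2 := by
  have hloc : IsLocallyConstant fun p => F.differenceInvariant p / F.meanInvariant p ^ 2 := by
    rw [IsLocallyConstant.iff_eventually_eq]
    intro p
    obtain ⟨z, hz, A, hp, hA, hode⟩ := h p
    set C := A.coord hz with hC
    have hx : z p ∈ z.target ∩ z.symm ⁻¹' A.dom :=
      ⟨z.map_source hp, by simpa [z.left_inv hp] using hA hp⟩
    have hPne : ∀ y ∈ z.target ∩ z.symm ⁻¹' A.dom, C.P y ≠ 0 := by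
      intro y hy
      have := A.coord_P hz (z.map_target hy.1)
      rw [z.right_inv hy.1] at this
      rw [hC, this, ← A.meanInvariant_eq hy.2]
      exact hP _
    have hd := fun y hy =>
      C.fderiv_quotient_eq_zero Complex.finrank_real_complex hode hPne (x := y) hy
    obtain ⟨r, hr, hball⟩ := Metric.isOpen_iff.1 C.isOpen (z p) hx
    have hconst : ∀ y ∈ Metric.ball (z p) r, (C.p₁ y - C.p₃ y) / C.P y ^ 2
        = (C.p₁ (z p) - C.p₃ (z p)) / C.P (z p) ^ 2 := by
      intro y hy
      refine (convex_ball (z p) r).is_const_of_fderivWithin_eq_zero (𝕜 := ℝ)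
        (fun t ht => (hd t (hball ht)).differentiableAt.differentiableWithinAt) (fun t ht => ?_)
        hy (Metric.mem_ball_self hr)
      exact (hd t (hball ht)).hasFDerivWithinAt.fderivWithin
        (Metric.isOpen_ball.uniqueDiffWithinAt ht)
    have e : ∀ q ∈ z.source, F.differenceInvariant q / F.meanInvariant q ^ 2
        = (C.p₁ (z q) - C.p₃ (z q)) / C.P (z q) ^ 2 := by
      intro q hq
      have e1 : C.p₁ (z q) = A.p₁ q := congrArg A.p₁ (z.left_inv hq)
      have e3 : C.p₃ (z q) = A.p₃ q := congrArg A.p₃ (z.left_inv hq)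
      rw [hC, A.coord_P hz hq, ← hC, e1, e3, A.differenceInvariant_eq (hA hq),
        A.meanInvariant_eq (hA hq)]
    filter_upwards [(z.continuousAt hp).eventually (Metric.ball_mem_nhds (z p) hr),
      z.open_source.mem_nhds hp] with q hq hqs
    rw [e q hqs, e p hp]
    exact hconst _ hq
  obtain ⟨p₀⟩ := (inferInstance : Nonempty M)
  refine ⟨F.differenceInvariant p₀ / F.meanInvariant p₀ ^ 2, fun p => ?_⟩
  have := hloc.apply_eq_of_preconnectedSpace p p₀
  rw [← this, div_mul_cancel₀ _ (pow_ne_zero 2 (hP p))]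

/-- If `P φ²` is holomorphic without zeros, then `F` has a Blaschke potential that satisfies the
special equation with a constant. -/
theorem exists_blaschkePotential [ConnectedSpace M] (h : F.HasPOde)
    (hP : ∀ p, F.meanInvariant p ≠ 0) :
    F.IsLIsothermic ∧ ∃ u : M → ℝ, F.IsBlaschkePotential u ∧
      ∃ c : ℝ, ∀ z : OpenPartialHomeomorph M ℂ,
        F.IsIsothermicCoordinate z (fun q => Real.exp (u q)) →
          SatisfiesSpecialEquation z u c := by
  have hex : ∀ p : M, ∃ A : MiddleFrame F, p ∈ A.dom := fun p => by
    obtain ⟨z, hz, A, hp, hA, -⟩ := h p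
    exact ⟨A, hA hp⟩
  have hsm := smooth_potential hex hP
  refine ⟨isLIsothermic_of_isothermicCoordinate (exists_isothermicCoordinate h hP), F.potential,
    ⟨hsm, exists_isothermicCoordinate h hP⟩, ?_⟩
  obtain ⟨c, hc⟩ := exists_constant h hP
  refine ⟨-c, ?_⟩
  rintro z ⟨hz, A, hA, hco⟩ q hq
  have hzs : IsSmoothChart z := hz
  have hsub : z.target ⊆ z.target ∩ z.symm ⁻¹' A.dom := fun x hx => ⟨hx, hA (z.map_target hx)⟩
  set C := (A.coord hzs).restrict z.open_target hsub
  have hus : ContDiffOn ℝ ∞ (F.potential ∘ z.symm) z.target :=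
    (hzs.contDiffOn_comp_symm hsm.contMDiffOn (s := univ)).mono fun x hx => ⟨hx, trivial⟩
  have hC : ∀ x ∈ z.target, ∀ w : ℂ, C.θ x w = Real.exp ((F.potential ∘ z.symm) x) * w.re ∧
      C.η x w = Real.exp ((F.potential ∘ z.symm) x) * w.im := by
    intro x hx w
    have hq := z.map_target hx
    obtain ⟨v, rfl⟩ := hzs.surjective_dAt hq w
    have h1 := A.coord_trans hzs hq (hA hq) v
    have h2 := hco _ hq v
    rw [z.right_inv hx] at h1
    exact ⟨h1.1.symm.trans h2.1, h1.2.symm.trans h2.2⟩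
  obtain ⟨-, l2⟩ := C.laplacian_isothermic hus (fun x hx w => (hC x hx w).1)
    (fun x hx w => (hC x hx w).2) (z.map_source hq)
  have e1 : C.p₁ (z q) = A.p₁ q := congrArg A.p₁ (z.left_inv hq)
  have e3 : C.p₃ (z q) = A.p₃ q := congrArg A.p₃ (z.left_inv hq)
  have hu' : (F.potential ∘ z.symm) (z q) = F.potential q :=
    congrArg F.potential (z.left_inv hq)
  rw [e1, e3, hu'] at l2
  have hd := hc q
  rw [A.differenceInvariant_eq (hA hq)] at hd
  -- `e^{-2u} = |P|`, so that `P² e^{2u} = e^{-2u}`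
  have habs : Real.exp (-2 * F.potential q) = |F.meanInvariant q| := by
    rw [LegendreImmersion.potential, ← Real.exp_log_eq_abs (hP q)]
    congr 1
    ring
  have hexp : Real.exp (-2 * F.potential q) * Real.exp (F.potential q) ^ 2 = 1 := by
    rw [← Real.exp_nat_mul, ← Real.exp_add]
    norm_num
  have hsq : F.meanInvariant q ^ 2 = Real.exp (-2 * F.potential q) ^ 2 := by
    rw [habs, sq_abs]
  rw [l2]
  linear_combination (-(Real.exp (F.potential q) ^ 2)) * hd
    - c * Real.exp (F.potential q) ^ 2 * hsq - c * Real.exp (-2 * F.potential q) * hexp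

end Blaschke

/-! ### Completion of an adapted frame to a middle frame -/

section Completion

variable {E : Type*} [NormedAddCommGroup E] [NormedSpace ℝ E]

/-- A frame field with `da₀ = θ a₂ + η a₃` and `da₁ ≡ θ a₂ - η a₃` modulo `a₁` is a middle frame
field: the remaining relations between the coefficients of `da₁`, …, `da₄` follow from `dda₀ = 0`
and `dda₁ = 0`. -/
theorem exists_coordFrame (hE : Module.finrank ℝ E = 2) {D : Set E} (hD : IsOpen D) {a₀ : E → V4}
    {a : Fin 4 → E → V4} {θ η β : E → E → ℝ} (ha₀ : ContDiffOn ℝ ∞ a₀ D)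
    (ha : ∀ i, ContDiffOn ℝ ∞ (a i) D) (hb : ∀ x ∈ D, IsLaguerreBasis fun i => a i x)
    (h₀ : ∀ x ∈ D, ∀ w, fderiv ℝ a₀ x w = θ x w • a 1 x + η x w • a 2 x)
    (h₁ : ∀ x ∈ D, ∀ w, fderiv ℝ (a 0) x w = β x w • a 0 x + θ x w • a 1 x - η x w • a 2 x)
    (hinj : ∀ x ∈ D, ∀ w, θ x w = 0 → η x w = 0 → w = 0) :
    ∃ A : CoordFrame D, A.a₀ = a₀ ∧ A.a = a := by
  set ρ : E → E → ℝ := fun x w => -lorentz (fderiv ℝ (a 1) x w) (a 3 x) with hρ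
  set τ : E → E → ℝ := fun x w => -lorentz (fderiv ℝ (a 2) x w) (a 3 x) with hτ
  set ν : E → E → ℝ := fun x w => lorentz (fderiv ℝ (a 1) x w) (a 2 x) with hν
  have hda : ∀ i, ∀ x ∈ D, DifferentiableAt ℝ (a i) x := fun i x hx =>
    CoordFrame.differentiableAt_of_contDiffOn (ha i) hx hD
  -- the scalar products of the frame vectors are constant
  have hskew : ∀ x ∈ D, ∀ w i j, lorentz (fderiv ℝ (a i) x w) (a j x)
      = -lorentz (fderiv ℝ (a j) x w) (a i x) := by
    intro x hx w i j
    have hc : (fun y => lorentz (a i y) (a j y)) =ᶠ[nhds x] fun _ => gram i j := by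
      filter_upwards [hD.mem_nhds hx] with y hy using (hb y hy).1 i j
    have h := congrArg (fun T => T w) (hc.fderiv_eq (𝕜 := ℝ))
    have hi : ∀ i k, HasFDerivAt (fun y => a i y k)
        ((ContinuousLinearMap.proj (R := ℝ) (φ := fun _ : Fin 4 => ℝ) k).comp
          (fderiv ℝ (a i) x)) x :=
      fun i k => (hasFDerivAt_pi'.1 (hda i x hx).hasFDerivAt) k
    have hd : HasFDerivAt (fun y => lorentz (a i y) (a j y)) _ x :=
      (((((hi i 0).mul (hi j 3)).add ((hi i 3).mul (hi j 0))).neg).add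
        ((hi i 1).mul (hi j 1))).add ((hi i 2).mul (hi j 2))
    rw [hd.fderiv] at h
    simp at h
    simp only [lorentz]
    linear_combination h
  have s₀ : ∀ x ∈ D, ∀ w, θ x w = lorentz (fderiv ℝ a₀ x w) (a 1 x) ∧
      η x w = lorentz (fderiv ℝ a₀ x w) (a 2 x) ∧
      β x w = -lorentz (fderiv ℝ (a 0) x w) (a 3 x) ∧
      θ x w = lorentz (fderiv ℝ (a 0) x w) (a 1 x) ∧
      -η x w = lorentz (fderiv ℝ (a 0) x w) (a 2 x) := by
    intro x hx w
    obtain ⟨h00, h01, h02, h03, h11, h12, h13, h22, h23, h33⟩ := (hb x hx).products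
    obtain ⟨h10, h20, h30, h21, h31, h32⟩ := (hb x hx).products'
    rw [h₀ x hx, h₁ x hx]
    simp only [lorentz_add_left, lorentz_sub_left, lorentz_smul_left, h01, h02, h03, h11, h12, h13,
      h22, h23, h21]
    refine ⟨?_, ?_, ?_, ?_, ?_⟩ <;> ring
  have hself : ∀ x ∈ D, ∀ w i, lorentz (fderiv ℝ (a i) x w) (a i x) = 0 := by
    intro x hx w i
    linarith [hskew x hx w i i]
  have lin : ∀ (L : E →L[ℝ] V4) (v : V4) (c d : ℝ) (u w : E), lorentz (L (c • u + d • w)) v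
      = c * lorentz (L u) v + d * lorentz (L w) v := by
    intro L v c d u w
    rw [map_add, map_smul, map_smul, lorentz_add_left, lorentz_smul_left, lorentz_smul_left]
  have hform : ∀ x ∈ D, ∀ w j, fderiv ℝ (a j) x w
      = ∑ k, (!![β x w, ρ x w, τ x w, 0; θ x w, 0, -ν x w, ρ x w; -η x w, ν x w, 0, τ x w;
          0, θ x w, -η x w, -β x w] : Matrix (Fin 4) (Fin 4) ℝ) k j • a k x := by
    intro x hx w j
    obtain ⟨t1, t2, t3, t4, t5⟩ := s₀ x hx w
    have sk := hskew x hx w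
    have se := hself x hx w
    conv_lhs => rw [(hb x hx).expansion (fderiv ℝ (a j) x w)]
    rw [Fin.sum_univ_four]
    fin_cases j
    · simp only [Fin.zero_eta, Matrix.of_apply, Matrix.cons_val, ← t3, ← t4, ← t5, se]
      simp
    · simp only [Fin.mk_one, Matrix.of_apply, Matrix.cons_val, se, sk 1 0, ← t4]
      simp [hρ, hν]
    · simp only [Fin.reduceFinMk, Matrix.of_apply, Matrix.cons_val, se, sk 2 0, ← t5, sk 2 1]
      simp [hτ, hν]
    · simp only [Fin.reduceFinMk, Matrix.of_apply, Matrix.cons_val, se, sk 3 0, sk 3 1, sk 3 2]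
      simp only [hρ, hτ, t3]
      simp
  have sθ : ∀ w, ContDiffOn ℝ ∞ (fun x => θ x w) D := fun w =>
    (contDiffOn_lorentz (contDiffOn_fderiv_apply hD ha₀ w) (ha 1)).congr fun x hx => (s₀ x hx w).1
  have sη : ∀ w, ContDiffOn ℝ ∞ (fun x => η x w) D := fun w =>
    (contDiffOn_lorentz (contDiffOn_fderiv_apply hD ha₀ w) (ha 2)).congr fun x hx => (s₀ x hx w).2.1
  have sβ : ∀ w, ContDiffOn ℝ ∞ (fun x => β x w) D := fun w =>
    (contDiffOn_lorentz (contDiffOn_fderiv_apply hD (ha 0) w) (ha 3)).neg.congr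
      fun x hx => (s₀ x hx w).2.2.1
  have sρ : ∀ w, ContDiffOn ℝ ∞ (fun x => ρ x w) D := fun w =>
    (contDiffOn_lorentz (contDiffOn_fderiv_apply hD (ha 1) w) (ha 3)).neg
  have sτ : ∀ w, ContDiffOn ℝ ∞ (fun x => τ x w) D := fun w =>
    (contDiffOn_lorentz (contDiffOn_fderiv_apply hD (ha 2) w) (ha 3)).neg
  have sν : ∀ w, ContDiffOn ℝ ∞ (fun x => ν x w) D := fun w =>
    contDiffOn_lorentz (contDiffOn_fderiv_apply hD (ha 1) w) (ha 2)
  -- coefficients with respect to `θ`, `η`, from the values on a basis `u`, `v` of the plane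
  have : FiniteDimensional ℝ E := Module.finite_of_finrank_eq_succ hE
  set B := Module.finBasisOfFinrankEq ℝ E hE
  set u := B 0
  set v := B 1
  have hBw : ∀ w, w = B.repr w 0 • u + B.repr w 1 • v := fun w => by
    conv_lhs => rw [← B.sum_repr w]
    rw [Fin.sum_univ_two]
  have hBli : ∀ c d : ℝ, c • u + d • v = 0 → c = 0 ∧ d = 0 := by
    have := B.linearIndependent
    rw [Fintype.linearIndependent_iff] at this
    intro c d h
    have h2 := this ![c, d] (by rw [Fin.sum_univ_two]; exact h)
    exact ⟨h2 0, h2 1⟩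
  have hθl : ∀ x ∈ D, ∀ c d : ℝ, ∀ w w', θ x (c • w + d • w') = c * θ x w + d * θ x w' := by
    intro x hx c d w w'
    rw [(s₀ x hx _).1, (s₀ x hx w).1, (s₀ x hx w').1, lin]
  have hηl : ∀ x ∈ D, ∀ c d : ℝ, ∀ w w', η x (c • w + d • w') = c * η x w + d * η x w' := by
    intro x hx c d w w'
    rw [(s₀ x hx _).2.1, (s₀ x hx w).2.1, (s₀ x hx w').2.1, lin]
  set J : E → ℝ := fun x => θ x u * η x v - θ x v * η x u with hJ
  have hJ0 : ∀ x ∈ D, J x ≠ 0 := by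
    intro x hx h0
    have k1 := hBli (θ x v) (-θ x u) (by
      apply hinj x hx
      · rw [hθl x hx]; ring
      · rw [hηl x hx]; simp only [hJ] at h0; linear_combination -h0)
    have k2 := hBli (η x v) (-η x u) (by
      apply hinj x hx
      · rw [hθl x hx]; simp only [hJ] at h0; linear_combination h0
      · rw [hηl x hx]; ring)
    have hu := hinj x hx u (neg_eq_zero.1 k1.2) (neg_eq_zero.1 k2.2)
    have := hBli 1 0 (by rw [hu]; simp)
    exact one_ne_zero this.1
  have sJ : ContDiffOn ℝ ∞ J D := ((sθ u).mul (sη v)).sub ((sθ v).mul (sη u))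
  have split : ∀ (g : E → E → ℝ), (∀ x ∈ D, ∀ c d : ℝ, ∀ w w', g x (c • w + d • w')
      = c * g x w + d * g x w') → ∀ x ∈ D, ∀ w, g x w
      = (g x u * η x v - g x v * η x u) / J x * θ x w
        + (θ x u * g x v - θ x v * g x u) / J x * η x w := by
    intro g hg x hx w
    have h := hJ0 x hx
    conv_lhs => rw [hBw w, hg x hx]
    conv_rhs => rw [hBw w, hθl x hx, hηl x hx]
    field_simp
    simp only [hJ]
    ring
  have hρl : ∀ x ∈ D, ∀ c d : ℝ, ∀ w w', ρ x (c • w + d • w') = c * ρ x w + d * ρ x w' := by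
    intro x _ c d w w'
    simp only [hρ, lin]; ring
  have hτl : ∀ x ∈ D, ∀ c d : ℝ, ∀ w w', τ x (c • w + d • w') = c * τ x w + d * τ x w' := by
    intro x _ c d w w'
    simp only [hτ, lin]; ring
  have hνl : ∀ x ∈ D, ∀ c d : ℝ, ∀ w w', ν x (c • w + d • w') = c * ν x w + d * ν x w' := by
    intro x _ c d w w'
    simp only [hν, lin]
  have hβl : ∀ x ∈ D, ∀ c d : ℝ, ∀ w w', β x (c • w + d • w') = c * β x w + d * β x w' := by
    intro x hx c d w w'
    rw [(s₀ x hx _).2.2.1, (s₀ x hx w).2.2.1, (s₀ x hx w').2.2.1, lin]; ring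
  -- the Maurer–Cartan equations for `a₀` and `a₁`
  have rel : ∀ x ∈ D, (ρ x u * θ x v + τ x u * η x v - ρ x v * θ x u - τ x v * η x u = 0) ∧
      (θ x u * β x v - θ x v * β x u = -2 * (ν x u * η x v - ν x v * η x u)) ∧
      (β x u * η x v - β x v * η x u = 2 * (θ x u * ν x v - θ x v * ν x u)) := by
    intro x hx
    have hn := hD.mem_nhds hx
    have dθ := fun w => CoordFrame.differentiableAt_of_contDiffOn (sθ w) hx hD
    have dη := fun w => CoordFrame.differentiableAt_of_contDiffOn (sη w) hx hD
    have dβ := fun w => CoordFrame.differentiableAt_of_contDiffOn (sβ w) hx hD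
    have ev : ∀ᶠ y in nhds x, y ∈ D := hn
    have m0 := fun k => maurer_cartan u v (hb x hx) (ha₀.contDiffAt hn) (fun i => hda i x hx)
      (Cu := fun k y => ![0, θ y u, η y u, 0] k) (Cv := fun k y => ![0, θ y v, η y v, 0] k)
      (by intro k; fin_cases k <;> simp [dθ, dη]) (by intro k; fin_cases k <;> simp [dθ, dη])
      (ev.mono fun y hy => by rw [h₀ y hy]; simp [Fin.sum_univ_four])
      (ev.mono fun y hy => by rw [h₀ y hy]; simp [Fin.sum_univ_four])
      (hform x hx u) (hform x hx v) k
    have m1 := fun k => maurer_cartan u v (hb x hx) ((ha 0).contDiffAt hn) (fun i => hda i x hx)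
      (Cu := fun k y => ![β y u, θ y u, -η y u, 0] k)
      (Cv := fun k y => ![β y v, θ y v, -η y v, 0] k)
      (by intro k; fin_cases k <;> simp [dθ, dη, dβ])
      (by intro k; fin_cases k <;> simp [dθ, dη, dβ])
      (ev.mono fun y hy => by rw [h₁ y hy]; simp [Fin.sum_univ_four, sub_eq_add_neg])
      (ev.mono fun y hy => by rw [h₁ y hy]; simp [Fin.sum_univ_four, sub_eq_add_neg])
      (hform x hx u) (hform x hx v) k
    have n0 := m0 0
    have n1 := m0 1
    have n2 := m0 2
    have n3 := m1 1
    have n4 := m1 2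
    simp only [Fin.sum_univ_four, Matrix.of_apply, Matrix.cons_val] at n0 n1 n2 n3 n4
    have neg : ∀ w w', fderiv ℝ (fun y => -η y w) x w' = -fderiv ℝ (fun y => η y w) x w' := by
      intro w w'
      rw [fderiv_fun_neg]
      rfl
    rw [neg, neg] at n4
    simp only [fderiv_fun_const, Pi.zero_apply, zero_apply] at n0
    refine ⟨?_, ?_, ?_⟩
    · linear_combination n0
    · linear_combination n3 - n1
    · linear_combination n4 + n2
  have sdiv : ∀ (g h k l : E → ℝ), ContDiffOn ℝ ∞ g D → ContDiffOn ℝ ∞ h D → ContDiffOn ℝ ∞ k D →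
      ContDiffOn ℝ ∞ l D → ContDiffOn ℝ ∞ (fun x => (g x * h x - k x * l x) / J x) D :=
    fun g h k l hg hh hk hl => ((hg.mul hh).sub (hk.mul hl)).div sJ hJ0
  refine ⟨{
    a₀ := a₀
    a := a
    θ := θ
    η := η
    p₁ := fun x => (ρ x u * η x v - ρ x v * η x u) / J x
    p₂ := fun x => (θ x u * ρ x v - θ x v * ρ x u) / J x
    p₃ := fun x => (θ x u * τ x v - θ x v * τ x u) / J x
    q₁ := fun x => (ν x u * η x v - ν x v * η x u) / J x
    q₂ := fun x => (θ x u * ν x v - θ x v * ν x u) / J x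
    isOpen := hD
    smooth_a₀ := ha₀
    smooth_a := ha
    smooth_p₁ := sdiv _ _ _ _ (sρ u) (sη v) (sρ v) (sη u)
    smooth_p₂ := sdiv _ _ _ _ (sθ u) (sρ v) (sθ v) (sρ u)
    smooth_p₃ := sdiv _ _ _ _ (sθ u) (sτ v) (sθ v) (sτ u)
    smooth_q₁ := sdiv _ _ _ _ (sν u) (sη v) (sν v) (sη u)
    smooth_q₂ := sdiv _ _ _ _ (sθ u) (sν v) (sθ v) (sν u)
    basis := hb
    d_a₀ := h₀
    d_a := fun x hx w j => ?_
    injective := hinj }, rfl, rfl⟩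
  have e1 := split ρ hρl x hx w
  have e2 := split τ hτl x hx w
  have e3 := split ν hνl x hx w
  have e4 := split β hβl x hx w
  obtain ⟨r1, r2, r3⟩ := rel x hx
  have r1' : τ x u * η x v - τ x v * η x u = θ x u * ρ x v - θ x v * ρ x u := by
    linear_combination r1
  rw [r1'] at e2
  rw [r2, r3] at e4
  rw [hform x hx w j]
  refine Finset.sum_congr rfl fun k _ => ?_
  congr 1
  rw [e1, e2, e3, e4]
  fin_cases k <;> fin_cases j <;> simp [connMatrix] <;> ring

end Completion

/-! ### The shape operator of a Legendre immersion -/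

/-- The vector product of Euclidean 3-space. -/
def cross (v w : E3) : E3 :=
  !₂[v 1 * w 2 - v 2 * w 1, v 2 * w 0 - v 0 * w 2, v 0 * w 1 - v 1 * w 0]

lemma inner_E3 (v w : E3) : ⟪v, w⟫_ℝ = v 0 * w 0 + v 1 * w 1 + v 2 * w 2 := by
  simp [PiLp.inner_apply, Fin.sum_univ_three, mul_comm]

lemma inner_cross_left (v w : E3) : ⟪cross v w, v⟫_ℝ = 0 := by
  rw [inner_E3]; simp [cross]; ring

lemma inner_cross_right (v w : E3) : ⟪cross v w, w⟫_ℝ = 0 := by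
  rw [inner_E3]; simp [cross]; ring

lemma inner_cross_self (v w : E3) :
    ⟪cross v w, cross v w⟫_ℝ = ⟪v, v⟫_ℝ * ⟪w, w⟫_ℝ - ⟪v, w⟫_ℝ ^ 2 := by
  simp only [inner_E3]; simp [cross]; ring

/-- Expansion of a vector in an oriented orthonormal basis. -/
lemma expansion_cross {n e : E3} (hn : ⟪n, n⟫_ℝ = 1) (he : ⟪e, e⟫_ℝ = 1) (hne : ⟪n, e⟫_ℝ = 0)
    (y : E3) : y = ⟪y, n⟫_ℝ • n + ⟪y, e⟫_ℝ • e + ⟪y, cross n e⟫_ℝ • cross n e := by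
  have h1 := inner_cross_left n e
  have h2 := inner_cross_right n e
  have h3 := inner_cross_self n e
  rw [hn, he, hne] at h3
  have hon : Orthonormal ℝ ![n, e, cross n e] := by
    rw [orthonormal_iff_ite]
    intro i j
    fin_cases i <;> fin_cases j <;>
      simp [hn, he, hne, h1, h2, h3, real_inner_comm, -inner_self_eq_norm_sq_to_K]
    · rw [real_inner_comm]; exact h1
    · rw [real_inner_comm]; exact h2
  have hspan : ⊤ ≤ Submodule.span ℝ (Set.range ![n, e, cross n e]) :=
    (hon.linearIndependent.span_eq_top_of_card_eq_finrank' (by simp)).ge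
  have := ((OrthonormalBasis.mk hon hspan).sum_repr' y).symm
  rw [Fin.sum_univ_three] at this
  simp only [OrthonormalBasis.coe_mk, Matrix.cons_val] at this
  rw [real_inner_comm y n, real_inner_comm y e, real_inner_comm y (cross n e)] at this
  exact this

/-- A vector orthogonal to a unit normal is a combination of two independent tangent vectors. -/
lemma exists_combination {n N₁ N₂ y : E3} (hn : ⟪n, n⟫_ℝ = 1) (h1 : ⟪N₁, n⟫_ℝ = 0)
    (h2 : ⟪N₂, n⟫_ℝ = 0) (hli : LinearIndependent ℝ ![N₁, N₂]) (hy : ⟪y, n⟫_ℝ = 0) :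
    ∃ a b : ℝ, y = a • N₁ + b • N₂ := by
  have hli3 : LinearIndependent ℝ ![N₁, N₂, n] := by
    rw [Fintype.linearIndependent_iff]
    intro g hg
    rw [Fin.sum_univ_three] at hg
    simp only [Matrix.cons_val] at hg
    have h := congrArg (fun t => ⟪t, n⟫_ℝ) hg
    simp only [inner_add_left, inner_smul_left, h1, h2, hn, inner_zero_left,
      RCLike.conj_to_real] at h
    have hg2 : g 2 = 0 := by linarith
    rw [hg2, zero_smul, add_zero] at hg
    have := LinearIndependent.pair_iff.1 hli _ _ hg
    intro i
    fin_cases i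
    · exact this.1
    · exact this.2
    · exact hg2
  have hspan := hli3.span_eq_top_of_card_eq_finrank' (by simp)
  have hmem : y ∈ Submodule.span ℝ (Set.range ![N₁, N₂, n]) := by rw [hspan]; trivial
  rw [Submodule.mem_span_range_iff_exists_fun] at hmem
  obtain ⟨c, hc⟩ := hmem
  rw [Fin.sum_univ_three] at hc
  simp only [Matrix.cons_val] at hc
  have h := congrArg (fun t => ⟪t, n⟫_ℝ) hc
  simp only [inner_add_left, inner_smul_left, h1, h2, hn, hy, RCLike.conj_to_real] at h
  have hc2 : c 2 = 0 := by linarith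
  exact ⟨c 0, c 1, by rw [← hc, hc2]; simp⟩

section Shape

variable {E : Type*} [NormedAddCommGroup E] [NormedSpace ℝ E]

/-- The determinant of `dn · dn` on the pair `u`, `v`. -/
def thirdDet (n : E → E3) (u v x : E) : ℝ :=
  ⟪fderiv ℝ n x u, fderiv ℝ n x u⟫_ℝ * ⟪fderiv ℝ n x v, fderiv ℝ n x v⟫_ℝ
    - ⟪fderiv ℝ n x u, fderiv ℝ n x v⟫_ℝ ^ 2

/-- The trace of the endomorphism that represents `df · dn` with respect to `dn · dn`, computed on
the basis `u`, `v`. -/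
def shapeTrace (f n : E → E3) (u v x : E) : ℝ :=
  (⟪fderiv ℝ f x u, fderiv ℝ n x u⟫_ℝ * ⟪fderiv ℝ n x v, fderiv ℝ n x v⟫_ℝ
    - ⟪fderiv ℝ f x u, fderiv ℝ n x v⟫_ℝ * ⟪fderiv ℝ n x u, fderiv ℝ n x v⟫_ℝ
    - ⟪fderiv ℝ f x v, fderiv ℝ n x u⟫_ℝ * ⟪fderiv ℝ n x u, fderiv ℝ n x v⟫_ℝ
    + ⟪fderiv ℝ f x v, fderiv ℝ n x v⟫_ℝ * ⟪fderiv ℝ n x u, fderiv ℝ n x u⟫_ℝ) / thirdDet n u v x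

/-- The determinant of the endomorphism that represents `df · dn` with respect to `dn · dn`. -/
def shapeDet (f n : E → E3) (u v x : E) : ℝ :=
  (⟪fderiv ℝ f x u, fderiv ℝ n x u⟫_ℝ * ⟪fderiv ℝ f x v, fderiv ℝ n x v⟫_ℝ
    - ⟪fderiv ℝ f x u, fderiv ℝ n x v⟫_ℝ * ⟪fderiv ℝ f x v, fderiv ℝ n x u⟫_ℝ) / thirdDet n u v x

/-- The square of half the difference of the principal radii. -/
def skewSq (f n : E → E3) (u v x : E) : ℝ := shapeTrace f n u v x ^ 2 / 4 - shapeDet f n u v x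

lemma thirdDet_swap (n : E → E3) (u v x : E) : thirdDet n v u x = thirdDet n u v x := by
  unfold thirdDet
  rw [real_inner_comm (fderiv ℝ n x v) (fderiv ℝ n x u)]
  ring

lemma shapeTrace_swap (f n : E → E3) (u v x : E) :
    shapeTrace f n v u x = shapeTrace f n u v x := by
  unfold shapeTrace
  rw [thirdDet_swap, real_inner_comm (fderiv ℝ n x v) (fderiv ℝ n x u)]
  ring

lemma skewSq_swap (f n : E → E3) (u v x : E) : skewSq f n v u x = skewSq f n u v x := by
  unfold skewSq shapeDet
  rw [thirdDet_swap, shapeTrace_swap]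
  ring

lemma contDiffOn_thirdDet {D : Set E} (hD : IsOpen D) {n : E → E3} (hn : ContDiffOn ℝ ∞ n D)
    (u v : E) : ContDiffOn ℝ ∞ (thirdDet n u v) D := by
  have hn := fun w => contDiffOn_fderiv_apply hD hn w
  exact (((hn u).inner ℝ (hn u)).mul ((hn v).inner ℝ (hn v))).sub (((hn u).inner ℝ (hn v)).pow 2)

lemma contDiffOn_shapeTrace {D : Set E} (hD : IsOpen D) {f n : E → E3} (hf : ContDiffOn ℝ ∞ f D)
    (hn : ContDiffOn ℝ ∞ n D) {u v : E} (h0 : ∀ x ∈ D, thirdDet n u v x ≠ 0) :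
    ContDiffOn ℝ ∞ (shapeTrace f n u v) D := by
  have hd := contDiffOn_thirdDet hD hn u v
  have hn := fun w => contDiffOn_fderiv_apply hD hn w
  have hf := fun w => contDiffOn_fderiv_apply hD hf w
  exact ((((((hf u).inner ℝ (hn u)).mul ((hn v).inner ℝ (hn v))).sub
    (((hf u).inner ℝ (hn v)).mul ((hn u).inner ℝ (hn v)))).sub
    (((hf v).inner ℝ (hn u)).mul ((hn u).inner ℝ (hn v)))).add
    (((hf v).inner ℝ (hn v)).mul ((hn u).inner ℝ (hn u)))).div hd h0

lemma contDiffOn_skewSq {D : Set E} (hD : IsOpen D) {f n : E → E3} (hf : ContDiffOn ℝ ∞ f D)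
    (hn : ContDiffOn ℝ ∞ n D) {u v : E} (h0 : ∀ x ∈ D, thirdDet n u v x ≠ 0) :
    ContDiffOn ℝ ∞ (skewSq f n u v) D := by
  have hd := contDiffOn_thirdDet hD hn u v
  have ht := contDiffOn_shapeTrace hD hf hn h0
  have hn := fun w => contDiffOn_fderiv_apply hD hn w
  have hf := fun w => contDiffOn_fderiv_apply hD hf w
  exact ((ht.pow 2).div_const 4).sub
    (((((hf u).inner ℝ (hn u)).mul ((hf v).inner ℝ (hn v))).sub
    (((hf u).inner ℝ (hn v)).mul ((hf v).inner ℝ (hn u)))).div hd h0)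

namespace IsLegendreOn

variable {D : Set E} {f n : E → E3} (h : IsLegendreOn D f n)
include h

lemma inner_n {x : E} (hx : x ∈ D) : ⟪n x, n x⟫_ℝ = 1 := by
  rw [real_inner_self_eq_norm_sq, h.norm_n x hx, one_pow]

/-- The form `df · dn` is symmetric. -/
lemma symm {x : E} (hx : x ∈ D) (u v : E) :
    ⟪fderiv ℝ f x u, fderiv ℝ n x v⟫_ℝ = ⟪fderiv ℝ f x v, fderiv ℝ n x u⟫_ℝ := by
  have hn := h.isOpen.mem_nhds hx
  have dn := h.differentiableAt_n hx
  have df : ∀ w, DifferentiableAt ℝ (fun y => fderiv ℝ f y w) x := fun w =>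
    CoordFrame.differentiableAt_of_contDiffOn (contDiffOn_fderiv_apply h.isOpen h.smooth_f w) hx
      h.isOpen
  have key : ∀ w w', ⟪fderiv ℝ f x w, fderiv ℝ n x w'⟫_ℝ
      = -⟪fderiv ℝ (fun y => fderiv ℝ f y w) x w', n x⟫_ℝ := by
    intro w w'
    have h1 := fderiv_inner_apply ℝ (df w) dn w'
    have h2 : (fun y => ⟪fderiv ℝ f y w, n y⟫_ℝ) =ᶠ[nhds x] fun _ => (0 : ℝ) := by
      filter_upwards [hn] with y hy using h.contact y hy w
    rw [h2.fderiv_eq] at h1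
    simp only [fderiv_fun_const, Pi.zero_apply, zero_apply] at h1
    linarith
  rw [key, key, fderiv_fderiv_comm (h.smooth_f.contDiffAt hn) u v]

lemma linearIndependent {x : E} (hx : x ∈ D) {u v : E} (huv : LinearIndependent ℝ ![u, v]) :
    LinearIndependent ℝ ![fderiv ℝ n x u, fderiv ℝ n x v] := by
  rw [LinearIndependent.pair_iff] at huv ⊢
  intro a b hab
  refine huv a b (h.immersive x hx _ ?_)
  rw [map_add, map_smul, map_smul, hab]

lemma thirdDet_pos {x : E} (hx : x ∈ D) {u v : E} (huv : LinearIndependent ℝ ![u, v]) :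
    0 < thirdDet n u v x := by
  have hli := h.linearIndependent hx huv
  rw [LinearIndependent.pair_iff] at hli
  set a := fderiv ℝ n x u
  set b := fderiv ℝ n x v
  have hb : 0 < ⟪b, b⟫_ℝ := by
    rw [real_inner_self_pos]
    intro h0
    have := hli 0 1 (by rw [h0]; simp)
    exact one_ne_zero this.2
  have hne : ⟪b, b⟫_ℝ • a + (-⟪a, b⟫_ℝ) • b ≠ 0 := fun h0 => hb.ne' (hli _ _ h0).1
  have hpos := real_inner_self_pos.2 hne
  have e : ⟪⟪b, b⟫_ℝ • a + (-⟪a, b⟫_ℝ) • b, ⟪b, b⟫_ℝ • a + (-⟪a, b⟫_ℝ) • b⟫_ℝ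
      = ⟪b, b⟫_ℝ * thirdDet n u v x := by
    simp only [inner_add_left, inner_add_right, inner_smul_left, inner_smul_right,
      RCLike.conj_to_real, real_inner_comm a b, thirdDet]
    ring
  rw [e] at hpos
  exact (pos_iff_pos_of_mul_pos hpos).1 hb

/-- The coefficients of the shape operator: `df = dn ∘ S`, with `S` symmetric for `dn · dn`. -/
lemma exists_shape {x : E} (hx : x ∈ D) {u v : E} (huv : LinearIndependent ℝ ![u, v]) :
    ∃ a b c : ℝ,
      (fderiv ℝ f x u + (-shapeTrace f n u v x / 2) • fderiv ℝ n x u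
        = a • fderiv ℝ n x u + b • fderiv ℝ n x v) ∧
      (fderiv ℝ f x v + (-shapeTrace f n u v x / 2) • fderiv ℝ n x v
        = c • fderiv ℝ n x u + (-a) • fderiv ℝ n x v) ∧
      skewSq f n u v x = a ^ 2 + b * c ∧
      2 * a * ⟪fderiv ℝ n x u, fderiv ℝ n x v⟫_ℝ + b * ⟪fderiv ℝ n x v, fderiv ℝ n x v⟫_ℝ
        = c * ⟪fderiv ℝ n x u, fderiv ℝ n x u⟫_ℝ := by
  have hli := h.linearIndependent hx huv
  have hpos := (h.thirdDet_pos hx huv).ne'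
  obtain ⟨α, β, h1⟩ := exists_combination (h.inner_n hx) (h.inner_fderiv_n hx u)
    (h.inner_fderiv_n hx v) hli (h.contact x hx u)
  obtain ⟨γ, δ, h2⟩ := exists_combination (h.inner_n hx) (h.inner_fderiv_n hx u)
    (h.inner_fderiv_n hx v) hli (h.contact x hx v)
  have hs := h.symm hx u v
  have htr : shapeTrace f n u v x = α + δ := by
    rw [shapeTrace, div_eq_iff hpos, thirdDet, h1, h2]
    simp only [inner_add_left, inner_smul_left, RCLike.conj_to_real,
      real_inner_comm (fderiv ℝ n x u) (fderiv ℝ n x v)]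
    ring
  have hdet : shapeDet f n u v x = α * δ - β * γ := by
    rw [shapeDet, div_eq_iff hpos, thirdDet, h1, h2]
    simp only [inner_add_left, inner_smul_left, RCLike.conj_to_real,
      real_inner_comm (fderiv ℝ n x u) (fderiv ℝ n x v)]
    ring
  refine ⟨(α - δ) / 2, β, γ, ?_, ?_, ?_, ?_⟩
  · rw [htr]
    conv_lhs => rw [h1]
    module
  · rw [htr]
    conv_lhs => rw [h2]
    module
  · rw [skewSq, htr, hdet]; ring
  · rw [h1, h2] at hs
    simp only [inner_add_left, inner_smul_left, RCLike.conj_to_real,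
      real_inner_comm (fderiv ℝ n x u) (fderiv ℝ n x v)] at hs
    linear_combination hs

/-- The middle sphere map is conformal with respect to `dn · dn`. -/
lemma conformal {x : E} (hx : x ∈ D) {u v : E} (huv : LinearIndependent ℝ ![u, v]) :
    (⟪fderiv ℝ f x u + (-shapeTrace f n u v x / 2) • fderiv ℝ n x u,
        fderiv ℝ f x u + (-shapeTrace f n u v x / 2) • fderiv ℝ n x u⟫_ℝ
      = skewSq f n u v x * ⟪fderiv ℝ n x u, fderiv ℝ n x u⟫_ℝ) ∧
    (⟪fderiv ℝ f x u + (-shapeTrace f n u v x / 2) • fderiv ℝ n x u,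
        fderiv ℝ f x v + (-shapeTrace f n u v x / 2) • fderiv ℝ n x v⟫_ℝ
      = skewSq f n u v x * ⟪fderiv ℝ n x u, fderiv ℝ n x v⟫_ℝ) ∧
    (⟪fderiv ℝ f x v + (-shapeTrace f n u v x / 2) • fderiv ℝ n x v,
        fderiv ℝ f x v + (-shapeTrace f n u v x / 2) • fderiv ℝ n x v⟫_ℝ
      = skewSq f n u v x * ⟪fderiv ℝ n x v, fderiv ℝ n x v⟫_ℝ) := by
  obtain ⟨a, b, c, h1, h2, h3, h4⟩ := h.exists_shape hx huv
  rw [h1, h2, h3]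
  simp only [inner_add_left, inner_add_right, inner_smul_left, inner_smul_right,
      RCLike.conj_to_real, real_inner_comm (fderiv ℝ n x u) (fderiv ℝ n x v)]
  refine ⟨?_, ?_, ?_⟩
  · linear_combination b * h4
  · linear_combination (-a) * h4
  · linear_combination (-c) * h4

lemma skewSq_nonneg {x : E} (hx : x ∈ D) {u v : E} (huv : LinearIndependent ℝ ![u, v]) :
    0 ≤ skewSq f n u v x := by
  have h1 := (h.conformal hx huv).1
  have hli := h.linearIndependent hx huv
  have hu : 0 < ⟪fderiv ℝ n x u, fderiv ℝ n x u⟫_ℝ := real_inner_self_pos.2 (hli.ne_zero 0)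
  by_contra hneg
  push Not at hneg
  have := mul_neg_of_neg_of_pos hneg hu
  rw [← h1] at this
  exact absurd real_inner_self_nonneg this.not_ge

/-- If `df` is not a multiple of `dn`, the principal radii are distinct. -/
lemma skewSq_pos {x : E} (hx : x ∈ D) {u v : E} (huv : LinearIndependent ℝ ![u, v])
    (hnd : ∀ s : ℝ, ¬ (fderiv ℝ f x u + s • fderiv ℝ n x u = 0 ∧
      fderiv ℝ f x v + s • fderiv ℝ n x v = 0)) :
    0 < skewSq f n u v x := by
  refine lt_of_le_of_ne (h.skewSq_nonneg hx huv) fun h0 => ?_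
  obtain ⟨h1, -, h3⟩ := h.conformal hx huv
  rw [← h0, zero_mul] at h1 h3
  exact hnd _ ⟨inner_self_eq_zero.1 h1, inner_self_eq_zero.1 h3⟩

lemma smooth_shapeTrace {u v : E} (huv : LinearIndependent ℝ ![u, v]) :
    ContDiffOn ℝ ∞ (shapeTrace f n u v) D :=
  contDiffOn_shapeTrace h.isOpen h.smooth_f h.smooth_n fun _ hx => (h.thirdDet_pos hx huv).ne'

lemma smooth_skewSq {u v : E} (huv : LinearIndependent ℝ ![u, v]) :
    ContDiffOn ℝ ∞ (skewSq f n u v) D :=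
  contDiffOn_skewSq h.isOpen h.smooth_f h.smooth_n fun _ hx => (h.thirdDet_pos hx huv).ne'

end IsLegendreOn

end Shape

/-! ### Existence of middle frames -/

/-- A Laguerre basis built from an oriented orthonormal basis `n, e, n × e` of Euclidean space, a
scaling `κ` of the null direction of `n`, and a null rotation with parameters `m₂`, `m₃`. -/
def nullBasis (n e : E3) (κ m₂ m₃ : ℝ) : Fin 4 → V4 :=
  ![κ • spherePoint n 1, spherePoint e 0 + m₂ • spherePoint n 1,
    spherePoint (cross n e) 0 + m₃ • spherePoint n 1,
    κ⁻¹ • (spherePoint (-(1 / 2 : ℝ) • n) (1 / 2) + m₂ • spherePoint e 0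
      + m₃ • spherePoint (cross n e) 0 + ((m₂ ^ 2 + m₃ ^ 2) / 2) • spherePoint n 1)]

lemma isLaguerreBasis_nullBasis {n e : E3} (hn : ⟪n, n⟫_ℝ = 1) (he : ⟪e, e⟫_ℝ = 1)
    (hne : ⟪n, e⟫_ℝ = 0) {κ : ℝ} (hκ : 0 < κ) (m₂ m₃ : ℝ) :
    IsLaguerreBasis (nullBasis n e κ m₂ m₃) := by
  have h1 : ⟪n, cross n e⟫_ℝ = 0 := by rw [real_inner_comm]; exact inner_cross_left n e
  have h1' := inner_cross_left n e
  have h2 : ⟪e, cross n e⟫_ℝ = 0 := by rw [real_inner_comm]; exact inner_cross_right n e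
  have h2' := inner_cross_right n e
  have hne' : ⟪e, n⟫_ℝ = 0 := by rw [real_inner_comm]; exact hne
  have h3 : ⟪cross n e, cross n e⟫_ℝ = 1 := by rw [inner_cross_self, hn, he, hne]; ring
  have hκ' := hκ.ne'
  have hs : 0 < √(2 : ℝ) := by positivity
  have hss : √(2 : ℝ) * √2 = 2 := Real.mul_self_sqrt (by norm_num)
  have hg : ∀ i j, lorentz (nullBasis n e κ m₂ m₃ i) (nullBasis n e κ m₂ m₃ j) = gram i j := by
    intro i j
    fin_cases i <;> fin_cases j <;>
      simp only [nullBasis, gram, Fin.zero_eta, Fin.mk_one, Fin.reduceFinMk, Matrix.of_apply,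
        Matrix.cons_val, lorentz_add_left,
        lorentz_add_right, lorentz_smul_left, lorentz_smul_right, lorentz_spherePoint,
        inner_smul_left, inner_smul_right, RCLike.conj_to_real, hn, he, hne, h1, h2, h3, h1', h2',
        hne'] <;> field_simp <;> ring
  have hsum : ∀ (c : E3) (r : ℝ), spherePoint c r 0 + spherePoint c r 3 = √2 * r := by
    intro c r
    simp only [spherePoint, Matrix.cons_val]
    field_simp
    linear_combination (-r) * hss
  refine ⟨hg, ⟨?_, ?_⟩, ⟨?_, ?_⟩, ?_⟩
  · rw [hg]; simp [gram]
  · have : lorentz (nullBasis n e κ m₂ m₃ 0) ![1, 0, 0, 1]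
        = -(κ * (spherePoint n 1 0 + spherePoint n 1 3)) := by
      simp [lorentz, nullBasis]; ring
    rw [this, hsum]
    have : 0 < κ * (√2 * 1) := by positivity
    linarith
  · rw [hg]; simp [gram]
  · have : lorentz (nullBasis n e κ m₂ m₃ 3) ![1, 0, 0, 1]
        = -(κ⁻¹ * ((spherePoint (-(1 / 2 : ℝ) • n) (1 / 2) 0
          + spherePoint (-(1 / 2 : ℝ) • n) (1 / 2) 3)
          + m₂ * (spherePoint e 0 0 + spherePoint e 0 3)
          + m₃ * (spherePoint (cross n e) 0 0 + spherePoint (cross n e) 0 3)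
          + (m₂ ^ 2 + m₃ ^ 2) / 2 * (spherePoint n 1 0 + spherePoint n 1 3))) := by
      simp only [lorentz, nullBasis, Matrix.cons_val, Pi.add_apply, Pi.smul_apply, smul_eq_mul]
      ring
    rw [this]
    simp only [hsum]
    have : 0 < κ⁻¹ * (√2 * (1 / 2) + (m₂ ^ 2 + m₃ ^ 2) / 2 * (√2 * 1)) := by positivity
    linarith
  · have key : (frameMatrix (nullBasis n e κ m₂ m₃)).det
        = (κ * κ⁻¹) * (2 * ((√2)⁻¹ * (√2)⁻¹)) * (⟪n, n⟫_ℝ * ⟪e, e⟫_ℝ - ⟪n, e⟫_ℝ ^ 2) := by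
      simp only [inner_E3]
      rw [Matrix.det_succ_row_zero]
      simp only [nullBasis, spherePoint, div_eq_mul_inv]
      generalize (√2)⁻¹ = s
      generalize κ⁻¹ = t
      simp [Fin.sum_univ_succ, Matrix.det_fin_three, frameMatrix, cross, Fin.succAbove]
      ring
    rw [key, hn, he, hne]
    have : 0 < κ * κ⁻¹ * (2 * ((√2)⁻¹ * (√2)⁻¹)) := by positivity
    linarith

section Existence

variable {E : Type*} [NormedAddCommGroup E] [NormedSpace ℝ E]

/-- The image `r` of `dn u` under the sum of the traceless shape operator and its positive
eigenvalue `κ` spans one eigenline, and the orthogonal direction spans the other. -/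
lemma IsLegendreOn.principal_directions {D : Set E} {f n : E → E3} (h : IsLegendreOn D f n) {x : E}
    (hx : x ∈ D) {u v : E} (huv : LinearIndependent ℝ ![u, v])
    (hspan : ∀ w, ∃ c d : ℝ, w = c • u + d • v) {κ : ℝ} (hκ : κ ^ 2 = skewSq f n u v x) {e : E3}
    (he : ⟪e, e⟫_ℝ = 1) {l : ℝ} (hl : e = l • (fderiv ℝ f x u
      + (-shapeTrace f n u v x / 2) • fderiv ℝ n x u + κ • fderiv ℝ n x u)) :
    ⟪n x, e⟫_ℝ = 0 ∧ ∀ w,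
      ⟪fderiv ℝ f x w + (-shapeTrace f n u v x / 2) • fderiv ℝ n x w, e⟫_ℝ
        = κ * ⟪fderiv ℝ n x w, e⟫_ℝ ∧
      ⟪fderiv ℝ f x w + (-shapeTrace f n u v x / 2) • fderiv ℝ n x w, cross (n x) e⟫_ℝ
        = -(κ * ⟪fderiv ℝ n x w, cross (n x) e⟫_ℝ) := by
  have hn := h.inner_n hx
  obtain ⟨a, b, c, h1, h2, h3, h4⟩ := h.exists_shape hx huv
  have hpos := h.thirdDet_pos hx huv
  have iu := h.inner_fderiv_n hx u
  have iv := h.inner_fderiv_n hx v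
  rw [thirdDet] at hpos
  have hne : ⟪n x, e⟫_ℝ = 0 := by
    rw [real_inner_comm, hl, h1]
    simp only [inner_add_left, inner_smul_left, RCLike.conj_to_real, iu, iv]
    ring
  set N₁ := fderiv ℝ n x u with hN₁
  set N₂ := fderiv ℝ n x v with hN₂
  have k1 := expansion_cross hn he hne N₁
  have k2 := expansion_cross hn he hne N₂
  rw [iu, zero_smul, zero_add] at k1
  rw [iv, zero_smul, zero_add] at k2
  have c1 : ⟪cross (n x) e, cross (n x) e⟫_ℝ = 1 := by rw [inner_cross_self, hn, he, hne]; ring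
  have c2 := inner_cross_right (n x) e
  have c3 : ⟪e, cross (n x) e⟫_ℝ = 0 := by rw [real_inner_comm]; exact c2
  set E₃ := cross (n x) e
  set y₁ := ⟪N₁, e⟫_ℝ with hy₁
  set y₂ := ⟪N₂, e⟫_ℝ with hy₂
  set x₁ := ⟪N₁, E₃⟫_ℝ with hx₁
  set x₂ := ⟪N₂, E₃⟫_ℝ with hx₂
  have g11 : ⟪N₁, N₁⟫_ℝ = y₁ ^ 2 + x₁ ^ 2 := by
    rw [k1]
    simp only [inner_add_left, inner_add_right, inner_smul_left, inner_smul_right,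
      RCLike.conj_to_real, he, c1, c2, c3]
    ring
  have g12 : ⟪N₁, N₂⟫_ℝ = y₁ * y₂ + x₁ * x₂ := by
    rw [k1, k2]
    simp only [inner_add_left, inner_add_right, inner_smul_left, inner_smul_right,
      RCLike.conj_to_real, he, c1, c2, c3]
    ring
  have g22 : ⟪N₂, N₂⟫_ℝ = y₂ ^ 2 + x₂ ^ 2 := by
    rw [k2]
    simp only [inner_add_left, inner_add_right, inner_smul_left, inner_smul_right,
      RCLike.conj_to_real, he, c1, c2, c3]
    ring
  rw [g11, g12, g22] at hpos h4
  have hJ : y₁ * x₂ - y₂ * x₁ ≠ 0 := by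
    intro h0
    have : (y₁ ^ 2 + x₁ ^ 2) * (y₂ ^ 2 + x₂ ^ 2) - (y₁ * y₂ + x₁ * x₂) ^ 2
      = (y₁ * x₂ - y₂ * x₁) ^ 2 := by ring
    rw [this, h0] at hpos
    norm_num at hpos
  -- the products of `e` with `dn` in terms of the matrix of the shape operator
  have e1 : y₁ = l * ((a + κ) * (y₁ ^ 2 + x₁ ^ 2) + b * (y₁ * y₂ + x₁ * x₂)) := by
    have := congrArg (fun y => ⟪N₁, y⟫_ℝ) hl
    rw [h1] at this
    simp only [inner_add_right, inner_smul_right, g11, g12] at this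
    linear_combination this
  have e2 : y₂ = l * ((a + κ) * (y₁ * y₂ + x₁ * x₂) + b * (y₂ ^ 2 + x₂ ^ 2)) := by
    have := congrArg (fun y => ⟪N₂, y⟫_ℝ) hl
    rw [h1] at this
    simp only [inner_add_right, inner_smul_right, g22, real_inner_comm N₁ N₂, g12] at this
    linear_combination this
  rw [h3] at hκ
  have m1 : a * y₁ + b * y₂ - κ * y₁ = 0 := by
    linear_combination (a - κ) * e1 + b * e2 + l * b * h4 - l * (y₁ ^ 2 + x₁ ^ 2) * hκ
  have m2 : c * y₁ - a * y₂ - κ * y₂ = 0 := by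
    linear_combination c * e1 - (a + κ) * e2 - l * (a + κ) * h4 - l * (y₁ * y₂ + x₁ * x₂) * hκ
  have q : (a * x₁ + b * x₂) * x₂ - (c * x₁ - a * x₂) * x₁ = 0 := by
    linear_combination h4 - y₂ * m1 + y₁ * m2
  have m3 : a * x₁ + b * x₂ + κ * x₁ = 0 := by
    have : (a * x₁ + b * x₂ + κ * x₁) * (y₁ * x₂ - y₂ * x₁) = 0 := by
      linear_combination y₁ * q - x₁ * x₂ * m1 + x₁ ^ 2 * m2
    exact (mul_eq_zero.1 this).resolve_right hJ
  have m4 : c * x₁ - a * x₂ + κ * x₂ = 0 := by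
    have : (c * x₁ - a * x₂ + κ * x₂) * (y₁ * x₂ - y₂ * x₁) = 0 := by
      linear_combination y₂ * q - x₂ ^ 2 * m1 + x₁ * x₂ * m2
    exact (mul_eq_zero.1 this).resolve_right hJ
  refine ⟨hne, fun w => ?_⟩
  obtain ⟨s, t, rfl⟩ := hspan w
  have ew : fderiv ℝ f x (s • u + t • v)
      + (-shapeTrace f n u v x / 2) • fderiv ℝ n x (s • u + t • v)
      = s • (a • N₁ + b • N₂) + t • (c • N₁ + (-a) • N₂) := by
    rw [← h1, ← h2, map_add, map_add, map_smul, map_smul, map_smul, map_smul]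
    module
  rw [ew, map_add, map_smul, map_smul]
  simp only [inner_add_left, inner_smul_left, RCLike.conj_to_real, ← hN₁, ← hN₂, ← hy₁, ← hy₂,
    ← hx₁, ← hx₂]
  constructor
  · linear_combination s * m1 + t * m2
  · linear_combination s * m3 + t * m4

lemma contDiffOn_cross {D : Set E} {g k : E → E3} (hg : ContDiffOn ℝ ∞ g D)
    (hk : ContDiffOn ℝ ∞ k D) : ContDiffOn ℝ ∞ (fun x => cross (g x) (k x)) D := by
  have a := fun i => contDiffOn_euclidean.1 hg i
  have b := fun i => contDiffOn_euclidean.1 hk i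
  rw [contDiffOn_euclidean]
  intro i
  fin_cases i
  · exact ((a 1).mul (b 2)).sub ((a 2).mul (b 1))
  · exact ((a 2).mul (b 0)).sub ((a 0).mul (b 2))
  · exact ((a 0).mul (b 1)).sub ((a 1).mul (b 0))

/-- The middle frame field determined by the curvature directions `e`, `n × e`, half the mean `-s`
and half the difference `κ` of the principal radii. -/
lemma IsLegendreOn.exists_coordFrame_of_principal (hE : Module.finrank ℝ E = 2) {D : Set E}
    {f n e : E → E3} (h : IsLegendreOn D f n) {s κ m₂ m₃ : E → ℝ} (se : ContDiffOn ℝ ∞ e D)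
    (ss : ContDiffOn ℝ ∞ s D) (sκ : ContDiffOn ℝ ∞ κ D) (sm₂ : ContDiffOn ℝ ∞ m₂ D)
    (sm₃ : ContDiffOn ℝ ∞ m₃ D) (κ0 : ∀ x ∈ D, 0 < κ x) (he : ∀ x ∈ D, ⟪e x, e x⟫_ℝ = 1)
    (hne : ∀ x ∈ D, ⟪n x, e x⟫_ℝ = 0)
    (h1 : ∀ x ∈ D, ∀ w, ⟪fderiv ℝ f x w + s x • fderiv ℝ n x w, e x⟫_ℝ
        = κ x * ⟪fderiv ℝ n x w, e x⟫_ℝ)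
    (h2 : ∀ x ∈ D, ∀ w, ⟪fderiv ℝ f x w + s x • fderiv ℝ n x w, cross (n x) (e x)⟫_ℝ
        = -(κ x * ⟪fderiv ℝ n x w, cross (n x) (e x)⟫_ℝ))
    (hds : ∀ x ∈ D, ∀ w, fderiv ℝ s x w = m₂ x * (κ x * ⟪fderiv ℝ n x w, e x⟫_ℝ)
      + m₃ x * -(κ x * ⟪fderiv ℝ n x w, cross (n x) (e x)⟫_ℝ)) :
    ∃ A : CoordFrame D, A.Along f n := by
  have sE := contDiffOn_cross h.smooth_n se
  have expand : ∀ x ∈ D, ∀ w, fderiv ℝ n x w = ⟪fderiv ℝ n x w, e x⟫_ℝ • e x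
      + ⟪fderiv ℝ n x w, cross (n x) (e x)⟫_ℝ • cross (n x) (e x) := by
    intro x hx w
    have := expansion_cross (h.inner_n hx) (he x hx) (hne x hx) (fderiv ℝ n x w)
    rwa [h.inner_fderiv_n hx, zero_smul, zero_add] at this
  have dn : ∀ x ∈ D, DifferentiableAt ℝ n x := fun x hx => h.differentiableAt_n hx
  have df : ∀ x ∈ D, DifferentiableAt ℝ f x := fun x hx => h.differentiableAt_f hx
  have dκ : ∀ x ∈ D, DifferentiableAt ℝ κ x := fun x hx =>
    CoordFrame.differentiableAt_of_contDiffOn sκ hx h.isOpen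
  have ds : ∀ x ∈ D, DifferentiableAt ℝ s x := fun x hx =>
    CoordFrame.differentiableAt_of_contDiffOn ss hx h.isOpen
  have spS : ∀ {c : E → E3} {r : E → ℝ}, ContDiffOn ℝ ∞ c D → ContDiffOn ℝ ∞ r D →
      ContDiffOn ℝ ∞ (fun x => spherePoint (c x) (r x)) D := fun hc hr =>
    spherePointLin.contDiff.comp_contDiffOn (hc.prodMk hr)
  have spL : ∀ (a b : ℝ) (c d : E3), spherePoint (a • c + b • d) 0
      = a • spherePoint c 0 + b • spherePoint d 0 := by
    intro a b c d
    rw [← spherePointLin_apply, ← spherePointLin_apply, ← spherePointLin_apply, ← map_smul,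
      ← map_smul, ← map_add]
    simp
  have sa : ∀ i, ContDiffOn ℝ ∞ (fun x => nullBasis (n x) (e x) (κ x) (m₂ x) (m₃ x) i) D := by
    intro i
    have c0 : ContDiffOn ℝ ∞ (fun _ : E => (0 : ℝ)) D := contDiffOn_const
    have c1 : ContDiffOn ℝ ∞ (fun _ : E => (1 : ℝ)) D := contDiffOn_const
    have c2 : ContDiffOn ℝ ∞ (fun _ : E => (1 / 2 : ℝ)) D := contDiffOn_const
    have z := spS h.smooth_n c1
    have z' := spS (h.smooth_n.const_smul (-(1 / 2 : ℝ))) c2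
    fin_cases i
    · exact sκ.smul z
    · exact (spS se c0).add (sm₂.smul z)
    · exact (spS sE c0).add (sm₃.smul z)
    · exact (sκ.inv fun x hx => (κ0 x hx).ne').smul (((z'.add (sm₂.smul (spS se c0))).add
        (sm₃.smul (spS sE c0))).add ((((sm₂.pow 2).add (sm₃.pow 2)).div_const 2).smul z))
  have d₀ : ∀ x ∈ D, ∀ w, fderiv ℝ (fun x => spherePoint (f x + s x • n x) (s x)) x w
      = (κ x * ⟪fderiv ℝ n x w, e x⟫_ℝ) • nullBasis (n x) (e x) (κ x) (m₂ x) (m₃ x) 1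
        + -(κ x * ⟪fderiv ℝ n x w, cross (n x) (e x)⟫_ℝ)
          • nullBasis (n x) (e x) (κ x) (m₂ x) (m₃ x) 2 := by
    intro x hx w
    rw [(hasFDerivAt_spherePoint ((df x hx).fun_add ((ds x hx).fun_smul (dn x hx))) (ds x hx) w).2]
    have e1 : fderiv ℝ (fun y => f y + s y • n y) x w
        = ((κ x * ⟪fderiv ℝ n x w, e x⟫_ℝ) • e x
          + -(κ x * ⟪fderiv ℝ n x w, cross (n x) (e x)⟫_ℝ) • cross (n x) (e x))
          + fderiv ℝ s x w • n x := by
      rw [((df x hx).hasFDerivAt.fun_add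
        ((ds x hx).hasFDerivAt.fun_smul (dn x hx).hasFDerivAt)).fderiv]
      have k := expansion_cross (h.inner_n hx) (he x hx) (hne x hx)
        (fderiv ℝ f x w + s x • fderiv ℝ n x w)
      rw [h1 x hx, h2 x hx, inner_add_left, inner_smul_left, h.inner_fderiv_n hx, h.contact x hx,
        mul_zero, add_zero, zero_smul, zero_add] at k
      rw [← k]
      simp only [add_apply, smul_apply, ContinuousLinearMap.smulRight_apply]
      rw [← add_assoc]
    have e2 := spherePoint_add_smul ((κ x * ⟪fderiv ℝ n x w, e x⟫_ℝ) • e x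
      + -(κ x * ⟪fderiv ℝ n x w, cross (n x) (e x)⟫_ℝ) • cross (n x) (e x)) (n x) 0
      (fderiv ℝ s x w)
    rw [zero_add] at e2
    rw [e1, ← e2, spL, hds x hx]
    simp only [nullBasis, Matrix.cons_val]
    module
  have d₁ : ∀ x ∈ D, ∀ w, fderiv ℝ (fun x => nullBasis (n x) (e x) (κ x) (m₂ x) (m₃ x) 0) x w
      = ((fderiv ℝ κ x w - m₂ x * (κ x * ⟪fderiv ℝ n x w, e x⟫_ℝ)
          + m₃ x * -(κ x * ⟪fderiv ℝ n x w, cross (n x) (e x)⟫_ℝ)) / κ x)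
          • nullBasis (n x) (e x) (κ x) (m₂ x) (m₃ x) 0
        + (κ x * ⟪fderiv ℝ n x w, e x⟫_ℝ) • nullBasis (n x) (e x) (κ x) (m₂ x) (m₃ x) 1
        - -(κ x * ⟪fderiv ℝ n x w, cross (n x) (e x)⟫_ℝ)
          • nullBasis (n x) (e x) (κ x) (m₂ x) (m₃ x) 2 := by
    intro x hx w
    have hb : ∀ᶠ y in nhds x, nullBasis (n y) (e y) (κ y) (m₂ y) (m₃ y) 0
        = κ y • spherePoint (n y) 1 := Filter.Eventually.of_forall fun y => rfl
    rw [hasFDerivAt_smul_spherePoint hb (dn x hx) (dκ x hx) w]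
    have e3 := spL ⟪fderiv ℝ n x w, e x⟫_ℝ ⟪fderiv ℝ n x w, cross (n x) (e x)⟫_ℝ (e x)
      (cross (n x) (e x))
    rw [← expand x hx] at e3
    rw [e3]
    have := (κ0 x hx).ne'
    simp only [nullBasis, Matrix.cons_val]
    rw [smul_smul (_ / κ x), div_mul_cancel₀ _ this]
    module
  have hinj : ∀ x ∈ D, ∀ w, κ x * ⟪fderiv ℝ n x w, e x⟫_ℝ = 0 →
      -(κ x * ⟪fderiv ℝ n x w, cross (n x) (e x)⟫_ℝ) = 0 → w = 0 := by
    intro x hx w h1 h2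
    have h1' := (mul_eq_zero.1 h1).resolve_left (κ0 x hx).ne'
    have h2' := (mul_eq_zero.1 (neg_eq_zero.1 h2)).resolve_left (κ0 x hx).ne'
    refine h.immersive x hx w ?_
    rw [expand x hx, h1', h2', zero_smul, zero_smul, add_zero]
  obtain ⟨A, hA0, hA⟩ := exists_coordFrame hE h.isOpen
    (a₀ := fun x => spherePoint (f x + s x • n x) (s x))
    (a := fun i x => nullBasis (n x) (e x) (κ x) (m₂ x) (m₃ x) i)
    (spS (h.smooth_f.add (ss.smul h.smooth_n)) ss) sa
    (fun x hx => isLaguerreBasis_nullBasis (h.inner_n hx) (he x hx) (hne x hx) (κ0 x hx) _ _)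
    d₀ d₁ hinj
  refine ⟨A, fun x hx => ?_⟩
  rw [hA0, hA]
  refine line_eq_of_eq (l := κ x * √2) (s := s x * √2)
    (mul_ne_zero (κ0 x hx).ne' (by positivity)) ?_ ?_
  · rw [planeNormal_eq_spherePoint, smul_smul, spherePoint_add_smul, mul_one_div,
      mul_div_cancel_right₀ _ (by positivity), zero_add]
  · rw [planeNormal_eq_spherePoint, smul_smul, mul_one_div,
      mul_div_cancel_right₀ _ (by positivity)]
    rfl

/-- Middle frames exist around every point at which `df` is not a multiple of `dn`. -/
theorem IsLegendreOn.exists_middle (hE : Module.finrank ℝ E = 2) {D : Set E} {f n : E → E3}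
    (h : IsLegendreOn D f n) {x₀ : E} (hx₀ : x₀ ∈ D) {u v : E}
    (huv : LinearIndependent ℝ ![u, v])
    (hpos : ∀ x ∈ D, 0 < skewSq f n u v x)
    (hr : fderiv ℝ f x₀ u + (-shapeTrace f n u v x₀ / 2) • fderiv ℝ n x₀ u
      + √(skewSq f n u v x₀) • fderiv ℝ n x₀ u ≠ 0) :
    ∃ D' ⊆ D, x₀ ∈ D' ∧ ∃ A : CoordFrame D', A.Along f n := by
  have : FiniteDimensional ℝ E := Module.finite_of_finrank_eq_succ hE
  have hspan : ∀ w, ∃ c d : ℝ, w = c • u + d • v := by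
    intro w
    have hs := huv.span_eq_top_of_card_eq_finrank' (by simp [hE])
    have hmem : w ∈ Submodule.span ℝ (Set.range ![u, v]) := by rw [hs]; trivial
    rw [Submodule.mem_span_range_iff_exists_fun] at hmem
    obtain ⟨c, hc⟩ := hmem
    rw [Fin.sum_univ_two] at hc
    exact ⟨c 0, c 1, hc.symm⟩
  set s : E → ℝ := fun x => -shapeTrace f n u v x / 2 with hs
  set κ : E → ℝ := fun x => √(skewSq f n u v x) with hκ
  set r : E → E3 := fun x => fderiv ℝ f x u + s x • fderiv ℝ n x u + κ x • fderiv ℝ n x u with hrdef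
  have ss : ContDiffOn ℝ ∞ s D := (h.smooth_shapeTrace huv).neg.div_const 2
  have sκ : ContDiffOn ℝ ∞ κ D := (h.smooth_skewSq huv).sqrt fun x hx => (hpos x hx).ne'
  have sf := fun w => contDiffOn_fderiv_apply h.isOpen h.smooth_f w
  have sn := fun w => contDiffOn_fderiv_apply h.isOpen h.smooth_n w
  have sr : ContDiffOn ℝ ∞ r D := ((sf u).add (ss.smul (sn u))).add (sκ.smul (sn u))
  set D' := D ∩ r ⁻¹' {0}ᶜ with hD'
  have hDD : D' ⊆ D := inter_subset_left
  have oD : IsOpen D' := sr.continuousOn.isOpen_inter_preimage h.isOpen isOpen_compl_singleton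
  have h' := h.mono oD hDD
  refine ⟨D', hDD, ⟨hx₀, hr⟩, ?_⟩
  have r0 : ∀ x ∈ D', ‖r x‖ ≠ 0 := fun x hx => norm_ne_zero_iff.2 hx.2
  have κ0 : ∀ x ∈ D', 0 < κ x := fun x hx => Real.sqrt_pos.2 (hpos x hx.1)
  set e : E → E3 := fun x => ‖r x‖⁻¹ • r x with he
  have he1 : ∀ x ∈ D', ⟪e x, e x⟫_ℝ = 1 := by
    intro x hx
    have := r0 x hx
    simp only [he, inner_smul_left, inner_smul_right, RCLike.conj_to_real,
      real_inner_self_eq_norm_sq]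
    field_simp
  have pd := fun x (hx : x ∈ D') => h'.principal_directions hx huv hspan (κ := κ x)
    (Real.sq_sqrt (hpos x hx.1).le) (he1 x hx) (l := ‖r x‖⁻¹) rfl
  have se : ContDiffOn ℝ ∞ e D' :=
    ((sr.mono hDD).norm ℝ fun x hx => norm_ne_zero_iff.1 (r0 x hx)).inv r0 |>.smul (sr.mono hDD)
  have sκ' := sκ.mono hDD
  have ss' := ss.mono hDD
  have sE := contDiffOn_cross h'.smooth_n se
  have sN := fun w => contDiffOn_fderiv_apply oD h'.smooth_n w
  set θ : E → E → ℝ := fun x w => κ x * ⟪fderiv ℝ n x w, e x⟫_ℝ with hθ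
  set η : E → E → ℝ := fun x w => -(κ x * ⟪fderiv ℝ n x w, cross (n x) (e x)⟫_ℝ) with hη
  have sθ : ∀ w, ContDiffOn ℝ ∞ (fun x => θ x w) D' := fun w => sκ'.mul ((sN w).inner ℝ se)
  have sη : ∀ w, ContDiffOn ℝ ∞ (fun x => η x w) D' := fun w => (sκ'.mul ((sN w).inner ℝ sE)).neg
  have expand : ∀ x ∈ D', ∀ w, fderiv ℝ n x w = ⟪fderiv ℝ n x w, e x⟫_ℝ • e x
      + ⟪fderiv ℝ n x w, cross (n x) (e x)⟫_ℝ • cross (n x) (e x) := by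
    intro x hx w
    have := expansion_cross (h'.inner_n hx) (he1 x hx) (pd x hx).1 (fderiv ℝ n x w)
    rwa [h'.inner_fderiv_n hx, zero_smul, zero_add] at this
  have hinj : ∀ x ∈ D', ∀ w, θ x w = 0 → η x w = 0 → w = 0 := by
    intro x hx w h1 h2
    have h1' := (mul_eq_zero.1 h1).resolve_left (κ0 x hx).ne'
    have h2' := (mul_eq_zero.1 (neg_eq_zero.1 h2)).resolve_left (κ0 x hx).ne'
    refine h'.immersive x hx w ?_
    rw [expand x hx, h1', h2', zero_smul, zero_smul, add_zero]
  have hθl : ∀ x, ∀ c d : ℝ, ∀ w w', θ x (c • w + d • w') = c * θ x w + d * θ x w' := by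
    intro x c d w w'
    simp only [hθ, map_add, map_smul, inner_add_left, inner_smul_left, RCLike.conj_to_real]; ring
  have hηl : ∀ x, ∀ c d : ℝ, ∀ w w', η x (c • w + d • w') = c * η x w + d * η x w' := by
    intro x c d w w'
    simp only [hη, map_add, map_smul, inner_add_left, inner_smul_left, RCLike.conj_to_real]; ring
  set J : E → ℝ := fun x => θ x u * η x v - θ x v * η x u with hJ
  have hJ0 : ∀ x ∈ D', J x ≠ 0 := by
    intro x hx h0
    rw [LinearIndependent.pair_iff] at huv
    simp only [hJ] at h0
    have k1 := huv (θ x v) (-θ x u) (hinj x hx _ (by rw [hθl]; ring)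
      (by rw [hηl]; linear_combination -h0))
    have k2 := huv (η x v) (-η x u) (hinj x hx _ (by rw [hθl]; linear_combination h0)
      (by rw [hηl]; ring))
    have hu := hinj x hx u (neg_eq_zero.1 k1.2) (neg_eq_zero.1 k2.2)
    exact one_ne_zero (huv 1 0 (by rw [hu]; simp)).1
  have sJ : ContDiffOn ℝ ∞ J D' := ((sθ u).mul (sη v)).sub ((sθ v).mul (sη u))
  have sds := fun w => contDiffOn_fderiv_apply oD ss' w
  -- the null rotation that removes the `a₁` component of `da₀`
  set m₂ : E → ℝ := fun x => (fderiv ℝ s x u * η x v - fderiv ℝ s x v * η x u) / J x with hm₂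
  set m₃ : E → ℝ := fun x => (θ x u * fderiv ℝ s x v - θ x v * fderiv ℝ s x u) / J x with hm₃
  have sm₂ : ContDiffOn ℝ ∞ m₂ D' :=
    (((sds u).mul (sη v)).sub ((sds v).mul (sη u))).div sJ hJ0
  have sm₃ : ContDiffOn ℝ ∞ m₃ D' :=
    (((sθ u).mul (sds v)).sub ((sθ v).mul (sds u))).div sJ hJ0
  have hds : ∀ x ∈ D', ∀ w, fderiv ℝ s x w = m₂ x * θ x w + m₃ x * η x w := by
    intro x hx w
    have := hJ0 x hx
    obtain ⟨c, d, rfl⟩ := hspan w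
    rw [hθl, hηl, map_add, map_smul, map_smul, smul_eq_mul, smul_eq_mul]
    simp only [hm₂, hm₃]
    field_simp
    simp only [hJ]
    ring
  exact h'.exists_coordFrame_of_principal hE se ss' sκ' sm₂ sm₃ κ0 he1 (fun x hx => (pd x hx).1)
    (fun x hx w => ((pd x hx).2 w).1) (fun x hx w => ((pd x hx).2 w).2) hds

/-- Frames exist near every point of a nondegenerate Legendre immersion. The adapted frame is built
from the image under `df + (r + κ) dn` of one vector of a basis, where `κ` is half the difference of
the principal radii; the image is non-zero for one of the two basis vectors, as the trace-free part
of the shape operator is not `-κ`. -/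
lemma IsLegendreOn.exists_coordFrame_along (hE : Module.finrank ℝ E = 2) {D : Set E} {f n : E → E3}
    (h : IsLegendreOn D f n) (hnd : ∀ x ∈ D, ∀ s : ℝ, ∃ w, fderiv ℝ f x w + s • fderiv ℝ n x w ≠ 0)
    {x₀ : E} (hx₀ : x₀ ∈ D) : ∃ D' ⊆ D, x₀ ∈ D' ∧ ∃ A : CoordFrame D', A.Along f n := by
  have : FiniteDimensional ℝ E := Module.finite_of_finrank_eq_succ hE
  set B := Module.finBasisOfFinrankEq ℝ E hE
  have huv : LinearIndependent ℝ ![B 0, B 1] := by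
    have := B.linearIndependent
    rwa [show (B : Fin 2 → E) = ![B 0, B 1] by ext i; fin_cases i <;> rfl] at this
  have hvu : LinearIndependent ℝ ![B 1, B 0] := LinearIndependent.pair_symm_iff.1 huv
  have hpos : ∀ x ∈ D, 0 < skewSq f n (B 0) (B 1) x := by
    intro x hx
    refine h.skewSq_pos hx huv fun s hs => ?_
    obtain ⟨w, hw⟩ := hnd x hx s
    refine hw ?_
    rw [← B.sum_repr w, Fin.sum_univ_two, map_add, map_add, map_smul, map_smul, map_smul, map_smul]
    have e : ∀ (c d : ℝ) (p q p' q' : E3), c • p + d • q + s • (c • p' + d • q')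
        = c • (p + s • p') + d • (q + s • q') := by intros; module
    rw [e, hs.1, hs.2, smul_zero, smul_zero, add_zero]
  by_cases h1 : fderiv ℝ f x₀ (B 0) + (-shapeTrace f n (B 0) (B 1) x₀ / 2) • fderiv ℝ n x₀ (B 0)
      + √(skewSq f n (B 0) (B 1) x₀) • fderiv ℝ n x₀ (B 0) = 0
  · refine h.exists_middle hE hx₀ hvu (fun x hx => by rw [skewSq_swap]; exact hpos x hx)
      fun h2 => ?_
    rw [shapeTrace_swap, skewSq_swap] at h2
    have hκ := Real.sqrt_pos.2 (hpos x₀ hx₀)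
    set κ := √(skewSq f n (B 0) (B 1) x₀)
    obtain ⟨a, b, c, k1, k2, -, -⟩ := h.exists_shape hx₀ huv
    have hli := LinearIndependent.pair_iff.1 (h.linearIndependent hx₀ huv)
    rw [k1] at h1
    rw [k2] at h2
    have l1 := hli (a + κ) b (by rw [← h1]; module)
    have l2 := hli c (-a + κ) (by rw [← h2]; module)
    linarith [l1.1, l2.2]
  · exact h.exists_middle hE hx₀ huv hpos h1

end Existence

/-- Around every point of a nondegenerate Legendre immersion there is a middle frame field. -/
theorem LegendreImmersion.exists_middleFrame {M : Type*} [TopologicalSpace M] [ChartedSpace E2 M]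
    [IsManifold (𝓡 2) ∞ M] {F : LegendreImmersion M} (hF : F.IsNondegenerate) (p : M) :
    ∃ A : MiddleFrame F, p ∈ A.dom := by
  have hz := isSmoothChart_chartAt p
  set z := chartAt E2 p
  have hp : p ∈ z.source := mem_chart_source E2 p
  have hL := F.isLegendreOn hz
  obtain ⟨D', -, hx, B, hB⟩ := hL.exists_coordFrame_along finrank_E2 (x₀ := z p) (by
    intro x hx s
    by_contra! h0
    have h1 := LinearIndependent.pair_iff.1 (hF (z.symm x)) 1 s
    refine one_ne_zero (h1 ?_).1
    funext w
    have hq := z.map_target hx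
    have hzx := z.right_inv hx
    have ef := hz.dAt_eq hq (g := F.f) (by rw [hzx]; exact hL.differentiableAt_f hx) w
    have en := hz.dAt_eq hq (g := F.n) (by rw [hzx]; exact hL.differentiableAt_n hx) w
    rw [hzx] at ef en
    have h2 := h0 (dAt z (z.symm x) w)
    rw [← ef, ← en] at h2
    have h3 := congrArg (fun y => ⟪y, dAt F.n (z.symm x) w⟫_ℝ) h2
    simp only [inner_add_left, inner_smul_left, RCLike.conj_to_real, inner_zero_left] at h3
    simpa using h3) (z.map_source hp)
  exact ⟨B.toMiddleFrame hz hB, hp, hx⟩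

/-! ### The first variation of the area of a spacelike surface -/

section AreaVariation

variable {E : Type*} [NormedAddCommGroup E] [NormedSpace ℝ E]

lemma fderiv_lorentz {g h : E → V4} {x : E} (hg : DifferentiableAt ℝ g x)
    (hh : DifferentiableAt ℝ h x) (w : E) :
    fderiv ℝ (fun y => lorentz (g y) (h y)) x w
      = lorentz (fderiv ℝ g x w) (h x) + lorentz (g x) (fderiv ℝ h x w) := by
  have hi : ∀ {g : E → V4}, DifferentiableAt ℝ g x → ∀ k, HasFDerivAt (fun y => g y k)
      ((ContinuousLinearMap.proj (R := ℝ) (φ := fun _ : Fin 4 => ℝ) k).comp (fderiv ℝ g x)) x :=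
    fun hg k => (hasFDerivAt_pi'.1 hg.hasFDerivAt) k
  have hd : HasFDerivAt (fun y => lorentz (g y) (h y)) _ x :=
    (((((hi hg 0).mul (hi hh 3)).add ((hi hg 3).mul (hi hh 0))).neg).add
      ((hi hg 1).mul (hi hh 1))).add ((hi hg 2).mul (hi hh 2))
  rw [hd.fderiv]
  simp [lorentz]
  ring

lemma fderiv_slice {G : Type*} [NormedAddCommGroup G] [NormedSpace ℝ G] {g : ℝ × E → G} {t : ℝ}
    {x : E} (hg : DifferentiableAt ℝ g (t, x)) (w : E) :
    fderiv ℝ (fun y => g (t, y)) x w = fderiv ℝ g (t, x) (0, w) := by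
  have := hg.hasFDerivAt.comp x ((hasFDerivAt_const t x).prodMk (hasFDerivAt_id x))
  have h2 : HasFDerivAt (fun y => g (t, y)) _ x := this
  rw [h2.fderiv]
  simp

lemma hasDerivAt_slice {G : Type*} [NormedAddCommGroup G] [NormedSpace ℝ G] {g : ℝ × E → G} {t : ℝ}
    {x : E} (hg : DifferentiableAt ℝ g (t, x)) :
    HasDerivAt (fun r => g (r, x)) (fderiv ℝ g (t, x) (1, 0)) t := by
  have := hg.hasFDerivAt.comp_hasDerivAt t ((hasDerivAt_id t).prodMk (hasDerivAt_const t x))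
  exact this

/-- The Gram determinant of the induced metric of `X` on the pair `u`, `v`. -/
def gramDet (X : E → V4) (u v x : E) : ℝ :=
  lorentz (fderiv ℝ X x u) (fderiv ℝ X x u) * lorentz (fderiv ℝ X x v) (fderiv ℝ X x v)
    - lorentz (fderiv ℝ X x u) (fderiv ℝ X x v) ^ 2

/-- The `u` component of the gradient of `X` for the induced metric, times the area density. -/
def conjugateField (X : E → V4) (u v x : E) : V4 :=
  (√(gramDet X u v x))⁻¹ • (lorentz (fderiv ℝ X x v) (fderiv ℝ X x v) • fderiv ℝ X x u
    - lorentz (fderiv ℝ X x u) (fderiv ℝ X x v) • fderiv ℝ X x v)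

/-- The Laplacian of `X` for the induced metric, times the area density. -/
def laplaceDensity (X : E → V4) (u v x : E) : V4 :=
  fderiv ℝ (conjugateField X u v) x u + fderiv ℝ (conjugateField X v u) x v

lemma gramDet_swap (X : E → V4) (u v x : E) : gramDet X v u x = gramDet X u v x := by
  rw [gramDet, gramDet, lorentz_comm (fderiv ℝ X x v) (fderiv ℝ X x u)]
  ring

lemma smooth_conjugateField {X : E → V4} {D : Set E} (hD : IsOpen D) (hX : ContDiffOn ℝ ∞ X D)
    {u v : E} (hpos : ∀ x ∈ D, 0 < gramDet X u v x) : ContDiffOn ℝ ∞ (conjugateField X u v) D := by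
  have s := fun w => contDiffOn_fderiv_apply hD hX w
  have g := fun w w' => contDiffOn_lorentz (s w) (s w')
  have sg : ContDiffOn ℝ ∞ (gramDet X u v) D := ((g u u).mul (g v v)).sub ((g u v).pow 2)
  exact ((sg.sqrt fun x hx => (hpos x hx).ne').inv
    fun x hx => (Real.sqrt_pos.2 (hpos x hx)).ne').smul
    (((g v v).smul (s u)).sub ((g u v).smul (s v)))

/-- The pointwise first variation formula. -/
lemma fderiv_area {X : ℝ × E → V4} {W : ℝ × E → ℝ} {x u v : E} (hX : ContDiffAt ℝ ∞ X (0, x))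
    (hW : DifferentiableAt ℝ W (0, x))
    (hWX : ∀ᶠ y in nhds ((0 : ℝ), x), W y ^ 2 = gramDet X (0, u) (0, v) y) (hpos : 0 < W (0, x)) :
    fderiv ℝ W (0, x) (1, 0)
      = lorentz (conjugateField (fun y => X (0, y)) u v x)
          (fderiv ℝ (fun y => fderiv ℝ X (0, y) (1, 0)) x u)
        + lorentz (conjugateField (fun y => X (0, y)) v u x)
          (fderiv ℝ (fun y => fderiv ℝ X (0, y) (1, 0)) x v) := by
  have dX : DifferentiableAt ℝ X (0, x) := hX.differentiableAt (by simp)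
  have ddX : ∀ w : ℝ × E, DifferentiableAt ℝ (fun y => fderiv ℝ X y w) (0, x) := fun w =>
    ((hX.fderiv_right (m := 1) (by norm_cast)).differentiableAt (by simp)).clm_apply
      (differentiableAt_const w)
  have hV : ∀ w : E, fderiv ℝ (fun y => fderiv ℝ X (0, y) (1, 0)) x w
      = fderiv ℝ (fun y => fderiv ℝ X y (0, w)) (0, x) (1, 0) := by
    intro w
    rw [fderiv_slice (ddX (1, 0)) w, fderiv_fderiv_comm hX (1, 0) (0, w)]
  have hg : gramDet (fun y => X (0, y)) u v x = gramDet X (0, u) (0, v) (0, x) := by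
    simp only [gramDet, fderiv_slice dX]
  have hw : √(gramDet (fun y => X (0, y)) u v x) = W (0, x) := by
    rw [hg, ← hWX.self_of_nhds, Real.sqrt_sq hpos.le]
  have key := congrArg (fun T => T ((1 : ℝ), (0 : E))) (Filter.EventuallyEq.fderiv_eq (𝕜 := ℝ) hWX)
  rw [(hW.hasFDerivAt.pow 2).fderiv] at key
  have dg := fun w w' : ℝ × E => (show DifferentiableAt ℝ
    (fun y => lorentz (fderiv ℝ X y w) (fderiv ℝ X y w')) (0, x) from
    ((contDiffOn_lorentz (D := univ) (g := fun y : V4 × V4 => y.1) (h := fun y => y.2)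
      contDiffOn_fst contDiffOn_snd).contDiffAt Filter.univ_mem |>.differentiableAt (by simp)).comp
        (0, x) ((ddX w).prodMk (ddX w')))
  have e : fderiv ℝ (gramDet X (0, u) (0, v)) (0, x) (1, 0) = _ :=
    congrArg (fun T => T ((1 : ℝ), (0 : E))) (((dg (0, u) (0, u)).hasFDerivAt.mul
      (dg (0, v) (0, v)).hasFDerivAt).sub ((dg (0, u) (0, v)).hasFDerivAt.pow 2)).fderiv
  rw [e] at key
  simp only [add_apply, smul_apply, sub_apply, smul_eq_mul, fderiv_lorentz (ddX _) (ddX _), ← hV]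
    at key
  simp only [conjugateField, gramDet_swap _ u v, hw, fderiv_slice dX, lorentz_smul_left,
    lorentz_sub_left]
  have hp := hpos.ne'
  simp only [lorentz_comm (fderiv ℝ (fun y => fderiv ℝ X (0, y) (1, 0)) x _)] at key
  rw [lorentz_comm (fderiv ℝ X (0, x) (0, v)) (fderiv ℝ X (0, x) (0, u))]
  field_simp
  norm_num at key
  linear_combination key / 2

end AreaVariation

section Integral

open MeasureTheory

variable {E : Type*} [NormedAddCommGroup E] [NormedSpace ℝ E] [FiniteDimensional ℝ E]
  [MeasurableSpace E] [BorelSpace E] {μ : Measure E} [μ.IsAddHaarMeasure]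

/-- The integral of the derivative of a function with compact support vanishes. The function is
only given on an open set that contains the support. -/
lemma integral_fderiv_eq_zero {D K : Set E} (hD : IsOpen D) (hK : IsCompact K) (hKD : K ⊆ D)
    {g : E → ℝ} (hg : ContDiffOn ℝ ∞ g D) (h0 : ∀ x ∈ D \ K, g x = 0) (w : E) :
    ∫ x in K, fderiv ℝ g x w ∂μ = 0 := by
  classical
  set G : E → ℝ := fun x => if x ∈ K then g x else 0 with hG
  have hGD : ∀ x ∈ D, G =ᶠ[nhds x] g := by
    intro x hx
    filter_upwards [hD.mem_nhds hx] with y hy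
    by_cases hyK : y ∈ K
    · simp [hG, hyK]
    · simp [hG, hyK, h0 y ⟨hy, hyK⟩]
  have hGK : ∀ x ∉ K, G =ᶠ[nhds x] fun _ => 0 := by
    intro x hx
    filter_upwards [hK.isClosed.isOpen_compl.mem_nhds hx] with y hy
    simp only [hG]
    exact if_neg hy
  have smooth : ContDiff ℝ ∞ G := by
    rw [contDiff_iff_contDiffAt]
    intro x
    by_cases hx : x ∈ K
    · exact (hg.contDiffAt (hD.mem_nhds (hKD hx))).congr_of_eventuallyEq (hGD x (hKD hx))
    · exact contDiffAt_const.congr_of_eventuallyEq (hGK x hx)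
  have hsupp : HasCompactSupport G := HasCompactSupport.intro hK fun x hx => if_neg hx
  have e1 : ∫ x in K, fderiv ℝ g x w ∂μ = ∫ x in K, fderiv ℝ G x w ∂μ :=
    setIntegral_congr_fun hK.measurableSet fun x hx => by rw [(hGD x (hKD hx)).fderiv_eq]
  have e2 : ∫ x in K, fderiv ℝ G x w ∂μ = ∫ x, fderiv ℝ G x w ∂μ := by
    refine setIntegral_eq_integral_of_forall_compl_eq_zero fun x hx => ?_
    rw [(hGK x hx).fderiv_eq]
    simp
  have hc : Continuous fun x => fderiv ℝ G x w := (smooth.continuous_fderiv (by simp)).clm_apply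
    continuous_const
  have hi : Integrable (fun x => fderiv ℝ G x w) μ :=
    hc.integrable_of_hasCompactSupport (hsupp.fderiv_apply (𝕜 := ℝ) w)
  have hi' : Integrable G μ := smooth.continuous.integrable_of_hasCompactSupport hsupp
  have := integral_mul_fderiv_eq_neg_fderiv_mul_of_integrable (μ := μ) (f := fun _ : E => (1 : ℝ))
    (g := G) (v := w) (by simp) (by simpa using hi) (by simpa using hi')
    (fun x _ => differentiableAt_const _) (fun x _ => smooth.differentiable (by simp) x)
  rw [e1, e2]
  simpa using this

omit [FiniteDimensional ℝ E] in
/-- Differentiation under the integral sign over a compact set. -/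
lemma hasDerivAt_setIntegral {D K : Set E} (hD : IsOpen D) (hK : IsCompact K) (hKD : K ⊆ D)
    {ε : ℝ} (hε : 0 < ε) {W : ℝ × E → ℝ} (hW : ContDiffOn ℝ ∞ W (Ioo (-ε) ε ×ˢ D)) :
    HasDerivAt (fun t => ∫ x in K, W (t, x) ∂μ) (∫ x in K, fderiv ℝ W (0, x) (1, 0) ∂μ) 0 := by
  have hO : IsOpen (Ioo (-ε) ε ×ˢ D) := isOpen_Ioo.prod hD
  have sub : Icc (-(ε / 2)) (ε / 2) ×ˢ K ⊆ Ioo (-ε) ε ×ˢ D := by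
    refine prod_mono (fun t ht => ⟨?_, ?_⟩) hKD <;> linarith [ht.1, ht.2]
  have hc : ContinuousOn (fun y => fderiv ℝ W y (1, 0)) (Ioo (-ε) ε ×ˢ D) :=
    (contDiffOn_fderiv_apply hO hW (1, 0)).continuousOn
  have h0 : (0 : ℝ) ∈ Ioo (-(ε / 2)) (ε / 2) := ⟨by linarith, by linarith⟩
  obtain ⟨C, hC⟩ := (isCompact_Icc.prod hK).exists_bound_of_continuousOn (hc.mono sub)
  have sl : ∀ t ∈ Ioo (-ε) ε, ∀ x ∈ K, ((t, x) : ℝ × E) ∈ Ioo (-ε) ε ×ˢ D :=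
    fun t ht x hx => ⟨ht, hKD hx⟩
  have cont : ∀ t ∈ Ioo (-ε) ε, ContinuousOn (fun x => W (t, x)) K := fun t ht =>
    hW.continuousOn.comp (by fun_prop) (sl t ht)
  have hm : Ioo (-ε) ε ∈ nhds (0 : ℝ) := Ioo_mem_nhds (by linarith) hε
  have c' : ContinuousOn (fun x => fderiv ℝ W (0, x) (1, 0)) K :=
    hc.comp (f := fun x : E => ((0 : ℝ), x)) (by fun_prop) (sl 0 (mem_of_mem_nhds hm))
  refine (hasDerivAt_integral_of_dominated_loc_of_deriv_le (μ := μ.restrict K)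
    (F := fun t x => W (t, x)) (F' := fun t x => fderiv ℝ W (t, x) (1, 0)) (bound := fun _ => C)
    (isOpen_Ioo.mem_nhds h0) ?_ ?_ ?_ ?_ ?_ ?_).2
  · filter_upwards [hm] with t ht
    exact (cont t ht).aestronglyMeasurable hK.measurableSet
  · exact (cont 0 (mem_of_mem_nhds hm)).integrableOn_compact hK
  · exact c'.aestronglyMeasurable hK.measurableSet
  · refine (ae_restrict_iff' hK.measurableSet).2 (Filter.Eventually.of_forall fun x hx t ht => ?_)
    exact hC (t, x) ⟨⟨ht.1.le, ht.2.le⟩, hx⟩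
  · exact (continuousOn_const (c := C)).integrableOn_compact hK
  · refine (ae_restrict_iff' hK.measurableSet).2 (Filter.Eventually.of_forall fun x hx t ht => ?_)
    exact hasDerivAt_slice ((hW.contDiffAt (hO.mem_nhds (sl t ⟨by linarith [ht.1],
      by linarith [ht.2]⟩ x hx))).differentiableAt (by simp))

/-- The first variation formula for the area of a spacelike surface in Minkowski space. -/
theorem hasDerivAt_area {D K : Set E} (hD : IsOpen D) (hK : IsCompact K) (hKD : K ⊆ D)
    {ε : ℝ} (hε : 0 < ε) {X : ℝ × E → V4} {W : ℝ × E → ℝ} {u v : E}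
    (hX : ContDiffOn ℝ ∞ X (Ioo (-ε) ε ×ˢ D)) (hW : ContDiffOn ℝ ∞ W (Ioo (-ε) ε ×ˢ D))
    (hWX : ∀ y ∈ Ioo (-ε) ε ×ˢ D, W y ^ 2 = gramDet X (0, u) (0, v) y)
    (hpos : ∀ x ∈ D, 0 < W (0, x))
    (hsupp : ∀ t ∈ Ioo (-ε) ε, ∀ x ∈ D \ K, X (t, x) = X (0, x)) :
    HasDerivAt (fun t => ∫ x in K, W (t, x) ∂μ)
      (-∫ x in K, lorentz (laplaceDensity (fun y => X (0, y)) u v x) (fderiv ℝ X (0, x) (1, 0)) ∂μ)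
      0 := by
  have h := hasDerivAt_setIntegral (μ := μ) hD hK hKD hε hW
  have hO : IsOpen (Ioo (-ε) ε ×ˢ D) := isOpen_Ioo.prod hD
  have hm : (0 : ℝ) ∈ Ioo (-ε) ε := ⟨by linarith, hε⟩
  have hmem : ∀ x ∈ D, ((0 : ℝ), x) ∈ Ioo (-ε) ε ×ˢ D := fun x hx => ⟨hm, hx⟩
  set X₀ : E → V4 := fun y => X (0, y) with hX₀
  set V : E → V4 := fun x => fderiv ℝ X (0, x) (1, 0) with hV
  have dX : ∀ x ∈ D, DifferentiableAt ℝ X (0, x) := fun x hx =>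
    (hX.contDiffAt (hO.mem_nhds (hmem x hx))).differentiableAt (by simp)
  have ins : ContDiff ℝ ∞ fun x : E => ((0 : ℝ), x) := contDiff_const.prodMk contDiff_id
  have sX₀ : ContDiffOn ℝ ∞ X₀ D := hX.comp ins.contDiffOn hmem
  have sV : ContDiffOn ℝ ∞ V D :=
    (contDiffOn_fderiv_apply hO hX (1, 0)).comp ins.contDiffOn hmem
  have hpos' : ∀ x ∈ D, 0 < gramDet X₀ u v x := by
    intro x hx
    have e : gramDet X₀ u v x = gramDet X (0, u) (0, v) (0, x) := by
      simp only [gramDet, hX₀, fderiv_slice (dX x hx)]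
    rw [e, ← hWX _ (hmem x hx)]
    have := hpos x hx
    positivity
  have sY₁ := smooth_conjugateField hD sX₀ hpos'
  have sY₂ := smooth_conjugateField hD sX₀ (u := v) (v := u)
    fun x hx => by rw [gramDet_swap]; exact hpos' x hx
  have V0 : ∀ x ∈ D \ K, V x = 0 := by
    intro x hx
    have h1 := hasDerivAt_slice (dX x hx.1)
    have h2 : (fun r => X (r, x)) =ᶠ[nhds 0] fun _ => X (0, x) := by
      filter_upwards [isOpen_Ioo.mem_nhds hm] with t ht using hsupp t ht x hx
    exact h1.unique ((hasDerivAt_const 0 (X (0, x))).congr_of_eventuallyEq h2)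
  have b₁ := integral_fderiv_eq_zero (μ := μ) hD hK hKD (contDiffOn_lorentz sY₁ sV)
    (fun x hx => by rw [V0 x hx, lorentz_zero_right]) u
  have b₂ := integral_fderiv_eq_zero (μ := μ) hD hK hKD (contDiffOn_lorentz sY₂ sV)
    (fun x hx => by rw [V0 x hx, lorentz_zero_right]) v
  have i₁ := ((contDiffOn_fderiv_apply hD (contDiffOn_lorentz sY₁ sV) u).continuousOn.mono
    hKD).integrableOn_compact (μ := μ) hK
  have i₂ := ((contDiffOn_fderiv_apply hD (contDiffOn_lorentz sY₂ sV) v).continuousOn.mono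
    hKD).integrableOn_compact (μ := μ) hK
  have i₃ := ((contDiffOn_lorentz ((contDiffOn_fderiv_apply hD sY₁ u).add
    (contDiffOn_fderiv_apply hD sY₂ v)) sV).continuousOn.mono hKD).integrableOn_compact (μ := μ) hK
  convert h using 1
  have e : ∫ x in K, fderiv ℝ W (0, x) (1, 0) ∂μ
      = ∫ x in K, (fderiv ℝ (fun y => lorentz (conjugateField X₀ u v y) (V y)) x u
        + fderiv ℝ (fun y => lorentz (conjugateField X₀ v u y) (V y)) x v)
        - lorentz (laplaceDensity X₀ u v x) (V x) ∂μ := by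
    refine setIntegral_congr_fun hK.measurableSet fun x hx => ?_
    have hx := hKD hx
    have dd : ∀ {g : E → V4}, ContDiffOn ℝ ∞ g D → DifferentiableAt ℝ g x := fun hg =>
      CoordFrame.differentiableAt_of_contDiffOn hg hx hD
    have := fderiv_area (u := u) (v := v) (hX.contDiffAt (hO.mem_nhds (hmem x hx)))
      ((hW.contDiffAt (hO.mem_nhds (hmem x hx))).differentiableAt (by simp))
      (by filter_upwards [hO.mem_nhds (hmem x hx)] with y hy using hWX y hy) (hpos x hx)
    rw [fderiv_lorentz (dd sY₁) (dd sV), fderiv_lorentz (dd sY₂) (dd sV), laplaceDensity,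
      lorentz_add_left]
    linear_combination this
  have z : ∫ x in K, (fderiv ℝ (fun y => lorentz (conjugateField X₀ u v y) (V y)) x u
      + fderiv ℝ (fun y => lorentz (conjugateField X₀ v u y) (V y)) x v) ∂μ = 0 :=
    (integral_add i₁ i₂).trans (by rw [b₁, b₂, add_zero])
  rw [e]
  exact (zero_sub _).symm.trans ((congrArg (fun t => t - _) z.symm).trans
    (integral_sub (i₁.add i₂) i₃).symm)

end Integral

/-! ### The middle sphere map and the Euler–Lagrange expression -/

section MiddleSphere

variable {E : Type*} [NormedAddCommGroup E] [NormedSpace ℝ E]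

lemma laplaceDensity_congr {X Y : E → V4} {x : E} (h : X =ᶠ[nhds x] Y) (u v : E) :
    laplaceDensity X u v x = laplaceDensity Y u v x := by
  have h1 : ∀ w, (fun y => fderiv ℝ X y w) =ᶠ[nhds x] fun y => fderiv ℝ Y y w := fun w => by
    filter_upwards [h.fderiv (𝕜 := ℝ)] with y hy
    rw [hy]
  have h2 : ∀ u v : E, conjugateField X u v =ᶠ[nhds x] conjugateField Y u v := by
    intro u v
    filter_upwards [h1 u, h1 v] with y hu hv
    simp only [conjugateField, gramDet, hu, hv]
  rw [laplaceDensity, laplaceDensity, (h2 u v).fderiv_eq, (h2 v u).fderiv_eq]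

namespace CoordFrame

variable {D : Set E} (A : CoordFrame D)

lemma lorentz_d_a₀ {x : E} (hx : x ∈ D) (u v : E) :
    lorentz (fderiv ℝ A.a₀ x u) (fderiv ℝ A.a₀ x v) = A.θ x u * A.θ x v + A.η x u * A.η x v := by
  obtain ⟨-, -, -, -, h11, h12, -, h22, -, -⟩ := (A.basis x hx).products
  obtain ⟨-, -, -, h21, -, -⟩ := (A.basis x hx).products'
  rw [A.d_a₀ x hx, A.d_a₀ x hx]
  simp only [lorentz_add_left, lorentz_add_right, lorentz_smul_left, lorentz_smul_right, h11, h12,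
    h22, h21]
  ring

lemma gramDet_eq {x : E} (hx : x ∈ D) (u v : E) : gramDet A.a₀ u v x = A.area x u v ^ 2 := by
  simp only [gramDet, A.lorentz_d_a₀ hx, area]
  ring

lemma smooth_area (u v : E) : ContDiffOn ℝ ∞ (fun x => A.area x u v) D :=
  ((A.smooth_θ u).mul (A.smooth_η v)).sub ((A.smooth_θ v).mul (A.smooth_η u))

/-- The middle sphere map has Laplacian `P a₁`. -/
theorem laplaceDensity_eq {x : E} (hx : x ∈ D) {u v : E} (h0 : A.area x u v ≠ 0) :
    laplaceDensity A.a₀ u v x = (√(gramDet A.a₀ u v x) * A.P x) • A.a 0 x := by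
  have hD := A.isOpen.mem_nhds hx
  have dθ := fun w => differentiableAt_of_contDiffOn (A.smooth_θ w) hx A.isOpen
  have dη := fun w => differentiableAt_of_contDiffOn (A.smooth_η w) hx A.isOpen
  have da := fun i => differentiableAt_of_contDiffOn (A.smooth_a i) hx A.isOpen
  -- the orientation of the coframe is locally constant
  obtain ⟨σ, hσ, hJ⟩ : ∃ σ : ℝ, σ ^ 2 = 1 ∧
      ∀ᶠ y in nhds x, A.area y u v ≠ 0 ∧ √(gramDet A.a₀ u v y) = σ * A.area y u v := by
    have hc : ContinuousAt (fun y => A.area y u v) x :=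
      (A.smooth_area u v).continuousOn.continuousAt hD
    rcases lt_or_gt_of_ne h0 with h | h
    · refine ⟨-1, by norm_num, ?_⟩
      filter_upwards [hc.eventually (gt_mem_nhds h), hD] with y hy hyD
      refine ⟨hy.ne, ?_⟩
      rw [A.gramDet_eq hyD, Real.sqrt_sq_eq_abs, abs_of_neg hy]
      ring
    · refine ⟨1, by norm_num, ?_⟩
      filter_upwards [hc.eventually (lt_mem_nhds h), hD] with y hy hyD
      refine ⟨hy.ne', ?_⟩
      rw [A.gramDet_eq hyD, Real.sqrt_sq_eq_abs, abs_of_pos hy]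
      ring
  have hσ0 : σ ≠ 0 := by
    rintro rfl
    norm_num at hσ
  have hσi : σ⁻¹ = σ := by
    field_simp
    exact hσ.symm
  have Yu : conjugateField A.a₀ u v =ᶠ[nhds x]
      fun y => σ • (A.η y v • A.a 1 y - A.θ y v • A.a 2 y) := by
    filter_upwards [hJ, hD] with y hy hyD
    rw [conjugateField, hy.2, A.lorentz_d_a₀ hyD, A.lorentz_d_a₀ hyD, A.d_a₀ y hyD, A.d_a₀ y hyD,
      mul_inv, hσi, mul_smul]
    congr 1
    rw [inv_smul_eq_iff₀ hy.1, area]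
    module
  have Yv : conjugateField A.a₀ v u =ᶠ[nhds x]
      fun y => σ • (A.θ y u • A.a 2 y - A.η y u • A.a 1 y) := by
    filter_upwards [hJ, hD] with y hy hyD
    rw [conjugateField, gramDet_swap, hy.2, A.lorentz_d_a₀ hyD, A.lorentz_d_a₀ hyD, A.d_a₀ y hyD,
      A.d_a₀ y hyD, mul_inv, hσi, mul_smul]
    congr 1
    rw [inv_smul_eq_iff₀ hy.1, area]
    module
  have ex : ∀ {g h : E → ℝ} {b c : E → V4}, DifferentiableAt ℝ g x → DifferentiableAt ℝ h x →
      DifferentiableAt ℝ b x → DifferentiableAt ℝ c x → ∀ w,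
      fderiv ℝ (fun y => σ • (g y • b y - h y • c y)) x w
        = σ • ((g x • fderiv ℝ b x w + fderiv ℝ g x w • b x)
          - (h x • fderiv ℝ c x w + fderiv ℝ h x w • c x)) := by
    intro g h b c hg hh hb hc w
    have hd : HasFDerivAt (fun y => σ • (g y • b y - h y • c y)) _ x :=
      ((hg.hasFDerivAt.fun_smul hb.hasFDerivAt).fun_sub
        (hh.hasFDerivAt.fun_smul hc.hasFDerivAt)).const_smul σ
    rw [hd.fderiv]
    simp
  obtain ⟨s1, s2, -⟩ := A.structure_equations hx u v
  rw [laplaceDensity, Yu.fderiv_eq, Yv.fderiv_eq, ex (dη v) (dθ v) (da 1) (da 2),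
    ex (dθ u) (dη u) (da 2) (da 1), hJ.self_of_nhds.2]
  have s1' : fderiv ℝ (fun y => A.θ y v) x u
      = fderiv ℝ (fun y => A.θ y u) x v + A.q₁ x * A.area x u v := by linear_combination s1
  have s2' : fderiv ℝ (fun y => A.η y v) x u
      = fderiv ℝ (fun y => A.η y u) x v + A.q₂ x * A.area x u v := by linear_combination s2
  rw [s1', s2', A.d_a x hx, A.d_a x hx, A.d_a x hx, A.d_a x hx]
  simp only [Fin.sum_univ_four, connMatrix, Matrix.of_apply, Matrix.cons_val, P, area]
  module

end CoordFrame

/-- The sphere of the contact element `(f, n)` whose radius is, up to sign, the mean of the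
principal radii. -/
def middleSphere (f n : E → E3) (u v x : E) : V4 :=
  spherePoint (f x + (-shapeTrace f n u v x / 2) • n x) (-shapeTrace f n u v x / 2)

/-- The induced metric of the middle sphere map is conformal to `dn · dn`. -/
lemma IsLegendreOn.gramDet_middleSphere {D : Set E} {f n : E → E3} (h : IsLegendreOn D f n) {x : E}
    (hx : x ∈ D) {u v : E} (huv : LinearIndependent ℝ ![u, v]) :
    gramDet (middleSphere f n u v) u v x = skewSq f n u v x ^ 2 * thirdDet n u v x := by
  have df := h.differentiableAt_f hx
  have dn := h.differentiableAt_n hx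
  have ds := CoordFrame.differentiableAt_of_contDiffOn
    ((h.smooth_shapeTrace huv).neg.div_const 2) hx h.isOpen
  set s : E → ℝ := fun y => -shapeTrace f n u v y / 2 with hs
  have hd : ∀ w, fderiv ℝ (middleSphere f n u v) x w
      = spherePoint (fderiv ℝ f x w + s x • fderiv ℝ n x w) 0
        + fderiv ℝ s x w • spherePoint (n x) 1 := by
    intro w
    have e := (hasFDerivAt_spherePoint (df.fun_add (ds.fun_smul dn)) ds w).2
    refine e.trans ?_
    rw [spherePoint_add_smul, (df.hasFDerivAt.fun_add
      (ds.hasFDerivAt.fun_smul dn.hasFDerivAt)).fderiv]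
    congr 1
    · simp
      abel
    · simp
  have o : ∀ w, ⟪fderiv ℝ f x w + s x • fderiv ℝ n x w, n x⟫_ℝ = 0 := fun w => by
    rw [inner_add_left, inner_smul_left, h.contact x hx, h.inner_fderiv_n hx]
    simp
  have hl : ∀ w w', lorentz (fderiv ℝ (middleSphere f n u v) x w)
      (fderiv ℝ (middleSphere f n u v) x w')
      = ⟪fderiv ℝ f x w + s x • fderiv ℝ n x w, fderiv ℝ f x w' + s x • fderiv ℝ n x w'⟫_ℝ := by
    intro w w'
    have o' := o w'
    rw [real_inner_comm] at o'
    simp only [hd, lorentz_add_left, lorentz_add_right, lorentz_smul_left, lorentz_smul_right,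
      lorentz_spherePoint, o, o', h.inner_n hx]
    ring
  obtain ⟨c1, c2, c3⟩ := h.conformal hx huv
  rw [gramDet, hl, hl, hl, c1, c2, c3, thirdDet]
  ring

/-- The position vector of a middle frame is the middle sphere. -/
lemma CoordFrame.Along.radius_eq {D : Set E} {A : CoordFrame D} {f n : E → E3} (hA : A.Along f n)
    (h : IsLegendreOn D f n) {x : E} (hx : x ∈ D) {u v : E} (huv : LinearIndependent ℝ ![u, v]) :
    A.radius x = -shapeTrace f n u v x / 2 := by
  have hpos := h.thirdDet_pos hx huv
  have hl := A.scale_pos hx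
  have F := fun v w => hA.forms h hx v w
  have e : shapeTrace f n u v x * thirdDet n u v x = _ := div_mul_cancel₀ _ hpos.ne'
  have key : A.scale x ^ 3 * ((shapeTrace f n u v x + 2 * A.radius x) * thirdDet n u v x) = 0 := by
    rw [add_mul, e, thirdDet]
    have a11 := (F u u).2.1
    have a12 := (F u v).2.1
    have a22 := (F v v).2.1
    have b11 := (F u u).2.2
    have b12 := (F u v).2.2
    have b22 := (F v v).2.2
    have hs := h.symm hx u v
    simp only [inner_add_left, inner_smul_left, RCLike.conj_to_real] at b11 b12 b22
    rw [← hs]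
    generalize A.scale x = l at *
    generalize A.radius x = r at *
    generalize ⟪fderiv ℝ n x u, fderiv ℝ n x u⟫_ℝ = g11 at *
    generalize ⟪fderiv ℝ n x u, fderiv ℝ n x v⟫_ℝ = g12 at *
    generalize ⟪fderiv ℝ n x v, fderiv ℝ n x v⟫_ℝ = g22 at *
    generalize ⟪fderiv ℝ f x u, fderiv ℝ n x u⟫_ℝ = h11 at *
    generalize ⟪fderiv ℝ f x u, fderiv ℝ n x v⟫_ℝ = h12 at *
    generalize ⟪fderiv ℝ f x v, fderiv ℝ n x v⟫_ℝ = h22 at *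
    have : l ^ 3 * (h11 * g22 - h12 * g12 - h12 * g12 + h22 * g11 + 2 * r * (g11 * g22 - g12 ^ 2))
        = (l * (h11 + r * g11)) * (l ^ 2 * g22) - 2 * (l * (h12 + r * g12)) * (l ^ 2 * g12)
          + (l * (h22 + r * g22)) * (l ^ 2 * g11) := by ring
    rw [this, ← a11, ← a12, ← a22, ← b11, ← b12, ← b22]
    ring
  have h2 := (mul_eq_zero.1 ((mul_eq_zero.1 key).resolve_left (by positivity))).resolve_right
    hpos.ne'
  linarith

/-- The middle sphere map of a surface with a middle frame: its induced metric is nondegenerate,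
and its Laplacian is `P a₁`. -/
lemma CoordFrame.Along.middleSphere_laplaceDensity (hE : Module.finrank ℝ E = 2) {D : Set E}
    {A : CoordFrame D} {f n : E → E3} (hA : A.Along f n) (h : IsLegendreOn D f n) {x : E}
    (hx : x ∈ D) {u v : E} (huv : LinearIndependent ℝ ![u, v]) :
    0 < skewSq f n u v x ∧ laplaceDensity (middleSphere f n u v) u v x
      = (√(gramDet A.a₀ u v x) * A.P x) • A.a 0 x := by
  have e : middleSphere f n u v =ᶠ[nhds x] A.a₀ := by
    filter_upwards [A.isOpen.mem_nhds hx] with y hy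
    rw [hA.a₀_eq hy, hA.radius_eq h hy huv, middleSphere]
  have h0 := A.area_ne_zero hE hx huv
  refine ⟨(h.skewSq_nonneg hx huv).lt_of_ne fun h1 => h0 ?_, ?_⟩
  · have g := h.gramDet_middleSphere hx huv
    rw [gramDet, e.fderiv_eq, ← gramDet, A.gramDet_eq hx, ← h1] at g
    simpa using g
  · rw [laplaceDensity_congr e, A.laplaceDensity_eq hx h0]

end MiddleSphere

/-! ### The first variation of the Weingarten functional -/

section Weingarten

lemma linearIndependent_single : LinearIndependent ℝ
    ![(EuclideanSpace.single 0 1 : E2), EuclideanSpace.single 1 1] := by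
  rw [LinearIndependent.pair_iff]
  intro a b h
  have h0 := congrArg (fun y : E2 => y 0) h
  have h1 := congrArg (fun y : E2 => y 1) h
  simp at h0 h1
  exact ⟨h0, h1⟩

lemma weingartenDensity_eq {f n : E2 → E3} {x : E2}
    (h : thirdDet n (EuclideanSpace.single 0 1) (EuclideanSpace.single 1 1) x ≠ 0) :
    weingartenDensity f n x
      = skewSq f n (EuclideanSpace.single 0 1) (EuclideanSpace.single 1 1) x
        * √(thirdDet n (EuclideanSpace.single 0 1) (EuclideanSpace.single 1 1) x) := by
  have hd : (derivGram n n x).det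
      = thirdDet n (EuclideanSpace.single 0 1) (EuclideanSpace.single 1 1) x := by
    rw [Matrix.det_fin_two, thirdDet]
    simp only [derivGram, Matrix.of_apply]
    rw [real_inner_comm (fderiv ℝ n x (EuclideanSpace.single 0 1))
      (fderiv ℝ n x (EuclideanSpace.single 1 1))]
    ring
  rw [weingartenDensity, Matrix.inv_def, hd, Ring.inverse_eq_inv', skewSq, shapeTrace, shapeDet]
  congr 1
  rw [Matrix.det_fin_two, Matrix.trace_fin_two, Matrix.adjugate_fin_two]
  simp only [Matrix.mul_apply, Fin.sum_univ_two, Matrix.smul_apply, Matrix.of_apply,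
    Matrix.cons_val', Matrix.cons_val_zero, Matrix.cons_val_one, Matrix.cons_val_fin_one, derivGram,
    smul_eq_mul]
  set d := thirdDet n (EuclideanSpace.single 0 1) (EuclideanSpace.single 1 1) x with hdef
  rw [thirdDet] at hdef
  rw [real_inner_comm (fderiv ℝ n x (EuclideanSpace.single 0 1))
    (fderiv ℝ n x (EuclideanSpace.single 1 1))]
  field_simp
  rw [hdef]
  ring

namespace IsLegendreVariation

variable {D K : Set E2} {f n : E2 → E3} {ε : ℝ} {ft nt : ℝ → E2 → E3}
  (h : IsLegendreVariation D f n K ε ft nt) (hD : IsOpen D)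
include h hD

lemma fderiv_f {t : ℝ} (ht : t ∈ Ioo (-ε) ε) {x : E2} (hx : x ∈ D) (w : E2) :
    fderiv ℝ (ft t) x w = fderiv ℝ (fun y : ℝ × E2 => ft y.1 y.2) (t, x) (0, w) :=
  fderiv_slice (g := fun y : ℝ × E2 => ft y.1 y.2)
    (CoordFrame.differentiableAt_of_contDiffOn h.smooth_f ⟨ht, hx⟩ (isOpen_Ioo.prod hD)) w

lemma fderiv_n {t : ℝ} (ht : t ∈ Ioo (-ε) ε) {x : E2} (hx : x ∈ D) (w : E2) :
    fderiv ℝ (nt t) x w = fderiv ℝ (fun y : ℝ × E2 => nt y.1 y.2) (t, x) (0, w) :=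
  fderiv_slice (g := fun y : ℝ × E2 => nt y.1 y.2)
    (CoordFrame.differentiableAt_of_contDiffOn h.smooth_n ⟨ht, hx⟩ (isOpen_Ioo.prod hD)) w

lemma isLegendreOn {t : ℝ} (ht : t ∈ Ioo (-ε) ε) : IsLegendreOn D (ft t) (nt t) where
  isOpen := hD
  smooth_f := h.smooth_f.comp (contDiff_const.prodMk contDiff_id).contDiffOn fun _ hx => ⟨ht, hx⟩
  smooth_n := h.smooth_n.comp (contDiff_const.prodMk contDiff_id).contDiffOn fun _ hx => ⟨ht, hx⟩
  norm_n := h.norm_n t ht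
  contact := h.contact t ht
  immersive := fun x hx w hw => by_contra fun h0 => h.immersive t ht x hx w h0 hw

/-- The first variation of the Weingarten functional: the functional is the area of the middle
sphere map. -/
theorem hasDerivAt_weingarten
    (hpos : ∀ x ∈ D, 0 < skewSq f n (EuclideanSpace.single 0 1) (EuclideanSpace.single 1 1) x) :
    HasDerivAt (fun t => ∫ x in K, weingartenDensity (ft t) (nt t) x)
      (-∫ x in K, lorentz
        (laplaceDensity (middleSphere f n (EuclideanSpace.single 0 1) (EuclideanSpace.single 1 1))
          (EuclideanSpace.single 0 1) (EuclideanSpace.single 1 1) x)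
        (fderiv ℝ (middleSphere (fun y : ℝ × E2 => ft y.1 y.2) (fun y : ℝ × E2 => nt y.1 y.2)
          (0, EuclideanSpace.single 0 1) (0, EuclideanSpace.single 1 1)) (0, x) (1, 0))) 0 := by
  have huv := linearIndependent_single
  set u : E2 := EuclideanSpace.single 0 1
  set v : E2 := EuclideanSpace.single 1 1
  set ff : ℝ × E2 → E3 := fun y => ft y.1 y.2 with hff
  set nn : ℝ × E2 → E3 := fun y => nt y.1 y.2 with hnn
  set X := middleSphere ff nn (0, u) (0, v) with hX
  set I := Ioo (-ε) ε
  have hO : IsOpen (I ×ˢ D) := isOpen_Ioo.prod hD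
  have hm : (0 : ℝ) ∈ I := ⟨by linarith [h.pos], h.pos⟩
  have ef := fun {t} (ht : t ∈ I) {x} (hx : x ∈ D) => h.fderiv_f hD ht hx
  have en := fun {t} (ht : t ∈ I) {x} (hx : x ∈ D) => h.fderiv_n hD ht hx
  have L := fun {t} (ht : t ∈ I) => h.isLegendreOn hD ht
  have e1 : ∀ {t}, t ∈ I → ∀ {x}, x ∈ D →
      thirdDet (nt t) u v x = thirdDet nn (0, u) (0, v) (t, x) := fun ht x hx => by
    simp only [thirdDet, en ht hx, hnn]
  have e2 : ∀ {t}, t ∈ I → ∀ {x}, x ∈ D →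
      shapeTrace (ft t) (nt t) u v x = shapeTrace ff nn (0, u) (0, v) (t, x) := fun ht x hx => by
    simp only [shapeTrace, e1 ht hx, en ht hx, ef ht hx, hnn, hff]
  have e3 : ∀ {t}, t ∈ I → ∀ {x}, x ∈ D →
      skewSq (ft t) (nt t) u v x = skewSq ff nn (0, u) (0, v) (t, x) := fun ht x hx => by
    simp only [skewSq, shapeDet, e2 ht hx, e1 ht hx, en ht hx, ef ht hx, hnn, hff]
  have e4 : ∀ {t}, t ∈ I → ∀ {x}, x ∈ D →
      middleSphere (ft t) (nt t) u v x = X (t, x) := fun ht x hx => by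
    simp only [middleSphere, hX, e2 ht hx, hff, hnn]
  have pos3 : ∀ y ∈ I ×ˢ D, 0 < thirdDet nn (0, u) (0, v) y := fun y hy => by
    have := (L hy.1).thirdDet_pos hy.2 huv
    rwa [e1 hy.1 hy.2] at this
  have s3 := contDiffOn_thirdDet hO h.smooth_n (0, u) (0, v)
  have sT := contDiffOn_shapeTrace hO h.smooth_f h.smooth_n fun y hy => (pos3 y hy).ne'
  have sS := contDiffOn_skewSq hO h.smooth_f h.smooth_n fun y hy => (pos3 y hy).ne'
  have sX : ContDiffOn ℝ ∞ X (I ×ˢ D) := spherePointLin.contDiff.comp_contDiffOn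
    ((h.smooth_f.add ((sT.neg.div_const 2).smul h.smooth_n)).prodMk (sT.neg.div_const 2))
  have germ : ∀ {g g' : E2 → E3}, (∀ x ∈ D, g x = g' x) → ∀ x ∈ D, fderiv ℝ g x = fderiv ℝ g' x :=
    fun hg x hx => Filter.EventuallyEq.fderiv_eq (by
      filter_upwards [hD.mem_nhds hx] with y hy using hg y hy)
  have germf := germ fun x hx => (h.start x hx).1
  have germn := germ fun x hx => (h.start x hx).2
  have z2 : ∀ x ∈ D, shapeTrace (ft 0) (nt 0) u v x = shapeTrace f n u v x := fun x hx => by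
    simp only [shapeTrace, thirdDet, germf x hx, germn x hx]
  have z3 : ∀ x ∈ D, skewSq (ft 0) (nt 0) u v x = skewSq f n u v x := fun x hx => by
    simp only [skewSq, shapeDet, z2 x hx, thirdDet, germf x hx, germn x hx]
  have z4 : ∀ x ∈ D, X (0, x) = middleSphere f n u v x := fun x hx => by
    rw [← e4 hm hx]
    simp only [middleSphere, z2 x hx, (h.start x hx).1, (h.start x hx).2]
  have main := hasDerivAt_area (μ := MeasureTheory.volume) hD h.compact h.subset h.pos (u := u)
    (v := v) (X := X)
    (W := fun y => skewSq ff nn (0, u) (0, v) y * √(thirdDet nn (0, u) (0, v) y)) sX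
    (sS.mul (s3.sqrt fun y hy => (pos3 y hy).ne')) ?_ ?_ ?_
  · refine (main.congr_of_eventuallyEq ?_).congr_deriv ?_
    · filter_upwards [isOpen_Ioo.mem_nhds hm] with t ht
      refine MeasureTheory.setIntegral_congr_fun h.compact.measurableSet fun x hx => ?_
      have hx := h.subset hx
      rw [weingartenDensity_eq ((L ht).thirdDet_pos hx huv).ne', e3 ht hx, e1 ht hx]
    · congr 1
      refine MeasureTheory.setIntegral_congr_fun h.compact.measurableSet fun x hx => ?_
      have hx := h.subset hx
      have : (fun y => X (0, y)) =ᶠ[nhds x] middleSphere f n u v := by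
        filter_upwards [hD.mem_nhds hx] with y hy using z4 y hy
      rw [laplaceDensity_congr this]
  · rintro ⟨t, x⟩ ⟨ht, hx⟩
    have g := (L ht).gramDet_middleSphere hx huv
    have e : gramDet (middleSphere (ft t) (nt t) u v) u v x = gramDet X (0, u) (0, v) (t, x) := by
      have hg : middleSphere (ft t) (nt t) u v =ᶠ[nhds x] fun y => X (t, y) := by
        filter_upwards [hD.mem_nhds hx] with y hy using e4 ht hy
      have dX := CoordFrame.differentiableAt_of_contDiffOn sX (x := (t, x)) ⟨ht, hx⟩ hO
      simp only [gramDet, hg.fderiv_eq, fderiv_slice dX]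
    rw [← e, g, e3 ht hx, e1 ht hx, mul_pow, Real.sq_sqrt (pos3 (t, x) ⟨ht, hx⟩).le]
  · intro x hx
    have := hpos x hx
    rw [← z3 x hx, e3 hm hx] at this
    exact mul_pos this (Real.sqrt_pos.2 (pos3 (0, x) ⟨hm, hx⟩))
  · intro t ht x hx
    have hoD : IsOpen (D \ K) := hD.sdiff h.compact.isClosed
    have g1 : fderiv ℝ (ft t) x = fderiv ℝ f x := Filter.EventuallyEq.fderiv_eq (by
      filter_upwards [hoD.mem_nhds hx] with y hy using (h.support t ht y hy).1)
    have g2 : fderiv ℝ (nt t) x = fderiv ℝ n x := Filter.EventuallyEq.fderiv_eq (by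
      filter_upwards [hoD.mem_nhds hx] with y hy using (h.support t ht y hy).2)
    rw [z4 x hx.1, ← e4 ht hx.1]
    simp only [middleSphere, shapeTrace, thirdDet, g1, g2, (h.support t ht x hx).1,
      (h.support t ht x hx).2]

end IsLegendreVariation

end Weingarten

/-! ### L-minimality and the vanishing of `P` -/

section NormalVariation

open MeasureTheory

/-- A variation of a Legendre immersion with fixed normal is given by a function `ψ`: the vector
field `Z` has normal component `ψ`, and its tangential component is determined by the contact
condition. -/
lemma exists_support_field {D : Set E2} {f n : E2 → E3} (h : IsLegendreOn D f n) {ψ : E2 → ℝ}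
    (hψ : ContDiff ℝ ∞ ψ) :
    ∃ Z : E2 → E3, ContDiffOn ℝ ∞ Z D ∧ (∀ x ∈ D, ⟪n x, Z x⟫_ℝ = ψ x) ∧
      (∀ x ∈ D, ∀ w, ⟪fderiv ℝ Z x w, n x⟫_ℝ = 0) ∧ ∀ x ∈ D, x ∉ tsupport ψ → Z x = 0 := by
  have huv := linearIndependent_single
  set u : E2 := EuclideanSpace.single 0 1
  set v : E2 := EuclideanSpace.single 1 1
  have sn := fun w => contDiffOn_fderiv_apply h.isOpen h.smooth_n w
  have sψ := fun w => (contDiffOn_fderiv_apply isOpen_univ hψ.contDiffOn w).mono (subset_univ D)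
  have s3 := contDiffOn_thirdDet h.isOpen h.smooth_n u v
  have g := fun w w' => (sn w).inner ℝ (sn w')
  have h0 : ∀ x ∈ D, thirdDet n u v x ≠ 0 := fun x hx => (h.thirdDet_pos hx huv).ne'
  set α : E2 → ℝ := fun x => (fderiv ℝ ψ x u * ⟪fderiv ℝ n x v, fderiv ℝ n x v⟫_ℝ
    - fderiv ℝ ψ x v * ⟪fderiv ℝ n x u, fderiv ℝ n x v⟫_ℝ) / thirdDet n u v x with hα
  set β : E2 → ℝ := fun x => (fderiv ℝ ψ x v * ⟪fderiv ℝ n x u, fderiv ℝ n x u⟫_ℝ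
    - fderiv ℝ ψ x u * ⟪fderiv ℝ n x u, fderiv ℝ n x v⟫_ℝ) / thirdDet n u v x with hβ
  have sα : ContDiffOn ℝ ∞ α D := (((sψ u).mul (g v v)).sub ((sψ v).mul (g u v))).div s3 h0
  have sβ : ContDiffOn ℝ ∞ β D := (((sψ v).mul (g u u)).sub ((sψ u).mul (g u v))).div s3 h0
  set T : E2 → E3 := fun x => α x • fderiv ℝ n x u + β x • fderiv ℝ n x v with hT
  have sT : ContDiffOn ℝ ∞ T D := (sα.smul (sn u)).add (sβ.smul (sn v))
  have sZ : ContDiffOn ℝ ∞ (fun x => ψ x • n x + T x) D :=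
    (hψ.contDiffOn.smul h.smooth_n).add sT
  have hnT : ∀ x ∈ D, ⟪n x, T x⟫_ℝ = 0 := by
    intro x hx
    rw [real_inner_comm]
    simp only [hT, inner_add_left, inner_smul_left, h.inner_fderiv_n hx]
    simp
  have hnZ : ∀ x ∈ D, ⟪n x, ψ x • n x + T x⟫_ℝ = ψ x := by
    intro x hx
    rw [inner_add_right, inner_smul_right, h.inner_n hx, hnT x hx]
    ring
  have hTu : ∀ x ∈ D, ⟪T x, fderiv ℝ n x u⟫_ℝ = fderiv ℝ ψ x u := by
    intro x hx
    have := h0 x hx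
    simp only [hT, hα, hβ, inner_add_left, inner_smul_left, RCLike.conj_to_real]
    rw [real_inner_comm (fderiv ℝ n x u) (fderiv ℝ n x v)]
    field_simp
    rw [thirdDet]
    ring
  have hTv : ∀ x ∈ D, ⟪T x, fderiv ℝ n x v⟫_ℝ = fderiv ℝ ψ x v := by
    intro x hx
    have := h0 x hx
    simp only [hT, hα, hβ, inner_add_left, inner_smul_left, RCLike.conj_to_real]
    field_simp
    rw [thirdDet]
    ring
  refine ⟨_, sZ, hnZ, fun x hx w => ?_, fun x hx hxs => ?_⟩
  · have dZ := CoordFrame.differentiableAt_of_contDiffOn sZ hx h.isOpen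
    have h1 := fderiv_inner_apply ℝ dZ (h.differentiableAt_n hx) w
    have h2 : (fun y => ⟪ψ y • n y + T y, n y⟫_ℝ) =ᶠ[nhds x] ψ := by
      filter_upwards [h.isOpen.mem_nhds hx] with y hy
      rw [real_inner_comm]
      exact hnZ y hy
    rw [h2.fderiv_eq] at h1
    have h3 : ⟪ψ x • n x + T x, fderiv ℝ n x w⟫_ℝ = fderiv ℝ ψ x w := by
      have hw : w = w 0 • u + w 1 • v := by
        ext i
        fin_cases i <;> simp [u, v]
      rw [inner_add_left, inner_smul_left, real_inner_comm, h.inner_fderiv_n hx, mul_zero, zero_add]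
      rw [hw, map_add, map_add, map_smul, map_smul, map_smul, map_smul, inner_add_right,
        inner_smul_right, inner_smul_right, hTu x hx, hTv x hx]
      rfl
    linarith
  · have e : ψ =ᶠ[nhds x] fun _ => 0 := notMem_tsupport_iff_eventuallyEq.1 hxs
    simp [hT, hα, hβ, e.fderiv_eq, e.self_of_nhds]

/-- A Legendre immersion with a middle frame is not critical if `P` does not vanish. -/
theorem exists_noncritical_variation {D : Set E2} {f n : E2 → E3} (h : IsLegendreOn D f n)
    (A : CoordFrame D) (hA : A.Along f n) {x₀ : E2} (hx₀ : x₀ ∈ D) (hP : A.P x₀ ≠ 0) :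
    ∃ (K : Set E2) (ε : ℝ) (ft nt : ℝ → E2 → E3), IsLegendreVariation D f n K ε ft nt ∧
      ¬ HasDerivAt (fun t => ∫ x in K, weingartenDensity (ft t) (nt t) x) 0 0 := by
  have hU : {x | x ∈ D ∧ 0 < A.P x * A.P x₀} ∈ nhds x₀ := by
    have hc : ContinuousAt (fun x => A.P x * A.P x₀) x₀ :=
      (A.smooth_P.continuousOn.continuousAt (h.isOpen.mem_nhds hx₀)).mul continuousAt_const
    filter_upwards [h.isOpen.mem_nhds hx₀,
      hc.eventually (lt_mem_nhds (mul_self_pos.2 hP))] with y hy hy' using ⟨hy, hy'⟩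
  obtain ⟨ψ, hψU, hψc, hψ, hψr, hψ1⟩ := exists_contDiff_tsupport_subset (n := ⊤) hU
  have hψ : ContDiff ℝ ∞ ψ := hψ
  have hψ0 : ∀ x, 0 ≤ ψ x := fun x => (hψr ⟨x, rfl⟩).1
  obtain ⟨Z, sZ, hnZ, hZn, hZ0⟩ := exists_support_field h hψ
  set K := tsupport ψ
  have hKD : K ⊆ D := fun x hx => (hψU hx).1
  have hvar : IsLegendreVariation D f n K 1 (fun t x => f x + t • Z x) (fun _ => n) := {
    pos := one_pos
    compact := hψc
    subset := hKD
    smooth_f := (h.smooth_f.comp contDiffOn_snd fun _ hy => hy.2).add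
      (contDiffOn_fst.smul (sZ.comp contDiffOn_snd fun _ hy => hy.2))
    smooth_n := h.smooth_n.comp contDiffOn_snd fun _ hy => hy.2
    norm_n := fun _ _ => h.norm_n
    contact := fun t _ x hx w => by
      rw [fderiv_fun_add (h.differentiableAt_f hx)
        ((CoordFrame.differentiableAt_of_contDiffOn sZ hx h.isOpen).fun_const_smul t),
        fderiv_fun_const_smul (CoordFrame.differentiableAt_of_contDiffOn sZ hx h.isOpen)]
      rw [add_apply, smul_apply, inner_add_left, inner_smul_left, h.contact x hx, hZn x hx]
      simp
    immersive := fun _ _ x hx w hw h0 => hw (h.immersive x hx w h0)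
    start := fun x _ => by simp
    support := fun t _ x hx => by simp [hZ0 x hx.1 hx.2] }
  refine ⟨K, 1, _, _, hvar, fun hd => ?_⟩
  have huv := linearIndependent_single
  have L := fun x (hx : x ∈ D) => hA.middleSphere_laplaceDensity finrank_E2 h hx huv
  have main := hvar.hasDerivAt_weingarten h.isOpen fun x hx => (L x hx).1
  have zero := main.unique hd
  set u : E2 := EuclideanSpace.single 0 1
  set v : E2 := EuclideanSpace.single 1 1
  set ff : ℝ × E2 → E3 := fun y => f y.2 + y.1 • Z y.2 with hff
  set nn : ℝ × E2 → E3 := fun y => n y.2 with hnn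
  have hO : IsOpen (Ioo (-1 : ℝ) 1 ×ˢ D) := isOpen_Ioo.prod h.isOpen
  have hm : ∀ x ∈ D, ((0 : ℝ), x) ∈ Ioo (-1 : ℝ) 1 ×ˢ D := fun x hx => ⟨by norm_num, hx⟩
  have pos3 : ∀ y ∈ Ioo (-1 : ℝ) 1 ×ˢ D, thirdDet nn (0, u) (0, v) y ≠ 0 := by
    rintro ⟨t, x⟩ ⟨ht, hx⟩
    have := (h.thirdDet_pos hx huv).ne'
    have en : ∀ w, fderiv ℝ n x w = fderiv ℝ nn (t, x) (0, w) := hvar.fderiv_n h.isOpen ht hx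
    simpa only [thirdDet, en] using this
  have sT := contDiffOn_shapeTrace hO hvar.smooth_f hvar.smooth_n pos3
  -- the variation field has scalar product `ψ` with the null direction `spherePoint n 1`
  have hV : ∀ x ∈ D, lorentz (A.a 0 x)
      (fderiv ℝ (middleSphere ff nn (0, u) (0, v)) (0, x) (1, 0)) = A.scale x * ψ x := by
    intro x hx
    have df := CoordFrame.differentiableAt_of_contDiffOn hvar.smooth_f (hm x hx) hO
    have dn := CoordFrame.differentiableAt_of_contDiffOn hvar.smooth_n (hm x hx) hO
    have ds := CoordFrame.differentiableAt_of_contDiffOn (sT.neg.div_const 2) (hm x hx) hO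
    set s : ℝ × E2 → ℝ := fun y => -shapeTrace ff nn (0, u) (0, v) y / 2 with hs
    have e := (hasFDerivAt_spherePoint (df.fun_add (ds.fun_smul dn)) ds ((1 : ℝ), (0 : E2))).2
    have e' : fderiv ℝ (middleSphere ff nn (0, u) (0, v)) (0, x) (1, 0) = _ := e
    have f1 : fderiv ℝ ff (0, x) (1, 0) = Z x := by
      refine (hasDerivAt_slice df).unique ?_
      have := ((hasDerivAt_id (0 : ℝ)).smul_const (Z x)).const_add (f x)
      simpa using this
    have n1 : fderiv ℝ nn (0, x) (1, 0) = 0 :=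
      (hasDerivAt_slice dn).unique (hasDerivAt_const 0 (n x))
    rw [e', (df.hasFDerivAt.fun_add (ds.hasFDerivAt.fun_smul dn.hasFDerivAt)).fderiv,
      hA.a_zero_eq hx, lorentz_smul_left, lorentz_spherePoint]
    simp only [add_apply, smul_apply, ContinuousLinearMap.smulRight_apply]
    erw [f1, n1]
    rw [smul_zero, zero_add, inner_add_right, inner_smul_right, hnZ x hx]
    have : ⟪n x, nn (0, x)⟫_ℝ = 1 := h.inner_n hx
    rw [this]
    ring
  have hint : ∫ x in K, √(gramDet A.a₀ u v x) * A.P x * (A.scale x * ψ x) = 0 := by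
    rw [← neg_eq_zero, ← zero]
    congr 1
    refine setIntegral_congr_fun hψc.measurableSet fun x hx => ?_
    have hx := hKD hx
    rw [(L x hx).2, lorentz_smul_left, hV x hx]
  have hint' : ∫ x in K, A.P x₀ * (√(gramDet A.a₀ u v x) * A.P x * (A.scale x * ψ x)) = 0 := by
    rw [integral_const_mul, hint, mul_zero]
  have sg : ContDiffOn ℝ ∞ (gramDet A.a₀ u v) D :=
    ((A.smooth_area u v).pow 2).congr fun x hx => A.gramDet_eq hx u v
  have hcont : ContinuousOn
      (fun x => A.P x₀ * (√(gramDet A.a₀ u v x) * A.P x * (A.scale x * ψ x))) K := by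
    refine ContinuousOn.mono ?_ hKD
    exact continuousOn_const.mul ((sg.continuousOn.sqrt.mul A.smooth_P.continuousOn).mul
      (A.smooth_scale.continuousOn.mul hψ.continuous.continuousOn))
  have hfac : ∀ x ∈ K, 0 < A.P x₀ * (√(gramDet A.a₀ u v x) * A.P x * A.scale x) := by
    intro x hx
    have h1 := (hψU hx).2
    have h2 := A.scale_pos (hKD hx)
    have h3 : 0 < √(gramDet A.a₀ u v x) := by
      rw [A.gramDet_eq (hKD hx)]
      have := A.area_ne_zero finrank_E2 (hKD hx) huv
      positivity
    have e : A.P x₀ * (√(gramDet A.a₀ u v x) * A.P x * A.scale x)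
        = A.P x * A.P x₀ * (√(gramDet A.a₀ u v x) * A.scale x) := by ring
    rw [e]
    positivity
  have hnn' : ∀ x ∈ K, 0 ≤ A.P x₀ * (√(gramDet A.a₀ u v x) * A.P x * (A.scale x * ψ x)) := by
    intro x hx
    have := mul_nonneg (hfac x hx).le (hψ0 x)
    linarith
  rw [setIntegral_eq_zero_iff_of_nonneg_ae
    ((ae_restrict_iff' hψc.measurableSet).2 (Filter.Eventually.of_forall hnn'))
    (hcont.integrableOn_compact hψc)] at hint'
  have hae := (ae_restrict_iff' hψc.measurableSet).1 hint'
  have hO' : IsOpen {x | 0 < ψ x} := isOpen_lt continuous_const hψ.continuous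
  have hpos : 0 < volume {x | 0 < ψ x} := hO'.measure_pos _ ⟨x₀, by simp [hψ1]⟩
  refine hpos.ne' (measure_mono_null (fun x hx => ?_) hae)
  have hx : 0 < ψ x := hx
  have hxK : x ∈ K := subset_tsupport _ hx.ne'
  intro h0
  have := h0 hxK
  have h4 := mul_pos (hfac x hxK) hx
  simp only [Pi.zero_apply] at this
  linarith

end NormalVariation

section Minimal

variable {M : Type*} [TopologicalSpace M] [ChartedSpace E2 M]

lemma isSmoothChart_of_mem_maximalAtlas {e : OpenPartialHomeomorph M E2}
    (he : e ∈ IsManifold.maximalAtlas (𝓡 2) ∞ M) : IsSmoothChart e :=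
  ⟨contMDiffOn_of_mem_maximalAtlas he, contMDiffOn_symm_of_mem_maximalAtlas he⟩

variable [IsManifold (𝓡 2) ∞ M] {F : LegendreImmersion M}

/-- The Laplacian of the middle sphere map is `P a₁`, so that every first variation vanishes with
`P`. -/
theorem isLMinimal_of_mean_zero (hex : ∀ p : M, ∃ A : MiddleFrame F, p ∈ A.dom)
    (hP : ∀ p, F.meanInvariant p = 0) : F.IsLMinimal := by
  intro e he K ε ft nt hvar
  have hz := isSmoothChart_of_mem_maximalAtlas he
  have huv := linearIndependent_single
  have key : ∀ x ∈ e.target,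
      0 < skewSq (F.f ∘ e.symm) (F.n ∘ e.symm) (EuclideanSpace.single 0 1)
        (EuclideanSpace.single 1 1) x ∧
      laplaceDensity (middleSphere (F.f ∘ e.symm) (F.n ∘ e.symm) (EuclideanSpace.single 0 1)
        (EuclideanSpace.single 1 1)) (EuclideanSpace.single 0 1) (EuclideanSpace.single 1 1) x
        = 0 := by
    intro x hx
    obtain ⟨A, hA⟩ := hex (e.symm x)
    have hL := (F.isLegendreOn hz).mono (A.coord hz).isOpen inter_subset_left
    obtain ⟨h1, h2⟩ := (A.coord_along hz).middleSphere_laplaceDensity finrank_E2 hL ⟨hx, hA⟩ huv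
    have h3 := A.coord_P hz (e.map_target hx)
    rw [e.right_inv hx, ← A.meanInvariant_eq hA, hP] at h3
    exact ⟨h1, by rw [h2, h3, mul_zero, zero_smul]⟩
  refine (hvar.hasDerivAt_weingarten e.open_target fun x hx => (key x hx).1).congr_deriv ?_
  rw [neg_eq_zero]
  refine MeasureTheory.setIntegral_eq_zero_of_forall_eq_zero fun x hx => ?_
  rw [(key x (hvar.subset hx)).2, lorentz_zero_left]

/-- Near a point with `P ≠ 0` a suitable bump variation has non-zero first variation. -/
theorem mean_zero_of_isLMinimal (hex : ∀ p : M, ∃ A : MiddleFrame F, p ∈ A.dom)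
    (h : F.IsLMinimal) (p : M) : F.meanInvariant p = 0 := by
  by_contra hp
  obtain ⟨A, hA⟩ := hex p
  set e := (chartAt E2 p).restr A.dom with he
  have hmem : e ∈ IsManifold.maximalAtlas (𝓡 2) ∞ M :=
    restr_mem_maximalAtlas _ (IsManifold.chart_mem_maximalAtlas p) A.isOpen_dom
  have hz := isSmoothChart_of_mem_maximalAtlas hmem
  have hsrc : e.source ⊆ A.dom := fun q hq => by
    have := hq.2
    rwa [A.isOpen_dom.interior_eq] at this
  have hpe : p ∈ e.source := ⟨mem_chart_source E2 p, by rwa [A.isOpen_dom.interior_eq]⟩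
  have hD : e.target ⊆ e.target ∩ e.symm ⁻¹' A.dom := fun x hx => ⟨hx, hsrc (e.map_target hx)⟩
  set B := (A.coord hz).restrict e.open_target hD
  have hB : B.Along (F.f ∘ e.symm) (F.n ∘ e.symm) := fun x hx => A.coord_along hz x (hD hx)
  have hBP : B.P (e p) ≠ 0 := by
    have h3 := A.coord_P hz hpe
    rw [← A.meanInvariant_eq hA] at h3
    intro h0
    exact hp (h3.symm.trans h0)
  obtain ⟨K, ε, ft, nt, hvar, hnot⟩ := exists_noncritical_variation (F.isLegendreOn hz) B hB
    (e.map_source hpe) hBP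
  exact hnot (h e hmem K ε ft nt hvar)

end Minimal

end Laguerre

end

theorem proposition3p5 {M : Type*} [TopologicalSpace M] [T2Space M] [ConnectedSpace M]
    [ChartedSpace Laguerre.E2 M] [IsManifold (𝓡 2) ∞ M]
    (F : Laguerre.LegendreImmersion M) (hF : F.IsNondegenerate) :
    -- characterization with a Blaschke potential and a constant on all of `M`
    (F.IsHolomorphicDifferential 4 F.quarticDifferential ↔
      F.IsLMinimal ∨
        (F.IsLIsothermic ∧ ∃ u : M → ℝ, F.IsBlaschkePotential u ∧
          ∃ c : ℝ, ∀ z : OpenPartialHomeomorph M ℂ,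
            F.IsIsothermicCoordinate z (fun q => Real.exp (u q)) →
              Laguerre.SatisfiesSpecialEquation z u c)) ∧
    -- the same with local Blaschke potentials and local constants
    (F.IsHolomorphicDifferential 4 F.quarticDifferential ↔
      F.IsLMinimal ∨
        (F.IsLIsothermic ∧ ∀ p : M, ∃ z : OpenPartialHomeomorph M ℂ, p ∈ z.source ∧
          ∃ u : M → ℝ, ContMDiffOn (𝓡 2) 𝓘(ℝ, ℝ) ∞ u z.source ∧
            F.IsIsothermicCoordinate z (fun q => Real.exp (u q)) ∧
              ∃ c : ℝ, Laguerre.SatisfiesSpecialEquation z u c)) ∧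
    (F.IsLMinimal →
      ∀ (p : M) (v : TangentSpace (𝓡 2) p), F.quadraticDifferential p v = 0) := by
  have hex := Laguerre.LegendreImmersion.exists_middleFrame hF
  -- the global form of the second alternative contains the local one
  have hloc : (∃ u : M → ℝ, F.IsBlaschkePotential u ∧
      ∃ c : ℝ, ∀ z : OpenPartialHomeomorph M ℂ,
        F.IsIsothermicCoordinate z (fun q => Real.exp (u q)) →
          Laguerre.SatisfiesSpecialEquation z u c) →
      ∀ p : M, ∃ z : OpenPartialHomeomorph M ℂ, p ∈ z.source ∧
        ∃ u : M → ℝ, ContMDiffOn (𝓡 2) 𝓘(ℝ, ℝ) ∞ u z.source ∧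
          F.IsIsothermicCoordinate z (fun q => Real.exp (u q)) ∧
            ∃ c : ℝ, Laguerre.SatisfiesSpecialEquation z u c := by
    rintro ⟨u, ⟨hu, hz⟩, c, hc⟩ p
    obtain ⟨z, hp, hiso⟩ := hz p
    exact ⟨z, hp, u, hu.contMDiffOn, hiso, c, hc z hiso⟩
  have hmin : F.IsLMinimal → F.IsHolomorphicDifferential 4 F.quarticDifferential := fun h =>
    Laguerre.holomorphic_of_mean_zero hex (Laguerre.mean_zero_of_isLMinimal hex h)
  have hfwd : F.IsHolomorphicDifferential 4 F.quarticDifferential → F.IsLMinimal ∨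
      (F.IsLIsothermic ∧ ∃ u : M → ℝ, F.IsBlaschkePotential u ∧
        ∃ c : ℝ, ∀ z : OpenPartialHomeomorph M ℂ,
          F.IsIsothermicCoordinate z (fun q => Real.exp (u q)) →
            Laguerre.SatisfiesSpecialEquation z u c) := by
    intro h
    have hode := Laguerre.hasPOde_of_holomorphic hex h
    rcases Laguerre.mean_zero_or_ne_zero hode with h0 | h0
    · exact Or.inl (Laguerre.isLMinimal_of_mean_zero hex h0)
    · exact Or.inr (Laguerre.exists_blaschkePotential hode h0)
  refine ⟨⟨hfwd, ?_⟩, ⟨fun h => (hfwd h).imp id fun h' => ⟨h'.1, hloc h'.2⟩, ?_⟩, fun h p v => ?_⟩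
  · rintro (h | h)
    · exact hmin h
    · exact Laguerre.holomorphic_of_special_equation (hloc h.2)
  · rintro (h | h)
    · exact hmin h
    · exact Laguerre.holomorphic_of_special_equation h.2
  · obtain ⟨A, hA⟩ := hex p
    have h0 := Laguerre.mean_zero_of_isLMinimal hex h p
    rw [A.meanInvariant_eq hA] at h0
    rw [A.quadraticDifferential_eq hA, Laguerre.MiddleFrame.P, h0]
    simp
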